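/- **Setting.** Let $0\le k\le n$ be integers and $m=n-k+1$. A *system of billiard type* is given by positive periods $a_1,\dots,a_n$, the torus $\mathbb T^n=\prod_{i}\mathbb R/a_i\mathbb Z$ with its uniform probability measure $\lambda$, a piecewise smooth function $F:\mathbb T^n\to\mathbb R$ (Lipschitz, and $C^\infty$ off a closed set of measure zero), and a constant $c$ with $F<c$. The configuration manifold is $M=\{(x,y)\in\mathbb T^n\times\mathbb R: y\ge F(x)\}$ with the Euclidean metric, and $y=c$ is the reference plane. The system is *symmetric* if $F(o+u)=F(o-u)$ for some $o$ and all $u$. Its *flatness parameter* is $h=\sup_x|\mathrm{grad}_xF|^2$ (over the points where $F$ is differentiable). Let $e$ be the last standard basis vector of $\mathbb R^{n+1}$, let $n(x)=(e-\mathrm{grad}_xF)/\sqrt{1+|\mathrm{grad}_xF|^2}$ be the unit normal to the graph of $F$, let $\overline n(x)$ be its orthogonal projection to $\mathbb R^n\times\{0\}$, and let $A$ be the symmetric matrix $A=\int_{\mathbb T^n}\overline n(x)\,\overline n(x)^{\top}\,d\lambda(x)$ on $\mathbb R^{n+1}$. Split $\mathbb R^{n+1}=\mathbb R^k\times\mathbb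 R^m$ into the first $k$ coordinates (hidden velocities) and the last $m$ coordinates (observed velocities), regard both factors as subspaces of $\mathbb R^{n+1}$, let $Q^\curlywedge$ be the orthogonal projection to $\mathbb R^k$, and put $\mathbb H^m_-=\{v\in\mathbb R^m:\langle v,e\rangle<0\}$. For $x\in\mathbb T^n$, $v\in\mathbb H^m_-$, $w\in\mathbb R^k$, let $V(x,v,w)\in\mathbb H_-^m$ be the observed component of the velocity, reflected on the reference plane, with which the billiard trajectory in $M$ (free flight and specular reflection at the graph of $F$) that starts at $(x,c)$ with velocity $w+v$ returns to the reference plane; for exceptional trajectories that hit a point where $F$ is not differentiable, or never return after finitely many collisions, put $V=v$. For a probability measure $\mu$ on $\mathbb R^k$, the scattering operator is $$(P\Phi)(v)=\int_{\mathbb R^k}\int_{\mathbb T^n}\Phi(V(x,v,w))\,d\lambda(x)\,d\mu(w).$$ **Theorem.** Let $\mu$ be a probability measure on $\mathbb R^k$ with mean $0$ and finite second and third moments, and let $C=\int ww^{\top}\,d\mu(w)$, as a matrix on $\mathbb R^{n+1}$. Consider a family of symmetric systems of billiard type (same $n$, $k$ and $\mu$; the periods, $F$ and $c$ may vary) along which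 the flatness parameter $h$ is positive and tends to $0$, write $P_h$ for the scattering operator of the member with flatness parameter $h$, and suppose that the limit $\Lambda=\lim_{h\to0}A/h$ exists. For smooth $\Phi$ on $\mathbb H^m_-$, let $\mathrm{grad}_v\Phi$ and $\mathrm{Hess}_v\Phi$ be the gradient and Hessian at $v$, extended by zero to $\mathbb R^{n+1}$, and put $$\begin{aligned}(\mathcal L\Phi)(v)={}&-4\langle\Lambda\,\mathrm{grad}_v\Phi,v\rangle+\frac{2}{\langle v,e\rangle}\left[\langle\Lambda v,v\rangle+\mathrm{Tr}(C\Lambda)-\mathrm{Tr}(\Lambda)\langle v,e\rangle^2\right]\langle\mathrm{grad}_v\Phi,e\rangle\\&+2\langle v,e\rangle\left[\langle v,e\rangle\mathrm{Tr}(\Lambda\,\mathrm{Hess}_v\Phi)-2\langle\Lambda\,\mathrm{Hess}_v\Phi\,e,v\rangle\right]+2\left(\langle\Lambda v,v\rangle+\mathrm{Tr}(C\Lambda)\right)\langle\mathrm{Hess}_v\Phi\,e,e\rangle.\end{aligned}$$ Then for every smooth $\Phi$ with compact support in $\mathbb H_-^m$, $$\lim_{h\to0}\frac{P_h\Phi-\Phi}{h}=\mathcal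 L\Phi\qquad\text{uniformly on }\mathbb H^m_-.$$ Moreover, if $\mu$ is the Gaussian distribution $d\mu(w)=(2\pi\sigma^2)^{-k/2}e^{-|w|^2/(2\sigma^2)}\,dw$ with $\sigma>0$, then $C=\sigma^2Q^\curlywedge$. -/

import Mathlib

open MeasureTheory Filter Topology
open scoped ContDiff Matrix

noncomputable section

namespace RandomBilliard

/-! ### Euclidean spaces

`EuclideanSpace ℝ d`, with `d` a finite index type of cardinality `n`, is `ℝⁿ`, and
`EuclideanSpace ℝ (d ⊕ Unit)` is `ℝⁿ⁺¹ = ℝⁿ × ℝ`; the index `Sum.inr ()` is that of the last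
basis vector `e = e_{n+1}`. -/

section Deterministic

variable {d : Type} [Fintype d] [DecidableEq d]

/-- The vector `(x, y)` of `ℝⁿ × ℝ`. -/
def vec (x : EuclideanSpace ℝ d) (y : ℝ) : EuclideanSpace ℝ (d ⊕ Unit) :=
  WithLp.toLp 2 (Sum.elim (fun i => x i) (fun _ => y))

/-- The component of a vector of `ℝⁿ × ℝ` in `ℝⁿ`. -/
def horizontal (q : EuclideanSpace ℝ (d ⊕ Unit)) : EuclideanSpace ℝ d :=
  WithLp.toLp 2 (fun i => q (Sum.inl i))

/-- The last coordinate `⟨q, e⟩` of a vector of `ℝⁿ × ℝ`. -/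
def height (q : EuclideanSpace ℝ (d ⊕ Unit)) : ℝ := q (Sum.inr ())

/-- Piecewise smooth (continuous) functions: Lipschitz, and of class `C^∞` off a closed set of
Lebesgue measure zero. -/
def PiecewiseSmooth (F : EuclideanSpace ℝ d → ℝ) : Prop :=
  (∃ K, LipschitzWith K F) ∧
    ∃ S : Set (EuclideanSpace ℝ d), IsClosed S ∧ volume S = 0 ∧ ContDiffOn ℝ ∞ F Sᶜ

variable (d) in
/-- A system of billiard type over the torus `𝕋ⁿ = ∏ᵢ ℝ / aᵢℤ`. The boundary function on the torus
is given as an `aᵢ`-periodic function `F` on `ℝⁿ`; the configuration manifold is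
`{(x, y) | F x ≤ y}` with the Euclidean metric, and `y = c` is the reference plane. -/
structure BilliardSystem where
  /-- the periods `aᵢ` -/
  period : d → ℝ
  period_pos : ∀ i, 0 < period i
  /-- the boundary function -/
  F : EuclideanSpace ℝ d → ℝ
  periodic : ∀ x i, F (x + EuclideanSpace.single i (period i)) = F x
  piecewiseSmooth : PiecewiseSmooth F
  /-- the height of the reference plane -/
  c : ℝ
  F_lt_c : ∀ x, F x < c

namespace BilliardSystem

variable (S : BilliardSystem d)

/-- Symmetry of the boundary function about some origin. -/
def Symmetric : Prop := ∃ o, ∀ u, S.F (o + u) = S.F (o - u)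

/-- The flatness parameter `h = sup |grad F|²`, over the points where `F` is differentiable
(Mathlib's `gradient` is `0` at the other points). -/
def flatness : ℝ := ⨆ x, ‖gradient S.F x‖ ^ 2

/-- The unit normal `n(x) = (e - grad F(x)) / √(1 + |grad F(x)|²)` to the graph of `F`. -/
def normal (x : EuclideanSpace ℝ d) : EuclideanSpace ℝ (d ⊕ Unit) :=
  (√(1 + ‖gradient S.F x‖ ^ 2))⁻¹ • vec (-gradient S.F x) 1

/-- The orthogonal projection `n̄(x)` of `n(x)` to `ℝⁿ`, as a vector of `ℝⁿ⁺¹`. -/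
def normalBar (x : EuclideanSpace ℝ d) : EuclideanSpace ℝ (d ⊕ Unit) :=
  vec (horizontal (S.normal x)) 0

/-- The translation invariant probability measure on the torus, on the fundamental domain
`∏ᵢ [0, aᵢ)`. -/
def uniform : Measure (EuclideanSpace ℝ d) :=
  ProbabilityTheory.cond volume {x | ∀ i, x i ∈ Set.Ico 0 (S.period i)}

/-- The matrix of `A = ∫ n̄(x)* ⊗ n̄(x) dλ(x)`. -/
def A : Matrix (d ⊕ Unit) (d ⊕ Unit) ℝ :=
  Matrix.of fun i j => ∫ x, S.normalBar x i * S.normalBar x j ∂S.uniform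

/-- The point `q` lies in the interior of the configuration manifold. -/
def Above (q : EuclideanSpace ℝ (d ⊕ Unit)) : Prop := S.F (horizontal q) < height q

/-- `Collision s s'`: the free flight `t ↦ q + t ξ` from the state `s = (q, ξ)` meets the boundary
for the first time at a point where the boundary has a normal, and `s'` is the state there after
specular reflection. -/
def Collision (s s' : EuclideanSpace ℝ (d ⊕ Unit) × EuclideanSpace ℝ (d ⊕ Unit)) : Prop :=
  ∃ t : ℝ, 0 < t ∧ (∀ u, 0 < u → u < t → S.Above (s.1 + u • s.2)) ∧
    s'.1 = s.1 + t • s.2 ∧ height s'.1 = S.F (horizontal s'.1) ∧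
    DifferentiableAt ℝ S.F (horizontal s'.1) ∧
    s'.2 = s.2 - (2 * inner ℝ (S.normal (horizontal s'.1)) s.2) • S.normal (horizontal s'.1)

/-- The free flight from the state `s` reaches the reference plane before any collision. -/
def ReachesPlane (s : EuclideanSpace ℝ (d ⊕ Unit) × EuclideanSpace ℝ (d ⊕ Unit)) : Prop :=
  ∃ t : ℝ, 0 < t ∧ height (s.1 + t • s.2) = S.c ∧
    ∀ u, 0 < u → u ≤ t → S.Above (s.1 + u • s.2)

/-- The billiard trajectory that starts at the point `(x, c)` of the reference plane with velocity
`ξ` returns to the reference plane, after finitely many collisions, with a velocity whose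
reflection on the reference plane is `η`. -/
def Returns (x : EuclideanSpace ℝ d) (ξ η : EuclideanSpace ℝ (d ⊕ Unit)) : Prop :=
  ∃ s, Relation.ReflTransGen S.Collision (vec x S.c, ξ) s ∧ S.ReachesPlane s ∧
    η = vec (horizontal s.2) (-height s.2)

open Classical in
/-- The velocity part of the scattering map: the final velocity, reflected back into the lower
half-space, of the trajectory starting at `(x, c)` with velocity `ξ`. It is unique if it exists;
for the exceptional trajectories that run into a singular point of the boundary, or never return,
the velocity is left unchanged. -/
def returnVelocity (x : EuclideanSpace ℝ d) (ξ : EuclideanSpace ℝ (d ⊕ Unit)) :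
    EuclideanSpace ℝ (d ⊕ Unit) :=
  if h : ∃ η, S.Returns x ξ η then h.choose else ξ

end BilliardSystem

end Deterministic

/-! ### Random scattering

The dimensions are `n = k + p` and `m = n - k + 1 = p + 1`: there are `k` hidden velocity components,
with index type `Fin k`, and `m` observed ones, with index type `Fin p ⊕ Unit`. -/

variable {k p : ℕ}

/-- The vector `w + v` of `ℝⁿ⁺¹ = ℝᵏ × ℝᵐ`. -/
def join (w : EuclideanSpace ℝ (Fin k)) (v : EuclideanSpace ℝ (Fin p ⊕ Unit)) :
    EuclideanSpace ℝ ((Fin k ⊕ Fin p) ⊕ Unit) :=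
  vec (WithLp.toLp 2 (Sum.elim (fun i => w i) (fun j => v (Sum.inl j)))) (height v)

/-- The observed component in `ℝᵐ` of a vector of `ℝⁿ⁺¹ = ℝᵏ × ℝᵐ`. -/
def observed (ξ : EuclideanSpace ℝ ((Fin k ⊕ Fin p) ⊕ Unit)) : EuclideanSpace ℝ (Fin p ⊕ Unit) :=
  vec (WithLp.toLp 2 (fun j => ξ (Sum.inl (Sum.inr j)))) (height ξ)

variable (p) in
/-- The open lower half-space of `ℝᵐ`, `m = p + 1`. -/
def lowerHalfSpace : Set (EuclideanSpace ℝ (Fin p ⊕ Unit)) := {v | height v < 0}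

/-- The scattering operator
`(P Φ)(v) = ∫∫ Φ(V(x, v, w)) dλ(x) dμ(w)`, with `V` the observed component of the return velocity. -/
def scatteringOperator (S : BilliardSystem (Fin k ⊕ Fin p)) (μ : Measure (EuclideanSpace ℝ (Fin k)))
    (Φ : EuclideanSpace ℝ (Fin p ⊕ Unit) → ℝ) (v : EuclideanSpace ℝ (Fin p ⊕ Unit)) : ℝ :=
  ∫ w, ∫ x, Φ (observed (S.returnVelocity x (join w v))) ∂S.uniform ∂μ

variable (p) in
/-- The matrix of `C = ∫ w* ⊗ w dμ(w)` on `ℝⁿ⁺¹`, where `ℝᵏ` is a subspace of `ℝⁿ⁺¹`. -/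
def covariance (μ : Measure (EuclideanSpace ℝ (Fin k))) :
    Matrix ((Fin k ⊕ Fin p) ⊕ Unit) ((Fin k ⊕ Fin p) ⊕ Unit) ℝ :=
  Matrix.of fun i j => ∫ w, (join w 0 : EuclideanSpace ℝ ((Fin k ⊕ Fin p) ⊕ Unit)) i *
    (join w 0 : EuclideanSpace ℝ ((Fin k ⊕ Fin p) ⊕ Unit)) j ∂μ

variable (k p) in
/-- The matrix of the orthogonal projection of `ℝⁿ⁺¹` to the subspace `ℝᵏ` of hidden velocities. -/
def hiddenProjection : Matrix ((Fin k ⊕ Fin p) ⊕ Unit) ((Fin k ⊕ Fin p) ⊕ Unit) ℝ :=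
  Matrix.diagonal (Sum.elim (Sum.elim (fun _ => 1) (fun _ => 0)) (fun _ => 0))

variable (k) in
/-- The Gaussian distribution on `ℝᵏ` with temperature parameter `σ²`. -/
def gaussian (σ : ℝ) : Measure (EuclideanSpace ℝ (Fin k)) :=
  volume.withDensity fun w =>
    ENNReal.ofReal (Real.exp (-(1 / 2) * ‖w‖ ^ 2 / σ ^ 2) / (2 * Real.pi * σ ^ 2) ^ ((k : ℝ) / 2))

variable (k) in
/-- `grad_v Φ`, as a vector of `ℝⁿ⁺¹`: `Φ` is viewed as a function on `ℝⁿ⁺¹` that does not depend on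
the hidden component. -/
def grad (Φ : EuclideanSpace ℝ (Fin p ⊕ Unit) → ℝ) (v : EuclideanSpace ℝ (Fin p ⊕ Unit)) :
    (Fin k ⊕ Fin p) ⊕ Unit → ℝ :=
  fun i => gradient (fun ξ : EuclideanSpace ℝ ((Fin k ⊕ Fin p) ⊕ Unit) => Φ (observed ξ)) (join 0 v) i

variable (k) in
/-- `Hess_v Φ`, as a matrix on `ℝⁿ⁺¹`, with the same convention. -/
def hess (Φ : EuclideanSpace ℝ (Fin p ⊕ Unit) → ℝ) (v : EuclideanSpace ℝ (Fin p ⊕ Unit)) :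
    Matrix ((Fin k ⊕ Fin p) ⊕ Unit) ((Fin k ⊕ Fin p) ⊕ Unit) ℝ :=
  Matrix.of fun i j =>
    iteratedFDeriv ℝ 2 (fun ξ : EuclideanSpace ℝ ((Fin k ⊕ Fin p) ⊕ Unit) => Φ (observed ξ)) (join 0 v)
      ![EuclideanSpace.single i 1, EuclideanSpace.single j 1]

variable (k p) in
/-- The last standard basis vector `e` of `ℝⁿ⁺¹`. -/
def basisE : (Fin k ⊕ Fin p) ⊕ Unit → ℝ := Pi.single (Sum.inr ()) 1

/-- The limit operator
`(𝓛Φ)(v) = -4⟨Λ grad Φ, v⟩ + (2/⟨v,e⟩)[⟨Λv,v⟩ + Tr(CΛ) - Tr(Λ)⟨v,e⟩²]⟨grad Φ, e⟩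
  + 2⟨v,e⟩[⟨v,e⟩ Tr(Λ Hess Φ) - 2⟨Λ Hess Φ e, v⟩] + 2(⟨Λv,v⟩ + Tr(CΛ))⟨Hess Φ e, e⟩`. -/
def limitOperator (C Λ : Matrix ((Fin k ⊕ Fin p) ⊕ Unit) ((Fin k ⊕ Fin p) ⊕ Unit) ℝ)
    (Φ : EuclideanSpace ℝ (Fin p ⊕ Unit) → ℝ) (v : EuclideanSpace ℝ (Fin p ⊕ Unit)) : ℝ :=
  let v' : (Fin k ⊕ Fin p) ⊕ Unit → ℝ :=
    fun i => (join 0 v : EuclideanSpace ℝ ((Fin k ⊕ Fin p) ⊕ Unit)) i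
  let e := basisE k p
  let G := grad k Φ v
  let H := hess k Φ v
  (-4) * ((Λ *ᵥ G) ⬝ᵥ v')
    + 2 / (v' ⬝ᵥ e) * ((Λ *ᵥ v') ⬝ᵥ v' + (C * Λ).trace - Λ.trace * (v' ⬝ᵥ e) ^ 2) * (G ⬝ᵥ e)
    + 2 * (v' ⬝ᵥ e) * ((v' ⬝ᵥ e) * (Λ * H).trace - 2 * ((Λ *ᵥ (H *ᵥ e)) ⬝ᵥ v'))
    + 2 * ((Λ *ᵥ v') ⬝ᵥ v' + (C * Λ).trace) * ((H *ᵥ e) ⬝ᵥ e)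

end RandomBilliard

end

noncomputable section

namespace RandomBilliard

/-! ### The space `ℝⁿ × ℝ` -/

section Geometry

variable {d : Type}

/-! Write h for the flatness; the boundary function is then √h-Lipschitz (`abs_F_sub_le`). If
16√h‖ξ‖ is at most the downward speed of ξ, the trajectory collides exactly once
(`returnVelocity_launch`). The map `launch` from collision point to starting point is a small
perturbation of the identity, commutes with the periods and has Jacobian 1 - ⟨grad F, ξ⟩/⟨ξ, e⟩. The
mean over starting points thus becomes a mean over collision points of an explicit function of the
normal (`integral_returnVelocity`).

Expanding that function in n̄ (`abs_launchDet_mul_sub_le`) leaves three parts: one odd in the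
gradient, whose mean vanishes by symmetry; a quadratic form in n̄, whose mean is linear in A; and a
remainder of order h^(3/2), cubic in ‖ξ‖ when the vertical speed is bounded below. The coefficients
of the form are quadratic polynomials in the hidden velocity w, so averaging over w kills the linear
terms by the zero mean and produces C from the second moments (`integral_evenCoeff_join`). The third
moment makes the remainder integrable.

Trajectories with several collisions are never followed. Each reflection raises the vertical
velocity and changes the horizontal one by at most √h times that rise. The rises telescope, so a
return changes the velocity by at most 4√h‖ξ‖ whatever the number of collisions
(`Returns.norm_sub_le`). If the one-collision condition fails near the support of Φ, or if v is far
from that support and Φ(V) does not vanish, then √h(1 + ‖w‖) is bounded below, and its cube absorbs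
the trivial bounds.

Altogether, P_hΦ - Φ is the limit operator with A in place of Λ, up to O(h^(3/2)) uniformly in v
(`exists_abs_scatteringOperator_sub_le`). Division by h finishes the proof, because the limit
operator is linear in its matrix with coefficients bounded in v. -/

@[simp] lemma horizontal_vec (x : EuclideanSpace ℝ d) (y : ℝ) : horizontal (vec x y) = x := by
  ext i; simp [horizontal, vec]

@[simp] lemma height_vec (x : EuclideanSpace ℝ d) (y : ℝ) : height (vec x y) = y := by
  simp [height, vec]

@[simp] lemma vec_horizontal_height (q : EuclideanSpace ℝ (d ⊕ Unit)) :
    vec (horizontal q) (height q) = q := by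
  ext i; rcases i with i | i <;> simp [horizontal, height, vec]

lemma ext_horizontal_height {q q' : EuclideanSpace ℝ (d ⊕ Unit)}
    (h₁ : horizontal q = horizontal q') (h₂ : height q = height q') : q = q' := by
  rw [← vec_horizontal_height q, h₁, h₂, vec_horizontal_height]

@[simp] lemma horizontal_add (q q' : EuclideanSpace ℝ (d ⊕ Unit)) :
    horizontal (q + q') = horizontal q + horizontal q' := by
  ext i; simp [horizontal]

@[simp] lemma horizontal_sub (q q' : EuclideanSpace ℝ (d ⊕ Unit)) :
    horizontal (q - q') = horizontal q - horizontal q' := by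
  ext i; simp [horizontal]

@[simp] lemma horizontal_smul (t : ℝ) (q : EuclideanSpace ℝ (d ⊕ Unit)) :
    horizontal (t • q) = t • horizontal q := by
  ext i; simp [horizontal]

@[simp] lemma height_add (q q' : EuclideanSpace ℝ (d ⊕ Unit)) :
    height (q + q') = height q + height q' := by
  simp [height]

@[simp] lemma height_sub (q q' : EuclideanSpace ℝ (d ⊕ Unit)) :
    height (q - q') = height q - height q' := by
  simp [height]

@[simp] lemma height_smul (t : ℝ) (q : EuclideanSpace ℝ (d ⊕ Unit)) :
    height (t • q) = t * height q := by
  simp [height]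

@[fun_prop] lemma continuous_horizontal :
    Continuous (horizontal : EuclideanSpace ℝ (d ⊕ Unit) → EuclideanSpace ℝ d) := by
  unfold horizontal; fun_prop

@[fun_prop] lemma continuous_height :
    Continuous (height : EuclideanSpace ℝ (d ⊕ Unit) → ℝ) := by
  unfold height; fun_prop

lemma continuous_vec_uncurry :
    Continuous fun z : EuclideanSpace ℝ d × ℝ => vec z.1 z.2 := by
  unfold vec
  refine (PiLp.continuous_toLp 2 _).comp (continuous_pi fun i => ?_)
  rcases i with i | i <;> simp <;> fun_prop

@[fun_prop] lemma Continuous.vec {α : Type*} [TopologicalSpace α] {f : α → EuclideanSpace ℝ d}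
    {g : α → ℝ} (hf : Continuous f) (hg : Continuous g) :
    Continuous fun a => RandomBilliard.vec (f a) (g a) :=
  continuous_vec_uncurry.comp (hf.prodMk hg)

variable [Fintype d]

lemma inner_eq_horizontal_add_height (q q' : EuclideanSpace ℝ (d ⊕ Unit)) :
    inner ℝ q q' = inner ℝ (horizontal q) (horizontal q') + height q * height q' := by
  simp [PiLp.inner_apply, horizontal, height, mul_comm]

lemma norm_sq_eq_horizontal_add_height (q : EuclideanSpace ℝ (d ⊕ Unit)) :
    ‖q‖ ^ 2 = ‖horizontal q‖ ^ 2 + height q ^ 2 := by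
  rw [← real_inner_self_eq_norm_sq, inner_eq_horizontal_add_height, real_inner_self_eq_norm_sq]
  ring

lemma norm_horizontal_le (q : EuclideanSpace ℝ (d ⊕ Unit)) : ‖horizontal q‖ ≤ ‖q‖ := by
  refine le_of_sq_le_sq ?_ (norm_nonneg _)
  rw [norm_sq_eq_horizontal_add_height q]; nlinarith

lemma abs_height_le (q : EuclideanSpace ℝ (d ⊕ Unit)) : |height q| ≤ ‖q‖ := by
  refine abs_le_of_sq_le_sq ?_ (norm_nonneg _)
  rw [norm_sq_eq_horizontal_add_height q]; nlinarith [sq_nonneg ‖horizontal q‖]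

lemma norm_le_horizontal_add_height (q : EuclideanSpace ℝ (d ⊕ Unit)) :
    ‖q‖ ≤ ‖horizontal q‖ + |height q| := by
  refine le_of_sq_le_sq ?_ (by positivity)
  rw [norm_sq_eq_horizontal_add_height q]
  nlinarith [sq_abs (height q), mul_nonneg (norm_nonneg (horizontal q)) (abs_nonneg (height q))]

end Geometry

/-! ### Velocities along billiard trajectories -/

namespace BilliardSystem

variable {d : Type} [Fintype d] [DecidableEq d] (S : BilliardSystem d)

lemma continuous_F : Continuous S.F := S.piecewiseSmooth.1.choose_spec.continuous

/-- The supremum of an unbounded set of reals is 0 by convention, so this is what makes `flatness` a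
genuine bound on the gradient. -/
lemma bddAbove_norm_gradient_sq : BddAbove (Set.range fun x => ‖gradient S.F x‖ ^ 2) := by
  obtain ⟨K, hK⟩ := S.piecewiseSmooth.1
  refine ⟨(K : ℝ) ^ 2, ?_⟩
  rintro _ ⟨x, rfl⟩
  have : ‖gradient S.F x‖ ≤ K := by
    rw [gradient, LinearIsometryEquiv.norm_map]
    exact norm_fderiv_le_of_lipschitz ℝ hK
  exact pow_le_pow_left₀ (norm_nonneg _) this 2

lemma norm_gradient_sq_le (x : EuclideanSpace ℝ d) : ‖gradient S.F x‖ ^ 2 ≤ S.flatness :=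
  le_ciSup S.bddAbove_norm_gradient_sq x

lemma norm_gradient_le (x : EuclideanSpace ℝ d) : ‖gradient S.F x‖ ≤ √S.flatness :=
  Real.le_sqrt_of_sq_le (S.norm_gradient_sq_le x)

lemma height_normal (x : EuclideanSpace ℝ d) :
    height (S.normal x) = (√(1 + ‖gradient S.F x‖ ^ 2))⁻¹ := by
  simp [normal]

lemma height_normal_pos (x : EuclideanSpace ℝ d) : 0 < height (S.normal x) := by
  rw [height_normal]; positivity

lemma horizontal_normal (x : EuclideanSpace ℝ d) :
    horizontal (S.normal x) = -(height (S.normal x) • gradient S.F x) := by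
  rw [height_normal]; simp [normal]

lemma height_normal_sq_mul (x : EuclideanSpace ℝ d) :
    height (S.normal x) ^ 2 * (1 + ‖gradient S.F x‖ ^ 2) = 1 := by
  rw [height_normal, inv_pow, Real.sq_sqrt (by positivity)]
  exact inv_mul_cancel₀ (by positivity)

@[simp] lemma norm_normal (x : EuclideanSpace ℝ d) : ‖S.normal x‖ = 1 := by
  have h : ‖S.normal x‖ ^ 2 = 1 := by
    rw [norm_sq_eq_horizontal_add_height, horizontal_normal, norm_neg, norm_smul, mul_pow,
      Real.norm_eq_abs, sq_abs, ← S.height_normal_sq_mul x]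
    ring
  exact (pow_eq_one_iff_of_nonneg (norm_nonneg _) two_ne_zero).1 h

lemma height_normal_le_one (x : EuclideanSpace ℝ d) : height (S.normal x) ≤ 1 :=
  (le_abs_self _).trans ((abs_height_le _).trans (S.norm_normal x).le)

lemma inner_normal (x : EuclideanSpace ℝ d) (ξ : EuclideanSpace ℝ (d ⊕ Unit)) :
    inner ℝ (S.normal x) ξ =
      height (S.normal x) * (height ξ - inner ℝ (gradient S.F x) (horizontal ξ)) := by
  rw [inner_eq_horizontal_add_height, horizontal_normal, inner_neg_left, real_inner_smul_left]
  ring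

variable {S}

/-- The height above the graph is positive during the flight and zero at the collision, so its
derivative there cannot be positive; that derivative is a positive multiple of the inner product. -/
lemma Collision.inner_normal_nonpos
    {s s' : EuclideanSpace ℝ (d ⊕ Unit) × EuclideanSpace ℝ (d ⊕ Unit)} (h : S.Collision s s') :
    inner ℝ (S.normal (horizontal s'.1)) s.2 ≤ 0 := by
  obtain ⟨t, ht, habove, hpos, hheight, hdiff, -⟩ := h
  rw [S.inner_normal]
  refine mul_nonpos_of_nonneg_of_nonpos (S.height_normal_pos _).le ?_
  set x := horizontal s'.1
  have hg : HasGradientAt S.F (gradient S.F x) x := hdiff.hasGradientAt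
  have hline : HasDerivAt (fun u : ℝ => horizontal s.1 + u • horizontal s.2) (horizontal s.2) t := by
    simpa using ((hasDerivAt_id t).smul_const (horizontal s.2)).const_add (horizontal s.1)
  have hx : x = horizontal s.1 + t • horizontal s.2 := by simp [x, hpos]
  have hF : HasDerivAt (fun u : ℝ => S.F (horizontal s.1 + u • horizontal s.2))
      (inner ℝ (gradient S.F x) (horizontal s.2)) t := by
    have := (hx ▸ hg).hasFDerivAt.comp_hasDerivAt t hline
    simpa [hx, Function.comp_def] using this
  have hf : HasDerivAt (fun u : ℝ => height s.1 + u * height s.2 -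
      S.F (horizontal s.1 + u • horizontal s.2))
      (height s.2 - inner ℝ (gradient S.F x) (horizontal s.2)) t := by
    have := (((hasDerivAt_id t).mul_const (height s.2)).const_add (height s.1)).fun_sub hF
    simpa using this
  have hf0 : height s.1 + t * height s.2 - S.F (horizontal s.1 + t • horizontal s.2) = 0 := by
    rw [← hx]
    have : height s'.1 = height s.1 + t * height s.2 := by simp [hpos]
    rw [← this, hheight, sub_self]
  by_contra hcon
  push Not at hcon
  have hev : ∀ᶠ u in 𝓝[<] t, height s.1 + u * height s.2 -
      S.F (horizontal s.1 + u • horizontal s.2) < 0 := by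
    have hslope := (hasDerivAt_iff_tendsto_slope.1 hf).mono_left
      (nhdsWithin_mono t (fun u (hu : u < t) => hu.ne))
    filter_upwards [hslope.eventually (lt_mem_nhds hcon), self_mem_nhdsWithin] with u hu hut
    rw [slope_def_field, hf0, sub_zero] at hu
    rcases div_pos_iff.1 hu with h | h
    · exact absurd h.2 (not_lt.2 (sub_nonpos.2 (le_of_lt hut)))
    · exact h.1
  have hev2 : ∀ᶠ u in 𝓝[<] t, 0 < u := by
    filter_upwards [mem_nhdsWithin_of_mem_nhds (lt_mem_nhds ht)] with u hu using hu
  obtain ⟨u, ⟨hu1, hu2⟩, hu3⟩ := ((hev.and hev2).and self_mem_nhdsWithin).exists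
  have := habove u hu2 hu3
  simp [Above] at this
  linarith

/-! ### Determinism of the trajectories and the a priori bound on the return velocity -/

lemma le_of_forall_above {s : EuclideanSpace ℝ (d ⊕ Unit) × EuclideanSpace ℝ (d ⊕ Unit)}
    {t₁ t₂ : ℝ} (ht₁ : 0 < t₁) (habove : ∀ u, 0 < u → u < t₂ → S.Above (s.1 + u • s.2))
    (hhit : height (s.1 + t₁ • s.2) = S.F (horizontal (s.1 + t₁ • s.2))) : t₂ ≤ t₁ := by
  by_contra! hlt
  have := habove t₁ ht₁ hlt
  rw [Above, hhit] at this
  exact lt_irrefl _ this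

/-- The flight time is the first hitting time, hence determined by the state, and the reflected
velocity follows from it. -/
lemma rightUnique_collision : Relator.RightUnique S.Collision := by
  rintro s ⟨q₁, ξ₁⟩ ⟨q₂, ξ₂⟩ ⟨t₁, ht₁, ha₁, hq₁, hh₁, -, hξ₁⟩ ⟨t₂, ht₂, ha₂, hq₂, hh₂, -, hξ₂⟩
  simp only at hq₁ hq₂ hh₁ hh₂ hξ₁ hξ₂
  have htt : t₁ = t₂ := le_antisymm (le_of_forall_above ht₂ ha₁ (hq₂ ▸ hh₂))
    (le_of_forall_above ht₁ ha₂ (hq₁ ▸ hh₁))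
  have hqq : q₁ = q₂ := by rw [hq₁, hq₂, htt]
  rw [hξ₁, hξ₂, hqq]

/-- Along a trajectory that starts at the reference plane with downward velocity, the states before
the return to the plane satisfy this condition, which excludes collisions after the return. -/
def Confined (S : BilliardSystem d)
    (s : EuclideanSpace ℝ (d ⊕ Unit) × EuclideanSpace ℝ (d ⊕ Unit)) : Prop :=
  height s.1 < S.c ∨ height s.1 ≤ S.c ∧ height s.2 < 0

lemma Confined.of_collision {s s' : EuclideanSpace ℝ (d ⊕ Unit) × EuclideanSpace ℝ (d ⊕ Unit)}
    (h : S.Collision s s') : S.Confined s' := by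
  obtain ⟨t, -, -, -, hheight, -⟩ := h
  exact Or.inl (hheight ▸ S.F_lt_c _)

lemma Confined.of_reflTransGen
    {s s' : EuclideanSpace ℝ (d ⊕ Unit) × EuclideanSpace ℝ (d ⊕ Unit)}
    (hs : S.Confined s) (h : Relation.ReflTransGen S.Collision s s') : S.Confined s' := by
  rcases h with _ | ⟨-, h⟩
  · exact hs
  · exact Confined.of_collision h

lemma Confined.height_pos_of_reachesPlane
    {s : EuclideanSpace ℝ (d ⊕ Unit) × EuclideanSpace ℝ (d ⊕ Unit)}
    (hs : S.Confined s) (h : S.ReachesPlane s) : height s.1 < S.c ∧ 0 < height s.2 := by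
  obtain ⟨t, ht, hheight, -⟩ := h
  rw [height_add, height_smul] at hheight
  rcases hs with hs | ⟨hs, hs'⟩
  · exact ⟨hs, pos_of_mul_pos_right (by linarith : 0 < t * height s.2) ht.le⟩
  · nlinarith

/-- Before reaching the plane the flight stays in the interior. Afterwards it keeps rising above
height `c`, where the graph cannot be met. -/
lemma Confined.not_collision_of_reachesPlane
    {s s' : EuclideanSpace ℝ (d ⊕ Unit) × EuclideanSpace ℝ (d ⊕ Unit)}
    (hs : S.Confined s) (h : S.ReachesPlane s) : ¬ S.Collision s s' := by
  rintro ⟨t', ht', -, hpos, hheight, -⟩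
  have hpos' := (hs.height_pos_of_reachesPlane h).2
  obtain ⟨t, ht, hplane, habove⟩ := h
  rw [hpos] at hheight
  rcases le_or_gt t' t with htt | htt
  · have := habove t' ht' htt
    rw [Above, hheight] at this
    exact lt_irrefl _ this
  · have h1 := S.F_lt_c (horizontal (s.1 + t' • s.2))
    rw [← hheight, ← hplane, height_add, height_add, height_smul, height_smul] at h1
    nlinarith

lemma confined_initial (S : BilliardSystem d) (x : EuclideanSpace ℝ d)
    {ξ : EuclideanSpace ℝ (d ⊕ Unit)} (hξ : height ξ < 0) : S.Confined (vec x S.c, ξ) :=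
  Or.inr ⟨by simp, hξ⟩

/-- Two chains of collisions from one state are comparable, and the end of the shorter one escapes
to the plane, so it admits no further collision. -/
lemma Returns.unique {x : EuclideanSpace ℝ d} {ξ η η' : EuclideanSpace ℝ (d ⊕ Unit)}
    (hξ : height ξ < 0) (h : S.Returns x ξ η) (h' : S.Returns x ξ η') : η = η' := by
  have key : ∀ s s', S.Confined s → Relation.ReflTransGen S.Collision s s' →
      S.ReachesPlane s → s = s' := by
    intro s s' hs hss hr
    rcases hss.cases_head with h | ⟨s'', h, -⟩
    · exact h
    · exact absurd h (hs.not_collision_of_reachesPlane hr)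
  obtain ⟨s, hs, hr, rfl⟩ := h
  obtain ⟨s', hs', hr', rfl⟩ := h'
  have hs0 := S.confined_initial x hξ
  have : s = s' := by
    rcases Relation.ReflTransGen.total_of_right_unique rightUnique_collision hs hs' with h | h
    · exact key s s' (hs0.of_reflTransGen hs) h hr
    · exact (key s' s (hs0.of_reflTransGen hs') h hr').symm
  rw [this]

lemma Returns.returnVelocity_eq {x : EuclideanSpace ℝ d} {ξ η : EuclideanSpace ℝ (d ⊕ Unit)}
    (hξ : height ξ < 0) (h : S.Returns x ξ η) : S.returnVelocity x ξ = η := by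
  have hex : ∃ η, S.Returns x ξ η := ⟨η, h⟩
  rw [returnVelocity, dif_pos hex]
  exact Returns.unique hξ hex.choose_spec h

/-- The incoming velocity points into the graph, so the reflection adds a nonnegative multiple of
the normal. The horizontal part of the normal is its vertical part times minus the gradient. -/
lemma Collision.velocity_step
    {s s' : EuclideanSpace ℝ (d ⊕ Unit) × EuclideanSpace ℝ (d ⊕ Unit)} (h : S.Collision s s') :
    ‖s'.2‖ = ‖s.2‖ ∧ height s.2 ≤ height s'.2 ∧
      ‖horizontal s'.2 - horizontal s.2‖ ≤ √S.flatness * (height s'.2 - height s.2) := by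
  have hκ := h.inner_normal_nonpos
  obtain ⟨t, -, -, -, -, -, hrefl⟩ := h
  set N := S.normal (horizontal s'.1) with hN
  have hr : 0 < height N := S.height_normal_pos _
  refine ⟨?_, ?_, ?_⟩
  · refine (pow_left_inj₀ (norm_nonneg _) (norm_nonneg _) two_ne_zero).1 ?_
    rw [hrefl, norm_sub_sq_real, norm_smul, real_inner_smul_right, mul_pow, hN, norm_normal,
      Real.norm_eq_abs, sq_abs, real_inner_comm]
    ring
  · rw [hrefl, height_sub, height_smul]; nlinarith
  · have h1 : horizontal s'.2 - horizontal s.2 =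
        (2 * inner ℝ N s.2 * height N) • gradient S.F (horizontal s'.1) := by
      rw [hrefl, horizontal_sub, horizontal_smul, hN, horizontal_normal, smul_neg, smul_smul]
      abel
    have h2 : height s'.2 - height s.2 = -(2 * inner ℝ N s.2 * height N) := by
      rw [hrefl, height_sub, height_smul]; ring
    rw [h1, h2, norm_smul, Real.norm_eq_abs, abs_of_nonpos (by nlinarith), mul_comm]
    exact mul_le_mul_of_nonneg_right (S.norm_gradient_le _) (by nlinarith)

/-- The vertical velocity is monotone, so its increments telescope and the bound does not depend on
the number of collisions. -/
lemma velocity_of_reflTransGen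
    {s s' : EuclideanSpace ℝ (d ⊕ Unit) × EuclideanSpace ℝ (d ⊕ Unit)}
    (h : Relation.ReflTransGen S.Collision s s') :
    ‖s'.2‖ = ‖s.2‖ ∧ height s.2 ≤ height s'.2 ∧
      ‖horizontal s'.2 - horizontal s.2‖ ≤ √S.flatness * (height s'.2 - height s.2) := by
  induction h with
  | refl => simp
  | tail _ h ih =>
    obtain ⟨h1, h2, h3⟩ := h.velocity_step
    refine ⟨h1.trans ih.1, ih.2.1.trans h2, ?_⟩
    refine (norm_sub_le_norm_sub_add_norm_sub _ _ _).trans ((add_le_add h3 ih.2.2).trans ?_)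
    apply le_of_eq; ring

/-- The vertical velocity rises by at most `2 * ‖ξ‖`, which bounds the horizontal change.
Conservation of energy then bounds the vertical defect, each part contributing `2 * √S.flatness *
‖ξ‖`. -/
lemma Returns.norm_sub_le {x : EuclideanSpace ℝ d} {ξ η : EuclideanSpace ℝ (d ⊕ Unit)}
    (hξ : height ξ < 0) (h : S.Returns x ξ η) : ‖η - ξ‖ ≤ 4 * √S.flatness * ‖ξ‖ := by
  obtain ⟨s, hs, hr, rfl⟩ := h
  obtain ⟨hn, hmono, hhor⟩ := velocity_of_reflTransGen hs
  have hpos := (((S.confined_initial x hξ).of_reflTransGen hs).height_pos_of_reachesPlane hr).2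
  simp only at hn hmono hhor
  set L := √S.flatness
  have hL : 0 ≤ L := Real.sqrt_nonneg _
  have e1 := norm_sq_eq_horizontal_add_height s.2
  have e2 := norm_sq_eq_horizontal_add_height ξ
  have a1 := abs_le.1 (abs_height_le s.2)
  have a2 := abs_le.1 (abs_height_le ξ)
  have b1 := norm_horizontal_le s.2
  have b2 := norm_horizontal_le ξ
  rw [hn] at e1 a1 b1
  set D := height s.2 - height ξ with hD
  have hDpos : 0 < D := by linarith
  have hh : ‖horizontal s.2 - horizontal ξ‖ ≤ 2 * L * ‖ξ‖ := by
    refine hhor.trans ?_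
    nlinarith
  have hdiff : |‖horizontal ξ‖ - ‖horizontal s.2‖| ≤ L * D := by
    rw [abs_sub_comm]; exact (abs_norm_sub_norm_le _ _).trans hhor
  -- By conservation of energy, the difference of the squared heights is the difference of the
  -- squared horizontal norms. It factors through `D`, the same factor that bounds the horizontal
  -- change, and `D > 0` cancels.
  have hv : |-(height s.2) - height ξ| ≤ 2 * L * ‖ξ‖ := by
    have hprod : D * |height s.2 + height ξ| ≤ D * (2 * L * ‖ξ‖) := by
      have : D * (height s.2 + height ξ) =
          (‖horizontal ξ‖ - ‖horizontal s.2‖) * (‖horizontal ξ‖ + ‖horizontal s.2‖) := by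
        rw [hD]; linarith
      rw [← abs_of_pos hDpos, ← abs_mul, this, abs_mul, abs_of_pos hDpos,
        abs_of_nonneg (a := ‖horizontal ξ‖ + _) (by positivity)]
      calc _ ≤ (L * D) * (‖ξ‖ + ‖ξ‖) := by gcongr
        _ = _ := by ring
    have := le_of_mul_le_mul_left hprod hDpos
    rwa [← abs_neg, neg_sub, sub_neg_eq_add, add_comm]
  refine (norm_le_horizontal_add_height _).trans ?_
  rw [horizontal_sub, height_sub, horizontal_vec, height_vec]
  linarith

lemma norm_returnVelocity_sub_le (S : BilliardSystem d) (x : EuclideanSpace ℝ d)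
    {ξ : EuclideanSpace ℝ (d ⊕ Unit)} (hξ : height ξ < 0) :
    ‖S.returnVelocity x ξ - ξ‖ ≤ 4 * √S.flatness * ‖ξ‖ := by
  by_cases hex : ∃ η, S.Returns x ξ η
  · obtain ⟨η, hη⟩ := hex
    rw [hη.returnVelocity_eq hξ]
    exact hη.norm_sub_le hξ
  · rw [returnVelocity, dif_neg hex, sub_self, norm_zero]
    positivity

end BilliardSystem

/-! ### Lipschitz functions with a bound on the derivative -/

/-- A Lipschitz function that is differentiable almost everywhere, with derivative bounded by `L`,
is Lipschitz with constant `L`. -/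
lemma lipschitzWith_of_norm_fderiv_le {E : Type*} [NormedAddCommGroup E] [NormedSpace ℝ E]
    [FiniteDimensional ℝ E] [MeasurableSpace E] [BorelSpace E] (m : Measure E) [m.IsAddHaarMeasure]
    {f : E → ℝ} {K L : NNReal} (hf : LipschitzWith K f) (hd : ∀ᵐ x ∂m, DifferentiableAt ℝ f x)
    (hL : ∀ x, ‖fderiv ℝ f x‖ ≤ L) : LipschitzWith L f := by
  refine LipschitzWith.of_dist_le_mul fun x y => ?_
  refine le_of_forall_pos_le_add fun δ hδ => ?_
  obtain ⟨ε, hε, hεδ⟩ : ∃ ε : ℝ, 0 < ε ∧ 2 * (K * ε) ≤ δ := by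
    refine ⟨δ / (2 * (K + 1)), by positivity, ?_⟩
    have : (K : ℝ) * (δ / (2 * (K + 1))) = δ / 2 * (K / (K + 1)) := by field_simp
    rw [this]
    have h1 : (K : ℝ) / (K + 1) ≤ 1 := (div_le_one (by positivity)).2 (by linarith)
    nlinarith
  -- A segment may lie inside the exceptional null set, so the mean value inequality is applied not
  -- to `f` but to its averages over small balls, which are differentiable everywhere and uniformly
  -- close to `f`.
  set B := Metric.ball (0 : E) ε
  set ν := ProbabilityTheory.cond m B with hν
  have hB0 : m B ≠ 0 := (Metric.measure_ball_pos m 0 hε).ne'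
  have hBt : m B ≠ ⊤ := measure_ball_lt_top.ne
  have : IsProbabilityMeasure ν := ProbabilityTheory.cond_isProbabilityMeasure_of_finite hB0 hBt
  have hνB : ∀ᵐ z ∂ν, ‖z‖ < ε := by
    filter_upwards [ProbabilityTheory.ae_cond_mem (μ := m) (s := B) measurableSet_ball] with z hz
    exact mem_ball_zero_iff.1 hz
  have hac : ν ≪ m := ProbabilityTheory.cond_absolutelyContinuous
  have hclose : ∀ x, ∀ᵐ z ∂ν, ‖f (x + z) - f x‖ ≤ K * ε := by
    intro x
    filter_upwards [hνB] with z hz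
    rw [← dist_eq_norm]
    refine (hf.dist_le_mul _ _).trans ?_
    rw [dist_self_add_left]
    gcongr
  have hint : ∀ x, Integrable (fun z => f (x + z)) ν := by
    intro x
    have h1 : Integrable (fun z => f (x + z) - f x) ν :=
      Integrable.of_bound
        ((hf.continuous.comp (continuous_const.add continuous_id)).sub
          continuous_const).aestronglyMeasurable (K * ε) (hclose x)
    exact (h1.add (integrable_const (f x))).congr (Eventually.of_forall fun z => by simp)
  have happrox : ∀ x, ‖(∫ z, f (x + z) ∂ν) - f x‖ ≤ K * ε := by
    intro x
    have : (∫ z, f (x + z) ∂ν) - f x = ∫ z, (f (x + z) - f x) ∂ν := by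
      rw [integral_sub (hint x) (integrable_const _)]; simp
    rw [this]
    simpa using norm_integral_le_of_norm_le_const (hclose x)
  have hderiv : ∀ x, HasFDerivAt (fun x => ∫ z, f (x + z) ∂ν) (∫ z, fderiv ℝ f (x + z) ∂ν) x := by
    intro x
    -- The crude constant `K` serves as the dominating function. Differentiability is needed only at
    -- `x + z` for almost every `z`, which translation invariance provides for every `x`.
    refine (hasFDerivAt_integral_of_dominated_loc_of_lip (bound := fun _ => (K : ℝ))
      Filter.univ_mem ?_ (hint x) ?_ ?_ (integrable_const _) ?_).2
    · exact Eventually.of_forall fun x => (hint x).aestronglyMeasurable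
    · exact ((measurable_fderiv ℝ f).comp (measurable_const_add x)).aestronglyMeasurable
    · refine Eventually.of_forall fun z => ?_
      have : LipschitzWith K fun y => f (y + z) := by
        have := hf.comp (isometry_add_right z).lipschitz
        rwa [mul_one] at this
      have hK : Real.nnabs (K : ℝ) = K := by simp
      rw [hK]
      exact this.lipschitzOnWith
    · have : ∀ᵐ z ∂m, DifferentiableAt ℝ f (x + z) :=
        (measurePreserving_add_left m x).quasiMeasurePreserving.ae hd
      filter_upwards [hac this] with z hz
      exact (hasFDerivAt_comp_add_right z).2 hz.hasFDerivAt
  have hsmooth : LipschitzWith L (fun x => ∫ z, f (x + z) ∂ν) := by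
    refine lipschitzWith_of_nnnorm_fderiv_le (𝕜 := ℝ) (fun x => (hderiv x).differentiableAt) ?_
    intro x
    rw [(hderiv x).fderiv, ← NNReal.coe_le_coe, coe_nnnorm]
    simpa using norm_integral_le_of_norm_le_const (μ := ν)
      (Eventually.of_forall fun z => hL (x + z))
  have h1 := hsmooth.dist_le_mul x y
  have h2 := happrox x
  have h3 := happrox y
  rw [Real.norm_eq_abs, abs_le] at h2 h3
  rw [Real.dist_eq, abs_le] at h1
  rw [Real.dist_eq, abs_le]
  constructor <;> linarith [h1.1, h1.2, h2.1, h2.2, h3.1, h3.2]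

namespace BilliardSystem

variable {d : Type} [Fintype d] [DecidableEq d] (S : BilliardSystem d)

lemma ae_differentiableAt : ∀ᵐ x, DifferentiableAt ℝ S.F x := by
  obtain ⟨Z, hZc, hZ0, hZ⟩ := S.piecewiseSmooth.2
  have : ∀ᵐ x, x ∈ Zᶜ := by rwa [ae_iff, ← Set.compl_def, compl_compl]
  filter_upwards [this] with x hx
  exact (hZ.differentiableOn (by simp)).differentiableAt (hZc.isOpen_compl.mem_nhds hx)

lemma norm_fderiv_le (x : EuclideanSpace ℝ d) : ‖fderiv ℝ S.F x‖ ≤ √S.flatness := by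
  have := S.norm_gradient_le x
  rwa [gradient, LinearIsometryEquiv.norm_map] at this

/-- The Lipschitz constant contained in `PiecewiseSmooth` is unrelated to the flatness; this
replaces it by one that tends to zero with it. -/
lemma abs_F_sub_le (x y : EuclideanSpace ℝ d) : |S.F x - S.F y| ≤ √S.flatness * ‖x - y‖ := by
  obtain ⟨K, hK⟩ := S.piecewiseSmooth.1
  have := (lipschitzWith_of_norm_fderiv_le (L := ⟨√S.flatness, Real.sqrt_nonneg _⟩) volume hK
    S.ae_differentiableAt S.norm_fderiv_le).dist_le_mul x y
  rwa [Real.dist_eq, dist_eq_norm] at this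

end BilliardSystem

/-! ### Measurability of the scattering map -/

namespace BilliardSystem

variable {d : Type} [Fintype d] [DecidableEq d] (S : BilliardSystem d)

@[fun_prop] lemma measurable_gradient : Measurable (gradient S.F) := by
  unfold gradient
  exact (LinearIsometryEquiv.continuous _).measurable.comp (measurable_fderiv ℝ S.F)

@[fun_prop] lemma measurable_normal : Measurable S.normal := by
  have hg := S.measurable_gradient
  have h1 : Measurable fun x => (√(1 + ‖gradient S.F x‖ ^ 2))⁻¹ := by fun_prop
  have h2 : Measurable fun x => vec (-gradient S.F x) 1 :=
    (continuous_vec_uncurry.comp (continuous_id.prodMk continuous_const)).measurable.comp hg.neg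
  exact h1.smul h2

/-- The times at which the free flight from the state `s` is not in the interior. -/
def hitTimes (s : EuclideanSpace ℝ (d ⊕ Unit) × EuclideanSpace ℝ (d ⊕ Unit)) : Set ℝ :=
  {t | 0 < t ∧ ¬ S.Above (s.1 + t • s.2)}

/-- The first hitting time of the boundary. -/
def hitTime (s : EuclideanSpace ℝ (d ⊕ Unit) × EuclideanSpace ℝ (d ⊕ Unit)) : ℝ :=
  sInf (S.hitTimes s)

/-- The state after the first collision. -/
def collide (s : EuclideanSpace ℝ (d ⊕ Unit) × EuclideanSpace ℝ (d ⊕ Unit)) :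
    EuclideanSpace ℝ (d ⊕ Unit) × EuclideanSpace ℝ (d ⊕ Unit) :=
  (s.1 + S.hitTime s • s.2,
    s.2 - (2 * inner ℝ (S.normal (horizontal (s.1 + S.hitTime s • s.2))) s.2) •
      S.normal (horizontal (s.1 + S.hitTime s • s.2)))

/-- The states from which there is a collision at a regular point of the boundary. -/
def collisionDomain : Set (EuclideanSpace ℝ (d ⊕ Unit) × EuclideanSpace ℝ (d ⊕ Unit)) :=
  {s | (S.hitTimes s).Nonempty ∧ 0 < S.hitTime s ∧
    DifferentiableAt ℝ S.F (horizontal (S.collide s).1)}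

/-- The upward states below the reference plane from which the boundary is never hit. -/
def escapeDomain : Set (EuclideanSpace ℝ (d ⊕ Unit) × EuclideanSpace ℝ (d ⊕ Unit)) :=
  {s | height s.1 < S.c ∧ 0 < height s.2 ∧ ¬ (S.hitTimes s).Nonempty}

lemma bddBelow_hitTimes (s : EuclideanSpace ℝ (d ⊕ Unit) × EuclideanSpace ℝ (d ⊕ Unit)) :
    BddBelow (S.hitTimes s) := ⟨0, fun _ ht => ht.1.le⟩

lemma isOpen_above : IsOpen {q | S.Above q} :=
  isOpen_lt (S.continuous_F.comp continuous_horizontal) continuous_height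

/-- Being above the graph is an open condition, and compactness of the time interval keeps it open
when imposed at all times. -/
lemma isOpen_forall_Icc_above (a b : ℝ) :
    IsOpen {s : EuclideanSpace ℝ (d ⊕ Unit) × EuclideanSpace ℝ (d ⊕ Unit) |
      ∀ t ∈ Set.Icc a b, S.Above (s.1 + t • s.2)} := by
  rw [isOpen_iff_mem_nhds]
  intro s hs
  refine isCompact_Icc.eventually_forall_of_forall_eventually fun t ht => ?_
  have hcont : Continuous fun z : (EuclideanSpace ℝ (d ⊕ Unit) × EuclideanSpace ℝ (d ⊕ Unit)) × ℝ =>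
    z.1.1 + z.2 • z.1.2 := by fun_prop
  exact (S.isOpen_above.preimage hcont).mem_nhds (hs t ht)

/-- The open interval is exhausted by countably many compact ones, on each of which the
complementary condition is open. -/
lemma measurableSet_exists_Ioo_not_above (a b : ℝ) :
    MeasurableSet {s : EuclideanSpace ℝ (d ⊕ Unit) × EuclideanSpace ℝ (d ⊕ Unit) |
      ∃ t ∈ Set.Ioo a b, ¬ S.Above (s.1 + t • s.2)} := by
  have : {s : EuclideanSpace ℝ (d ⊕ Unit) × EuclideanSpace ℝ (d ⊕ Unit) |
      ∃ t ∈ Set.Ioo a b, ¬ S.Above (s.1 + t • s.2)} =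
      ⋃ n : ℕ, {s | ∀ t ∈ Set.Icc (a + 1 / (n + 1)) (b - 1 / (n + 1)),
        S.Above (s.1 + t • s.2)}ᶜ := by
    ext s
    simp only [Set.mem_ofPred_eq, Set.mem_iUnion, Set.mem_compl_iff, not_forall]
    constructor
    · rintro ⟨t, ht, hn⟩
      obtain ⟨n, hn'⟩ := exists_nat_one_div_lt (lt_min (sub_pos.2 ht.1) (sub_pos.2 ht.2))
      rw [lt_min_iff] at hn'
      exact ⟨n, t, ⟨by linarith, by linarith⟩, hn⟩
    · rintro ⟨n, t, ht, hn⟩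
      have : (0 : ℝ) < 1 / (n + 1) := by positivity
      exact ⟨t, ⟨by linarith [ht.1], by linarith [ht.2]⟩, hn⟩
  rw [this]
  exact MeasurableSet.iUnion fun n => (S.isOpen_forall_Icc_above _ _).measurableSet.compl

lemma measurableSet_hitTimes_nonempty : MeasurableSet {s | (S.hitTimes s).Nonempty} := by
  have : {s | (S.hitTimes s).Nonempty} = ⋃ n : ℕ,
      {s : EuclideanSpace ℝ (d ⊕ Unit) × EuclideanSpace ℝ (d ⊕ Unit) |
        ∃ t ∈ Set.Ioo 0 (n : ℝ), ¬ S.Above (s.1 + t • s.2)} := by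
    ext s
    simp only [Set.mem_ofPred_eq, Set.mem_iUnion]
    constructor
    · rintro ⟨t, ht, hn⟩
      obtain ⟨n, hn'⟩ := exists_nat_gt t
      exact ⟨n, t, ⟨ht, hn'⟩, hn⟩
    · rintro ⟨n, t, ht, hn⟩
      exact ⟨t, ht.1, hn⟩
  rw [this]
  exact MeasurableSet.iUnion fun n => S.measurableSet_exists_Ioo_not_above _ _

@[fun_prop] lemma measurable_hitTime : Measurable S.hitTime := by
  refine measurable_of_Iio fun r => ?_
  -- The second set accounts for the flights that never hit: there `hitTime` is the infimum of the
  -- empty set, which is 0.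
  have : S.hitTime ⁻¹' Set.Iio r =
      {s | ∃ t ∈ Set.Ioo 0 r, ¬ S.Above (s.1 + t • s.2)} ∪
        ({s | (S.hitTimes s).Nonempty}ᶜ ∩ {_s | 0 < r}) := by
    ext s
    simp only [Set.mem_preimage, Set.mem_Iio, Set.mem_union, Set.mem_inter_iff, Set.mem_compl_iff,
      Set.mem_ofPred_eq]
    by_cases hne : (S.hitTimes s).Nonempty
    · simp only [hne, not_true, false_and, or_false]
      rw [hitTime, csInf_lt_iff (S.bddBelow_hitTimes s) hne]
      exact ⟨fun ⟨t, ht, htr⟩ => ⟨t, ⟨ht.1, htr⟩, ht.2⟩, fun ⟨t, ht, hn⟩ => ⟨t, ⟨ht.1, hn⟩, ht.2⟩⟩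
    · simp only [hne, not_false_iff, true_and]
      rw [hitTime, Set.not_nonempty_iff_eq_empty.1 hne, Real.sInf_empty]
      exact ⟨Or.inr, fun h => h.elim (fun ⟨t, ht, _⟩ => ht.1.trans ht.2) id⟩
  rw [this]
  exact (S.measurableSet_exists_Ioo_not_above _ _).union
    (S.measurableSet_hitTimes_nonempty.compl.inter (MeasurableSet.const _))

@[fun_prop] lemma measurable_collide : Measurable S.collide := by
  have h1 : Measurable fun s : EuclideanSpace ℝ (d ⊕ Unit) × EuclideanSpace ℝ (d ⊕ Unit) =>
      s.1 + S.hitTime s • s.2 := by fun_prop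
  have h2 : Measurable fun s : EuclideanSpace ℝ (d ⊕ Unit) × EuclideanSpace ℝ (d ⊕ Unit) =>
      S.normal (horizontal (s.1 + S.hitTime s • s.2)) :=
    S.measurable_normal.comp (continuous_horizontal.measurable.comp h1)
  have h3 : Measurable fun s : EuclideanSpace ℝ (d ⊕ Unit) × EuclideanSpace ℝ (d ⊕ Unit) =>
      2 * inner ℝ (S.normal (horizontal (s.1 + S.hitTime s • s.2))) s.2 :=
    (h2.inner measurable_snd).const_mul 2
  exact h1.prodMk (measurable_snd.sub (h3.smul h2))

lemma measurableSet_collisionDomain : MeasurableSet S.collisionDomain := by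
  refine S.measurableSet_hitTimes_nonempty.inter ((measurableSet_lt measurable_const
    S.measurable_hitTime).inter ?_)
  exact (continuous_horizontal.measurable.comp
    (measurable_fst.comp S.measurable_collide)) (measurableSet_of_differentiableAt ℝ S.F)

lemma measurableSet_escapeDomain : MeasurableSet S.escapeDomain := by
  refine (measurableSet_lt (continuous_height.measurable.comp measurable_fst)
    measurable_const).inter ((measurableSet_lt measurable_const
      (continuous_height.measurable.comp measurable_snd)).inter
      S.measurableSet_hitTimes_nonempty.compl)

lemma collision_iff {s s' : EuclideanSpace ℝ (d ⊕ Unit) × EuclideanSpace ℝ (d ⊕ Unit)} :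
    S.Collision s s' ↔ s ∈ S.collisionDomain ∧ s' = S.collide s := by
  constructor
  · rintro ⟨t, ht, habove, hpos, hheight, hdiff, hvel⟩
    have hmem : t ∈ S.hitTimes s := ⟨ht, by rw [Above, ← hpos, hheight]; exact lt_irrefl _⟩
    have hleast : IsLeast (S.hitTimes s) t := by
      refine ⟨hmem, fun t' ht' => ?_⟩
      by_contra! hlt
      exact ht'.2 (habove t' ht'.1 hlt)
    have htime : S.hitTime s = t := hleast.csInf_eq
    have heq : s' = S.collide s := by
      rw [hpos] at hvel
      exact Prod.ext (by simp [collide, htime, hpos]) (by simp [collide, htime, hvel])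
    exact ⟨⟨⟨t, hmem⟩, htime ▸ ht, heq ▸ hdiff⟩, heq⟩
  · rintro ⟨⟨hne, hpos, hdiff⟩, rfl⟩
    have habove : ∀ u, 0 < u → u < S.hitTime s → S.Above (s.1 + u • s.2) := by
      intro u hu hut
      by_contra hn
      exact notMem_of_lt_csInf hut (S.bddBelow_hitTimes s) ⟨hu, hn⟩
    have hline : Continuous fun u : ℝ => s.1 + u • s.2 := by fun_prop
    have hcF : Continuous fun u : ℝ => S.F (horizontal (s.1 + u • s.2)) :=
      S.continuous_F.comp (continuous_horizontal.comp hline)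
    have hch : Continuous fun u : ℝ => height (s.1 + u • s.2) := continuous_height.comp hline
    -- At the hitting time both inequalities come from limits: the infimum lies in the closure of
    -- the hit times, and it is also a limit of earlier times at which the flight is above the
    -- graph.
    refine ⟨S.hitTime s, hpos, habove, rfl, le_antisymm ?_ ?_, hdiff, rfl⟩
    · have : S.hitTimes s ⊆ {u | height (s.1 + u • s.2) ≤ S.F (horizontal (s.1 + u • s.2))} :=
        fun u hu => not_lt.1 hu.2
      exact closure_minimal this (isClosed_le hch hcF)
        (csInf_mem_closure hne (S.bddBelow_hitTimes s))
    · have : Set.Ioo 0 (S.hitTime s) ⊆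
          {u | S.F (horizontal (s.1 + u • s.2)) ≤ height (s.1 + u • s.2)} :=
        fun u hu => (habove u hu.1 hu.2).le
      refine closure_minimal this (isClosed_le hcF hch) ?_
      rw [closure_Ioo hpos.ne]
      exact ⟨hpos.le, le_rfl⟩

-- A rising flight cannot meet the graph beyond the plane, so reaching the plane first amounts to
-- never hitting; this puts the condition in measurable form.
variable {S} in
lemma Confined.reachesPlane_iff
    {s : EuclideanSpace ℝ (d ⊕ Unit) × EuclideanSpace ℝ (d ⊕ Unit)} (hs : S.Confined s) :
    S.ReachesPlane s ↔ s ∈ S.escapeDomain := by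
  constructor
  · intro h
    obtain ⟨h1, h2⟩ := hs.height_pos_of_reachesPlane h
    refine ⟨h1, h2, ?_⟩
    rintro ⟨u, hu, hn⟩
    obtain ⟨t, ht, hplane, habove⟩ := h
    rcases le_or_gt u t with hut | hut
    · exact hn (habove u hu hut)
    · refine hn ((S.F_lt_c _).trans ?_)
      rw [← hplane, height_add, height_add, height_smul, height_smul]
      nlinarith
  · rintro ⟨h1, h2, h3⟩
    refine ⟨(S.c - height s.1) / height s.2, div_pos (sub_pos.2 h1) h2, ?_, fun u hu _ => ?_⟩
    · rw [height_add, height_smul, div_mul_cancel₀ _ h2.ne']; ring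
    · by_contra hn
      exact h3 ⟨u, hu, hn⟩

lemma reflTransGen_collision_iff
    {s s' : EuclideanSpace ℝ (d ⊕ Unit) × EuclideanSpace ℝ (d ⊕ Unit)} :
    Relation.ReflTransGen S.Collision s s' ↔
      ∃ n : ℕ, (∀ j < n, S.collide^[j] s ∈ S.collisionDomain) ∧ s' = S.collide^[n] s := by
  constructor
  · intro h
    induction h with
    | refl => exact ⟨0, by simp, rfl⟩
    | tail _ h ih =>
      obtain ⟨n, hn, rfl⟩ := ih
      obtain ⟨h1, rfl⟩ := S.collision_iff.1 h
      refine ⟨n + 1, fun j hj => ?_, (Function.iterate_succ_apply' _ _ _).symm⟩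
      rcases Nat.lt_succ_iff_lt_or_eq.1 hj with hj | rfl
      · exact hn j hj
      · exact h1
  · rintro ⟨n, hn, rfl⟩
    induction n with
    | zero => exact Relation.ReflTransGen.refl
    | succ n ih =>
      refine (ih fun j hj => hn j (hj.trans n.lt_succ_self)).tail (S.collision_iff.2 ⟨hn n
        n.lt_succ_self, Function.iterate_succ_apply' _ _ _⟩)

/-- The states that return to the reference plane after exactly `n` collisions. -/
def returnDomain (n : ℕ) : Set (EuclideanSpace ℝ (d ⊕ Unit) × EuclideanSpace ℝ (d ⊕ Unit)) :=
  (⋂ j < n, S.collide^[j] ⁻¹' S.collisionDomain) ∩ S.collide^[n] ⁻¹' S.escapeDomain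

lemma measurableSet_returnDomain (n : ℕ) : MeasurableSet (S.returnDomain n) :=
  (MeasurableSet.iInter fun j => MeasurableSet.iInter fun _ =>
    (S.measurable_collide.iterate j) S.measurableSet_collisionDomain).inter
    ((S.measurable_collide.iterate n) S.measurableSet_escapeDomain)

lemma returns_iff {x : EuclideanSpace ℝ d} {ξ η : EuclideanSpace ℝ (d ⊕ Unit)}
    (hξ : height ξ < 0) :
    S.Returns x ξ η ↔ ∃ n, (vec x S.c, ξ) ∈ S.returnDomain n ∧
      η = vec (horizontal (S.collide^[n] (vec x S.c, ξ)).2)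
        (-height (S.collide^[n] (vec x S.c, ξ)).2) := by
  constructor
  · rintro ⟨s, hs, hr, rfl⟩
    have hconf := (S.confined_initial x hξ).of_reflTransGen hs
    obtain ⟨n, hn, rfl⟩ := S.reflTransGen_collision_iff.1 hs
    exact ⟨n, ⟨by simpa using hn, hconf.reachesPlane_iff.1 hr⟩, rfl⟩
  · rintro ⟨n, ⟨hn, hr⟩, rfl⟩
    have hs : Relation.ReflTransGen S.Collision (vec x S.c, ξ) (S.collide^[n] (vec x S.c, ξ)) :=
      S.reflTransGen_collision_iff.2 ⟨n, by simpa using hn, rfl⟩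
    exact ⟨_, hs, ((S.confined_initial x hξ).of_reflTransGen hs).reachesPlane_iff.2 hr, rfl⟩

/-- The returning states are covered by countably many measurable sets, indexed by the number of
collisions, on each of which the return velocity is an iterate of `collide`; elsewhere it is the
initial velocity. Downward initial velocity is what makes the value independent of the choice in
`returnVelocity`. -/
lemma measurable_returnVelocity :
    Measurable fun z : EuclideanSpace ℝ d × {ξ : EuclideanSpace ℝ (d ⊕ Unit) // height ξ < 0} =>
      S.returnVelocity z.1 z.2 := by
  set s₀ : EuclideanSpace ℝ d × {ξ : EuclideanSpace ℝ (d ⊕ Unit) // height ξ < 0} →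
      EuclideanSpace ℝ (d ⊕ Unit) × EuclideanSpace ℝ (d ⊕ Unit) :=
    fun z => (vec z.1 S.c, z.2) with hs₀
  have hs₀m : Measurable s₀ :=
    ((continuous_vec_uncurry.comp (continuous_id.prodMk continuous_const)).measurable.comp
      measurable_fst).prodMk (measurable_subtype_coe.comp measurable_snd)
  set out : ℕ → EuclideanSpace ℝ d × {ξ : EuclideanSpace ℝ (d ⊕ Unit) // height ξ < 0} →
      EuclideanSpace ℝ (d ⊕ Unit) := fun n z =>
    vec (horizontal (S.collide^[n] (s₀ z)).2) (-height (S.collide^[n] (s₀ z)).2) with hout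
  have houtm : ∀ n, Measurable (out n) := by
    intro n
    have : Continuous fun q : EuclideanSpace ℝ (d ⊕ Unit) => vec (horizontal q) (-height q) := by
      fun_prop
    exact this.measurable.comp (measurable_snd.comp ((S.measurable_collide.iterate n).comp hs₀m))
  intro B hB
  have : (fun z : EuclideanSpace ℝ d × {ξ : EuclideanSpace ℝ (d ⊕ Unit) // height ξ < 0} =>
      S.returnVelocity z.1 z.2) ⁻¹' B =
      (⋃ n, s₀ ⁻¹' S.returnDomain n ∩ out n ⁻¹' B) ∪
        ((⋂ n, (s₀ ⁻¹' S.returnDomain n)ᶜ) ∩ {z | (z.2 : EuclideanSpace ℝ (d ⊕ Unit)) ∈ B}) := by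
    ext ⟨x, ξ, hξ⟩
    simp only [Set.mem_preimage, Set.mem_union, Set.mem_iUnion, Set.mem_inter_iff, Set.mem_iInter,
      Set.mem_compl_iff, Set.mem_ofPred_eq]
    by_cases hex : ∃ n, s₀ (x, ⟨ξ, hξ⟩) ∈ S.returnDomain n
    · have hnot : ¬ ∀ n, s₀ (x, ⟨ξ, hξ⟩) ∉ S.returnDomain n := by push Not; exact hex
      have hret : ∀ n, s₀ (x, ⟨ξ, hξ⟩) ∈ S.returnDomain n →
          S.returnVelocity x ξ = out n (x, ⟨ξ, hξ⟩) := fun n hn =>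
        Returns.returnVelocity_eq hξ ((S.returns_iff hξ).2 ⟨n, hn, rfl⟩)
      simp only [hnot, false_and, or_false]
      constructor
      · intro h
        obtain ⟨n, hn⟩ := hex
        exact ⟨n, hn, hret n hn ▸ h⟩
      · rintro ⟨n, hn, h⟩
        rw [hret n hn]
        exact h
    · have hnot : ∀ n, s₀ (x, ⟨ξ, hξ⟩) ∉ S.returnDomain n := by push Not at hex; exact hex
      have hno : ¬ ∃ η, S.Returns x ξ η := by
        rintro ⟨η, h⟩
        obtain ⟨n, hn, -⟩ := (S.returns_iff hξ).1 h
        exact hnot n hn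
      rw [returnVelocity, dif_neg hno]
      simp [hnot]
  rw [this]
  refine (MeasurableSet.iUnion fun n => (hs₀m (S.measurableSet_returnDomain n)).inter
    (houtm n hB)).union ((MeasurableSet.iInter fun n =>
      (hs₀m (S.measurableSet_returnDomain n)).compl).inter ?_)
  exact (measurable_subtype_coe.comp measurable_snd) hB

end BilliardSystem

/-! ### Trajectories with a single collision -/

namespace BilliardSystem

variable {d : Type} [Fintype d] [DecidableEq d] (S : BilliardSystem d)

/-- The final velocity, reflected on the reference plane, after a single collision at the boundary
point over `x` with incoming velocity `ξ`. -/
def scatter (x : EuclideanSpace ℝ d) (ξ : EuclideanSpace ℝ (d ⊕ Unit)) :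
    EuclideanSpace ℝ (d ⊕ Unit) :=
  vec (horizontal (ξ - (2 * inner ℝ (S.normal x) ξ) • S.normal x))
    (-height (ξ - (2 * inner ℝ (S.normal x) ξ) • S.normal x))

/-- The point of the reference plane from which the line with direction `ξ` meets the boundary over
the point `x`. -/
def launch (ξ : EuclideanSpace ℝ (d ⊕ Unit)) (x : EuclideanSpace ℝ d) : EuclideanSpace ℝ d :=
  x - ((S.F x - S.c) / height ξ) • horizontal ξ

/-- The vertical speed is at most `‖ξ‖`, so the steepness condition on the velocity already forces
an absolute bound on the flatness. -/
lemma sqrt_flatness_le {ξ : EuclideanSpace ℝ (d ⊕ Unit)} (hξ : height ξ < 0)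
    (hsmall : 16 * (√S.flatness * ‖ξ‖) ≤ -height ξ) : √S.flatness ≤ 1 / 16 := by
  have h1 := (abs_le.1 (abs_height_le ξ)).1
  have h2 : 0 < ‖ξ‖ := by linarith
  by_contra! h
  nlinarith

lemma abs_inner_gradient_le (x : EuclideanSpace ℝ d) (ξ : EuclideanSpace ℝ (d ⊕ Unit)) :
    |inner ℝ (gradient S.F x) (horizontal ξ)| ≤ √S.flatness * ‖ξ‖ :=
  (abs_real_inner_le_norm _ _).trans (mul_le_mul (S.norm_gradient_le x) (norm_horizontal_le ξ)
    (norm_nonneg _) (Real.sqrt_nonneg _))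

/-- The incoming line is steeper than the Lipschitz constant of the graph, so it stays above the
graph until it hits. The reflected line is still steeper than that constant, so it never comes back.
-/
lemma returnVelocity_launch {ξ : EuclideanSpace ℝ (d ⊕ Unit)} (hξ : height ξ < 0)
    (hsmall : 16 * (√S.flatness * ‖ξ‖) ≤ -height ξ) {x : EuclideanSpace ℝ d}
    (hx : DifferentiableAt ℝ S.F x) :
    S.returnVelocity (S.launch ξ x) ξ = S.scatter x ξ := by
  have hL := S.sqrt_flatness_le hξ hsmall
  have hL0 : 0 ≤ √S.flatness := Real.sqrt_nonneg _
  set L := √S.flatness with hLdef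
  have hξpos : 0 < ‖ξ‖ := by linarith [(abs_le.1 (abs_height_le ξ)).1]
  have hstep : ∀ (y : EuclideanSpace ℝ d) (u : ℝ), 0 ≤ u → ∀ ζ : EuclideanSpace ℝ (d ⊕ Unit),
      |S.F (y + u • horizontal ζ) - S.F y| ≤ u * (L * ‖ζ‖) := by
    intro y u hu ζ
    refine (S.abs_F_sub_le _ _).trans ?_
    rw [add_sub_cancel_left, norm_smul, Real.norm_eq_abs, abs_of_nonneg hu]
    have := mul_le_mul_of_nonneg_left (norm_horizontal_le ζ) (mul_nonneg hL0 hu)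
    nlinarith
  apply Returns.returnVelocity_eq hξ
  set t := (S.F x - S.c) / height ξ with ht
  have htpos : 0 < t := div_pos_of_neg_of_neg (sub_neg.2 (S.F_lt_c x)) hξ
  have htmul : t * height ξ = S.F x - S.c := div_mul_cancel₀ _ hξ.ne
  set ζ := ξ - (2 * inner ℝ (S.normal x) ξ) • S.normal x with hζ
  have hhit : vec (S.launch ξ x) S.c + t • ξ = vec x (S.F x) := by
    refine ext_horizontal_height ?_ ?_
    · simp [launch, ← ht]
    · simp [htmul]
  have hcoll : S.Collision (vec (S.launch ξ x) S.c, ξ) (vec x (S.F x), ζ) := by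
    refine ⟨t, htpos, fun u hu hut => ?_, hhit.symm, by simp, by simpa using hx, by simp [hζ]⟩
    have hx' : horizontal (vec (S.launch ξ x) S.c + u • ξ) + (t - u) • horizontal ξ = x := by
      rw [horizontal_add, horizontal_vec, horizontal_smul, launch, ← ht, sub_smul]
      abel
    have h1 := (abs_le.1 (hstep (horizontal (vec (S.launch ξ x) S.c + u • ξ)) (t - u)
      (by linarith) ξ)).1
    rw [hx'] at h1
    simp only [Above]
    have h2 : height (vec (S.launch ξ x) S.c + u • ξ) = S.F x - (t - u) * height ξ := by
      rw [height_add, height_vec, height_smul, sub_mul, htmul]; ring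
    rw [h2]
    have : 0 < t - u := by linarith
    nlinarith [mul_pos this (neg_pos.2 hξ)]
  have hζnorm : ‖ζ‖ = ‖ξ‖ := hcoll.velocity_step.1
  have hr := S.height_normal_sq_mul x
  have hg := S.norm_gradient_le x
  set r := height (S.normal x)
  have hr2 : 4 / 5 ≤ r ^ 2 := by
    have : ‖gradient S.F x‖ ^ 2 ≤ 1 / 4 := by
      have := pow_le_pow_left₀ (norm_nonneg _) (hg.trans hL) 2
      norm_num at this ⊢; linarith
    nlinarith [sq_nonneg r]
  have hr1 : r ^ 2 ≤ 1 := by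
    nlinarith [mul_nonneg (sq_nonneg r) (sq_nonneg ‖gradient S.F x‖)]
  -- From `4 / 5 ≤ r ^ 2`, the reflected vertical velocity is at least 3/5 of the incoming vertical
  -- speed minus `2 * L * ‖ξ‖`; the factor 16 in `hsmall` leaves ample room.
  have hζheight : L * ‖ξ‖ < height ζ := by
    have h1 : height ζ = height ξ - 2 * r ^ 2 *
        (height ξ - inner ℝ (gradient S.F x) (horizontal ξ)) := by
      rw [hζ, height_sub, height_smul, inner_normal]; ring
    have h2 := (abs_le.1 (S.abs_inner_gradient_le x ξ)).1
    have h3 : -(L * ‖ξ‖) ≤ r ^ 2 * inner ℝ (gradient S.F x) (horizontal ξ) := by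
      nlinarith [mul_nonneg hL0 hξpos.le, sq_nonneg r]
    rw [h1]
    nlinarith [mul_nonneg hL0 hξpos.le]
  have hζpos : 0 < height ζ := (mul_nonneg hL0 hξpos.le).trans_lt hζheight
  refine ⟨(vec x (S.F x), ζ), Relation.ReflTransGen.single hcoll, ?_, rfl⟩
  refine ⟨(S.c - S.F x) / height ζ, div_pos (sub_pos.2 (S.F_lt_c x)) hζpos, ?_, fun u hu _ => ?_⟩
  · rw [height_add, height_vec, height_smul, div_mul_cancel₀ _ hζpos.ne']; ring
  · have h1 := (abs_le.1 (hstep x u hu.le ζ)).2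
    rw [Above, horizontal_add, height_add, horizontal_vec, height_vec, horizontal_smul,
      height_smul]
    rw [hζnorm] at h1
    nlinarith

end BilliardSystem

/-! ### Integration over the torus -/

/-- Volume is a multiple of the Hausdorff measure, which scales under Lipschitz maps. It is used to
see that `launch` preserves null sets. -/
lemma volume_image_le_of_lipschitzWith {V : Type*} [NormedAddCommGroup V] [InnerProductSpace ℝ V]
    [FiniteDimensional ℝ V] [MeasurableSpace V] [BorelSpace V] {f : V → V} {K : NNReal}
    (hf : LipschitzWith K f) (s : Set V) :
    volume (f '' s) ≤ (K : ENNReal) ^ (Module.finrank ℝ V : ℝ) * volume s := by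
  rw [← InnerProductSpace.euclideanHausdorffMeasure_eq_volume,
    Measure.euclideanHausdorffMeasure_def, Measure.smul_apply, Measure.smul_apply,
    ENNReal.smul_def, ENNReal.smul_def, smul_eq_mul, smul_eq_mul, mul_left_comm]
  gcongr
  exact hf.hausdorffMeasure_image_le (by positivity) s

namespace BilliardSystem

variable {d : Type} [Fintype d] [DecidableEq d] (S : BilliardSystem d)

/-- The basis of period vectors. -/
def periodBasis : Module.Basis d ℝ (EuclideanSpace ℝ d) :=
  (EuclideanSpace.basisFun d ℝ).toBasis.isUnitSMul (w := S.period)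
    fun i => (S.period_pos i).ne'.isUnit

lemma periodBasis_apply (i : d) :
    S.periodBasis i = EuclideanSpace.single i (S.period i) := by
  rw [periodBasis, Module.Basis.isUnitSMul_apply]
  ext j
  simp

/-- The lattice of periods. -/
def periods : Submodule ℤ (EuclideanSpace ℝ d) := Submodule.span ℤ (Set.range S.periodBasis)

instance : Countable S.periods := by
  unfold periods; infer_instance

instance : VAddInvariantMeasure S.periods (EuclideanSpace ℝ d) volume :=
  ⟨fun g s _ => measure_preimage_add volume (g : EuclideanSpace ℝ d) s⟩

/-- The fundamental box of the torus. -/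
def box : Set (EuclideanSpace ℝ d) := {x | ∀ i, x i ∈ Set.Ico 0 (S.period i)}

lemma box_eq : S.box = ZSpan.fundamentalDomain S.periodBasis := by
  ext x
  have hrepr : ∀ i, S.periodBasis.repr x i = (S.period i)⁻¹ * x i := by
    intro i
    rw [periodBasis, Module.Basis.repr_isUnitSMul, Units.smul_def]
    simp
  simp only [box, ZSpan.mem_fundamentalDomain, hrepr, Set.mem_ofPred_eq, Set.mem_Ico]
  refine forall_congr' fun i => ?_
  have hp := S.period_pos i
  rw [inv_mul_lt_one₀ hp]
  refine and_congr_left fun _ => ?_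
  exact ⟨fun h => by positivity, fun h => by
    have := mul_nonneg hp.le h
    rwa [mul_inv_cancel_left₀ hp.ne'] at this⟩

lemma isAddFundamentalDomain_box : IsAddFundamentalDomain S.periods S.box := by
  rw [box_eq]; exact ZSpan.isAddFundamentalDomain _ _

lemma measurableSet_box : MeasurableSet S.box := by
  rw [box_eq]; exact ZSpan.fundamentalDomain_measurableSet _

lemma volume_box_ne_zero : volume S.box ≠ 0 := by
  rw [box_eq]; exact ZSpan.measure_fundamentalDomain_ne_zero _

lemma volume_box_ne_top : volume S.box ≠ ⊤ := by
  rw [box_eq]; exact (ZSpan.fundamentalDomain_isBounded _).measure_lt_top.ne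

instance : IsProbabilityMeasure S.uniform :=
  ProbabilityTheory.cond_isProbabilityMeasure_of_finite S.volume_box_ne_zero S.volume_box_ne_top

lemma integral_uniform (f : EuclideanSpace ℝ d → ℝ) :
    ∫ x, f x ∂S.uniform = (volume S.box)⁻¹.toReal * ∫ x in S.box, f x := by
  rw [uniform, ProbabilityTheory.cond]
  exact integral_smul_measure _ _

lemma uniform_absolutelyContinuous : S.uniform ≪ volume :=
  ProbabilityTheory.cond_absolutelyContinuous

lemma F_add_period {g : EuclideanSpace ℝ d} (hg : g ∈ S.periods) (x : EuclideanSpace ℝ d) :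
    S.F (x + g) = S.F x := by
  let P : AddSubgroup (EuclideanSpace ℝ d) :=
    { carrier := {g | ∀ x, S.F (x + g) = S.F x}
      zero_mem' := fun x => by rw [add_zero]
      add_mem' := fun {a b} ha hb x => by rw [← add_assoc, hb, ha]
      neg_mem' := fun {a} ha x => by rw [← ha (x + -a), neg_add_cancel_right] }
  have hle : S.periods ≤ P.toIntSubmodule := by
    refine Submodule.span_le.2 ?_
    rintro _ ⟨i, rfl⟩ x
    rw [periodBasis_apply]
    exact S.periodic x i
  exact hle hg x

lemma gradient_add_period {g : EuclideanSpace ℝ d} (hg : g ∈ S.periods) (x : EuclideanSpace ℝ d) :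
    gradient S.F (x + g) = gradient S.F x := by
  have : (fun y => S.F (y + g)) = S.F := funext (S.F_add_period hg)
  rw [gradient, gradient, ← fderiv_comp_add_right g, this]

lemma normal_add_period {g : EuclideanSpace ℝ d} (hg : g ∈ S.periods) (x : EuclideanSpace ℝ d) :
    S.normal (x + g) = S.normal x := by
  rw [normal, normal, S.gradient_add_period hg]

lemma differentiableAt_add_period {g : EuclideanSpace ℝ d} (hg : g ∈ S.periods)
    (x : EuclideanSpace ℝ d) :
    DifferentiableAt ℝ S.F (x + g) ↔ DifferentiableAt ℝ S.F x := by
  have : (fun y => S.F (y + g)) = S.F := funext (S.F_add_period hg)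
  rw [← differentiableAt_comp_add_right g, this]

/-- This stands in for integration on the quotient torus: a periodic function has the same integral
over every fundamental domain. -/
lemma setIntegral_box_eq {D : Set (EuclideanSpace ℝ d)}
    (hD : IsAddFundamentalDomain S.periods D) {f : EuclideanSpace ℝ d → ℝ}
    (hf : ∀ g ∈ S.periods, ∀ x, f (x + g) = f x) :
    ∫ x in S.box, f x = ∫ x in D, f x :=
  S.isAddFundamentalDomain_box.setIntegral_eq hD fun g x => by
    rw [Submodule.vadd_def, vadd_eq_add, add_comm, hf _ g.2]

/-- A point reflection preserves volume and normalizes the lattice of periods, so it takes the box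
to another fundamental domain. -/
lemma integral_uniform_comp_reflection (o : EuclideanSpace ℝ d) {f : EuclideanSpace ℝ d → ℝ}
    (hf : ∀ g ∈ S.periods, ∀ x, f (x + g) = f x) :
    ∫ x, f (o - x) ∂S.uniform = ∫ x, f x ∂S.uniform := by
  rw [integral_uniform, integral_uniform]
  congr 1
  have hmp : MeasurePreserving (fun x : EuclideanSpace ℝ d => o - x) := by
    exact Measure.measurePreserving_sub_left volume o
  have hfd : IsAddFundamentalDomain S.periods ((fun x : EuclideanSpace ℝ d => o - x) ⁻¹' S.box) :=
    S.isAddFundamentalDomain_box.preimage_of_equiv hmp.quasiMeasurePreserving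
      (e := Neg.neg) (Equiv.neg _).bijective fun g x => by
        simp only [Submodule.vadd_def, vadd_eq_add, Submodule.coe_neg]
        abel
  rw [S.setIntegral_box_eq hfd hf,
    ← hmp.setIntegral_preimage_emb (Homeomorph.subLeft o).measurableEmbedding]
  congr 2
  ext x
  simp

/-- By symmetry, a function of the normal that changes sign with the gradient has mean zero. -/
lemma Symmetric.integral_eq_zero {S : BilliardSystem d} (hS : S.Symmetric)
    {φ : EuclideanSpace ℝ d → ℝ} (hφ : ∀ g, φ (-g) = -φ g) :
    ∫ x, φ (gradient S.F x) ∂S.uniform = 0 := by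
  obtain ⟨o, ho⟩ := hS
  -- Symmetry about `o` is invariance under the point reflection `x ↦ 2 • o - x`, which reverses the
  -- gradient.
  have hF : S.F = fun x => S.F ((2 : ℝ) • o - x) := by
    funext x
    have := ho (x - o)
    rw [show o + (x - o) = x by abel, show o - (x - o) = (2 : ℝ) • o - x by rw [two_smul]; abel]
      at this
    exact this
  have hgrad : ∀ x, gradient S.F ((2 : ℝ) • o - x) = -gradient S.F x := by
    intro x
    have h1 : fderiv ℝ S.F x = -fderiv ℝ S.F ((2 : ℝ) • o - x) := by
      conv_lhs => rw [hF]
      have h := (ContinuousLinearEquiv.neg ℝ (M := EuclideanSpace ℝ d)).comp_right_fderiv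
        (f := fun y => S.F ((2 : ℝ) • o + y)) (x := x)
      rw [fderiv_comp_add_left] at h
      have h' : (fun x => S.F ((2 : ℝ) • o - x)) =
          (fun y => S.F ((2 : ℝ) • o + y)) ∘ (ContinuousLinearEquiv.neg ℝ) := by
        funext y; simp [sub_eq_add_neg]
      rw [h', h]
      ext y
      simp [sub_eq_add_neg]
    rw [gradient, gradient, h1, map_neg, neg_neg]
  have h := S.integral_uniform_comp_reflection ((2 : ℝ) • o) (f := fun x => φ (gradient S.F x))
    fun g hg x => by rw [S.gradient_add_period hg]
  simp only [hgrad, hφ, integral_neg] at h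
  linarith

/-! ### The change of variables from the reference plane to the boundary -/

/-- `launch` is the identity plus a 1/16-Lipschitz map, the source of its injectivity, surjectivity
and Lipschitz bound. -/
lemma norm_launch_sub_launch_sub_le {ξ : EuclideanSpace ℝ (d ⊕ Unit)} (hξ : height ξ < 0)
    (hsmall : 16 * (√S.flatness * ‖ξ‖) ≤ -height ξ) (x y : EuclideanSpace ℝ d) :
    ‖S.launch ξ x - S.launch ξ y - (x - y)‖ ≤ 1 / 16 * ‖x - y‖ := by
  have h1 : S.launch ξ x - S.launch ξ y - (x - y) =
      (-((S.F x - S.F y) / height ξ)) • horizontal ξ := by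
    simp only [launch, sub_div, neg_smul, sub_smul]
    abel
  rw [h1, norm_smul, norm_neg, norm_div, Real.norm_eq_abs, Real.norm_eq_abs, abs_of_neg hξ,
    div_mul_eq_mul_div, div_le_iff₀ (neg_pos.2 hξ)]
  calc |S.F x - S.F y| * ‖horizontal ξ‖ ≤ (√S.flatness * ‖x - y‖) * ‖ξ‖ :=
        mul_le_mul (S.abs_F_sub_le x y) (norm_horizontal_le ξ) (norm_nonneg _) (by positivity)
    _ = (√S.flatness * ‖ξ‖) * ‖x - y‖ := by ring
    _ ≤ (-height ξ / 16) * ‖x - y‖ := by gcongr; linarith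
    _ = _ := by ring

lemma exists_homeomorph_launch {ξ : EuclideanSpace ℝ (d ⊕ Unit)} (hξ : height ξ < 0)
    (hsmall : 16 * (√S.flatness * ‖ξ‖) ≤ -height ξ) :
    ∃ e : EuclideanSpace ℝ d ≃ₜ EuclideanSpace ℝ d, ∀ x, e x = S.launch ξ x := by
  have happ : ApproximatesLinearOn (S.launch ξ)
      ((ContinuousLinearEquiv.refl ℝ (EuclideanSpace ℝ d) :
        EuclideanSpace ℝ d →L[ℝ] EuclideanSpace ℝ d)) Set.univ (1 / 16 : NNReal) := by
    rw [ApproximatesLinearOn.approximatesLinearOn_iff_lipschitzOnWith]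
    refine LipschitzOnWith.of_dist_le_mul fun x _ y _ => ?_
    rw [dist_eq_norm, dist_eq_norm]
    refine le_trans (le_of_eq ?_) ((S.norm_launch_sub_launch_sub_le hξ hsmall x y).trans
      (le_of_eq ?_))
    · congr 1
      simp only [Pi.sub_apply, ContinuousLinearEquiv.coe_coe, ContinuousLinearEquiv.refl_apply]
      abel
    · simp
  refine ⟨happ.toHomeomorph _ ?_, fun x => rfl⟩
  -- In dimension zero the identity has norm 0, so the norm computation below needs a nontrivial
  -- space.
  rcases subsingleton_or_nontrivial (EuclideanSpace ℝ d) with h | h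
  · exact Or.inl h
  · right
    have : ‖((ContinuousLinearEquiv.refl ℝ (EuclideanSpace ℝ d)).symm :
        EuclideanSpace ℝ d →L[ℝ] EuclideanSpace ℝ d)‖₊ = 1 :=
      NNReal.eq (ContinuousLinearMap.norm_id)
    rw [this]
    rw [← NNReal.coe_lt_coe]; norm_num

lemma lipschitzWith_launch {ξ : EuclideanSpace ℝ (d ⊕ Unit)} (hξ : height ξ < 0)
    (hsmall : 16 * (√S.flatness * ‖ξ‖) ≤ -height ξ) : LipschitzWith 2 (S.launch ξ) := by
  refine LipschitzWith.of_dist_le_mul fun x y => ?_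
  rw [dist_eq_norm, dist_eq_norm]
  have h1 := S.norm_launch_sub_launch_sub_le hξ hsmall x y
  have h2 := norm_le_norm_add_norm_sub' (S.launch ξ x - S.launch ξ y) (x - y)
  rw [NNReal.coe_ofNat]
  linarith [norm_nonneg (x - y)]

lemma launch_add_period {g : EuclideanSpace ℝ d} (hg : g ∈ S.periods)
    (ξ : EuclideanSpace ℝ (d ⊕ Unit)) (x : EuclideanSpace ℝ d) :
    S.launch ξ (x + g) = S.launch ξ x + g := by
  rw [launch, launch, S.F_add_period hg]; abel

/-- The Jacobian determinant of `launch`. -/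
def launchDet (ξ : EuclideanSpace ℝ (d ⊕ Unit)) (x : EuclideanSpace ℝ d) : ℝ :=
  1 - inner ℝ (gradient S.F x) (horizontal ξ) / height ξ

lemma abs_launchDet_sub_one_le {ξ : EuclideanSpace ℝ (d ⊕ Unit)} (hξ : height ξ < 0)
    (x : EuclideanSpace ℝ d) :
    |S.launchDet ξ x - 1| ≤ √S.flatness * ‖ξ‖ / (-height ξ) := by
  rw [launchDet, sub_sub_cancel_left, abs_neg, abs_div, abs_of_neg hξ]
  have := S.abs_inner_gradient_le x ξ
  have : 0 < -height ξ := neg_pos.2 hξ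
  gcongr

lemma abs_launchDet_sub_one_le_of_small {ξ : EuclideanSpace ℝ (d ⊕ Unit)} (hξ : height ξ < 0)
    (hsmall : 16 * (√S.flatness * ‖ξ‖) ≤ -height ξ) (x : EuclideanSpace ℝ d) :
    |S.launchDet ξ x - 1| ≤ 1 / 16 := by
  refine (S.abs_launchDet_sub_one_le hξ x).trans ?_
  rw [div_le_iff₀ (neg_pos.2 hξ)]
  linarith

/-- The derivative is the identity plus a map of rank one, whose determinant is one plus the
functional evaluated at the vector. -/
lemma exists_hasFDerivAt_launch (ξ : EuclideanSpace ℝ (d ⊕ Unit))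
    {x : EuclideanSpace ℝ d} (hx : DifferentiableAt ℝ S.F x) :
    ∃ T : EuclideanSpace ℝ d →L[ℝ] EuclideanSpace ℝ d, HasFDerivAt (S.launch ξ) T x ∧
      T.det = S.launchDet ξ x := by
  refine ⟨_, (hasFDerivAt_id x).sub (((hx.hasFDerivAt.sub_const S.c).mul_const
    (height ξ)⁻¹).smul_const (horizontal ξ)), ?_⟩
  rw [ContinuousLinearMap.det]
  have : (((ContinuousLinearMap.id ℝ (EuclideanSpace ℝ d)) -
      ((height ξ)⁻¹ • fderiv ℝ S.F x).smulRight (horizontal ξ) :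
        EuclideanSpace ℝ d →L[ℝ] EuclideanSpace ℝ d) :
        EuclideanSpace ℝ d →ₗ[ℝ] EuclideanSpace ℝ d) =
      LinearMap.transvection (-((height ξ)⁻¹ • (fderiv ℝ S.F x : EuclideanSpace ℝ d →ₗ[ℝ] ℝ)))
        (horizontal ξ) := by
    ext y
    simp [LinearMap.transvection, sub_eq_add_neg]
  refine (congrArg LinearMap.det this).trans ?_
  rw [LinearMap.transvection.det, launchDet]
  simp [gradient]
  ring

/-- `launch` commutes with the periods, and it maps null sets to null sets, which is the measure
condition on its inverse. -/
lemma isAddFundamentalDomain_launch_image_box {ξ : EuclideanSpace ℝ (d ⊕ Unit)}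
    (hξ : height ξ < 0) (hsmall : 16 * (√S.flatness * ‖ξ‖) ≤ -height ξ) :
    IsAddFundamentalDomain S.periods (S.launch ξ '' S.box) := by
  obtain ⟨e, he⟩ := S.exists_homeomorph_launch hξ hsmall
  have hfun : S.launch ξ = e.toEquiv := funext fun x => (he x).symm
  rw [hfun]
  refine S.isAddFundamentalDomain_box.image_of_equiv e.toEquiv ⟨e.symm.measurable, ?_⟩
    (Equiv.refl _) fun g x => ?_
  · refine Measure.AbsolutelyContinuous.mk fun s hs h0 => ?_
    refine (Measure.map_apply e.symm.measurable hs).trans ?_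
    have : e.symm ⁻¹' s = S.launch ξ '' s := by
      rw [hfun]; exact (e.toEquiv.image_eq_preimage_symm s).symm
    refine (congrArg volume this).trans ?_
    refine le_antisymm ((volume_image_le_of_lipschitzWith
      (S.lipschitzWith_launch hξ hsmall) s).trans ?_) bot_le
    rw [h0, mul_zero]
  · simp only [Equiv.refl_apply, Submodule.vadd_def, vadd_eq_add]
    rw [← hfun, add_comm, S.launch_add_period g.2, add_comm]

/-- The mean of a function of the return velocity, as an integral over the boundary. -/
lemma integral_returnVelocity {ξ : EuclideanSpace ℝ (d ⊕ Unit)} (hξ : height ξ < 0)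
    (hsmall : 16 * (√S.flatness * ‖ξ‖) ≤ -height ξ)
    (Ψ : EuclideanSpace ℝ (d ⊕ Unit) → ℝ) :
    ∫ x, Ψ (S.returnVelocity x ξ) ∂S.uniform =
      ∫ x, S.launchDet ξ x * Ψ (S.scatter x ξ) ∂S.uniform := by
  obtain ⟨e, he⟩ := S.exists_homeomorph_launch hξ hsmall
  have hinj : Function.Injective (S.launch ξ) := fun x y hxy => by
    rw [← he, ← he] at hxy; exact e.injective hxy
  have hnull : ∀ N : Set (EuclideanSpace ℝ d), volume N = 0 → volume (S.launch ξ '' N) = 0 :=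
    fun N hN => le_antisymm ((volume_image_le_of_lipschitzWith
      (S.lipschitzWith_launch hξ hsmall) N).trans (by rw [hN, mul_zero])) bot_le
  set G := {x | DifferentiableAt ℝ S.F x} with hG
  have hGm : MeasurableSet G := measurableSet_of_differentiableAt ℝ S.F
  have hG0 : volume Gᶜ = 0 := S.ae_differentiableAt
  have hΓ : ∀ g ∈ S.periods, ∀ x, x + g ∈ S.launch ξ '' G ↔ x ∈ S.launch ξ '' G := by
    have key : ∀ g ∈ S.periods, ∀ x, x ∈ S.launch ξ '' G → x + g ∈ S.launch ξ '' G := by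
      rintro g hg _ ⟨y, hy, rfl⟩
      exact ⟨y + g, (S.differentiableAt_add_period hg y).2 hy, S.launch_add_period hg ξ y⟩
    refine fun g hg x => ⟨fun h => ?_, key g hg x⟩
    have := key (-g) (neg_mem hg) _ h
    rwa [add_neg_cancel_right] at this
  -- Only over regular points is the return velocity known explicitly. The cut-off alters the
  -- integrand on a null set and makes it periodic at every point, as the change of fundamental
  -- domain requires.
  set f : EuclideanSpace ℝ d → ℝ :=
    (S.launch ξ '' G).indicator fun x => Ψ (S.returnVelocity x ξ) with hf
  have hval : ∀ y ∈ G, f (S.launch ξ y) = Ψ (S.scatter y ξ) := fun y hy => by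
    rw [hf, Set.indicator_of_mem (Set.mem_image_of_mem _ hy), S.returnVelocity_launch hξ hsmall hy]
  have hfper : ∀ g ∈ S.periods, ∀ x, f (x + g) = f x := by
    intro g hg x
    by_cases hx : x ∈ S.launch ξ '' G
    · obtain ⟨y, hy, rfl⟩ := hx
      rw [← S.launch_add_period hg, hval y hy,
        hval _ ((S.differentiableAt_add_period hg y).2 hy), scatter, scatter,
        S.normal_add_period hg]
    · rw [hf, Set.indicator_of_notMem hx, Set.indicator_of_notMem (mt (hΓ g hg x).1 hx)]
  have hae : ∀ᵐ x, f x = Ψ (S.returnVelocity x ξ) := by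
    have : ∀ᵐ x, x ∈ S.launch ξ '' G := by
      rw [ae_iff]
      have hsub : {x | x ∉ S.launch ξ '' G} ⊆ S.launch ξ '' Gᶜ := by
        intro x hx
        obtain ⟨y, rfl⟩ := e.surjective x
        refine ⟨y, fun hy => hx ⟨y, hy, (he y).symm⟩, (he y).symm⟩
      exact measure_mono_null hsub (hnull _ hG0)
    filter_upwards [this] with x hx
    rw [hf, Set.indicator_of_mem hx]
  rw [← integral_congr_ae (S.uniform_absolutelyContinuous hae), integral_uniform, integral_uniform]
  congr 1
  rw [S.setIntegral_box_eq (S.isAddFundamentalDomain_launch_image_box hξ hsmall) hfper]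
  have hboxG : (S.box ∩ G : Set _) =ᵐ[volume] S.box := by
    refine inter_ae_eq_left_of_ae_eq_univ ?_
    exact eventuallyEq_univ.2 S.ae_differentiableAt
  have himg : (S.launch ξ '' S.box : Set _) =ᵐ[volume] S.launch ξ '' (S.box ∩ G) := by
    refine (ae_eq_set.2 ⟨?_, ?_⟩)
    · refine measure_mono_null ?_ (hnull _ hG0)
      rintro _ ⟨⟨y, hy, rfl⟩, hn⟩
      exact ⟨y, fun hyG => hn ⟨y, ⟨hy, hyG⟩, rfl⟩, rfl⟩
    · rw [Set.sdiff_eq_empty.2 (Set.image_mono Set.inter_subset_left), measure_empty]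
  rw [setIntegral_congr_set himg]
  choose! T hT hTdet using fun (x : EuclideanSpace ℝ d) (hx : x ∈ G) =>
    S.exists_hasFDerivAt_launch ξ hx
  rw [integral_image_eq_integral_abs_det_fderiv_smul volume (S.measurableSet_box.inter hGm)
    (fun x hx => (hT x hx.2).hasFDerivWithinAt) hinj.injOn, ← setIntegral_congr_set hboxG]
  refine setIntegral_congr_fun (S.measurableSet_box.inter hGm) fun x hx => ?_
  rw [hTdet x hx.2, hval x hx.2, smul_eq_mul, abs_of_nonneg]
  have := (abs_le.1 (S.abs_launchDet_sub_one_le_of_small hξ hsmall x)).1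
  linarith

end BilliardSystem

/-! ### Second order Taylor expansion -/

/-- Two mean value inequalities: the Lipschitz bound on the second derivative controls the first
derivative on a ball, which controls the function along the segment. The sharp factor 1/6 is not
needed. -/
lemma abs_sub_taylor_two_le {V : Type*} [NormedAddCommGroup V] [NormedSpace ℝ V] {f : V → ℝ}
    (hf : ContDiff ℝ 2 f) {M : ℝ}
    (hM : ∀ x y, ‖fderiv ℝ (fderiv ℝ f) x - fderiv ℝ (fderiv ℝ f) y‖ ≤ M * ‖x - y‖) (x u : V) :
    |f (x + u) - f x - fderiv ℝ f x u - 1 / 2 * fderiv ℝ (fderiv ℝ f) x u u| ≤ M * ‖u‖ ^ 3 := by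
  rcases eq_or_ne u 0 with rfl | hu
  · simp
  have hu0 : 0 < ‖u‖ := norm_pos_iff.2 hu
  have hM0 : 0 ≤ M := by
    have := (norm_nonneg (fderiv ℝ (fderiv ℝ f) u - fderiv ℝ (fderiv ℝ f) 0)).trans (hM u 0)
    rw [sub_zero] at this
    exact nonneg_of_mul_nonneg_left this hu0
  have hf1 : ContDiff ℝ 1 (fderiv ℝ f) := hf.fderiv_right (by norm_num)
  have hline : ∀ t : ℝ, HasDerivAt (fun t : ℝ => x + t • u) u t := fun t => by
    simpa using ((hasDerivAt_id t).smul_const u).const_add x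
  have hnorm : ∀ t ∈ Set.Ico (0 : ℝ) 1, ‖x + t • u - x‖ ≤ ‖u‖ := fun t ht => by
    rw [add_sub_cancel_left, norm_smul, Real.norm_eq_abs, abs_of_nonneg ht.1]
    exact mul_le_of_le_one_left hu0.le ht.2.le
  have h1 : ∀ t ∈ Set.Icc (0 : ℝ) 1,
      ‖fderiv ℝ f (x + t • u) - fderiv ℝ f x - t • fderiv ℝ (fderiv ℝ f) x u‖ ≤
        M * ‖u‖ * ‖u‖ := by
    intro t ht
    have hd : ∀ y ∈ Metric.closedBall x ‖u‖,
        HasFDerivWithinAt (fun y => fderiv ℝ f y - fderiv ℝ (fderiv ℝ f) x y)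
          (fderiv ℝ (fderiv ℝ f) y - fderiv ℝ (fderiv ℝ f) x) (Metric.closedBall x ‖u‖) y :=
      fun y _ => (((hf1.differentiable (by norm_num)) y).hasFDerivAt.sub
        (fderiv ℝ (fderiv ℝ f) x).hasFDerivAt).hasFDerivWithinAt
    have hb : ∀ y ∈ Metric.closedBall x ‖u‖,
        ‖fderiv ℝ (fderiv ℝ f) y - fderiv ℝ (fderiv ℝ f) x‖ ≤ M * ‖u‖ := fun y hy =>
      (hM y x).trans (mul_le_mul_of_nonneg_left (mem_closedBall_iff_norm.1 hy) hM0)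
    have hmem : x + t • u ∈ Metric.closedBall x ‖u‖ := by
      rw [mem_closedBall_iff_norm, add_sub_cancel_left, norm_smul, Real.norm_eq_abs,
        abs_of_nonneg ht.1]
      exact mul_le_of_le_one_left hu0.le ht.2
    have := (convex_closedBall x ‖u‖).norm_image_sub_le_of_norm_hasFDerivWithin_le hd hb
      (Metric.mem_closedBall_self hu0.le) hmem
    refine le_trans (le_of_eq ?_) (this.trans ?_)
    · congr 1
      rw [map_add, map_smul]
      abel
    · rw [← mem_closedBall_iff_norm] at *
      exact mul_le_mul_of_nonneg_left (mem_closedBall_iff_norm.1 hmem) (by positivity)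
  have h2 := norm_image_sub_le_of_norm_deriv_le_segment_01'
    (f := fun t : ℝ => f (x + t • u) - t * fderiv ℝ f x u -
      t ^ 2 / 2 * fderiv ℝ (fderiv ℝ f) x u u)
    (f' := fun t => (fderiv ℝ f (x + t • u) - fderiv ℝ f x - t • fderiv ℝ (fderiv ℝ f) x u) u)
    (C := M * ‖u‖ ^ 3) (fun t _ => ?_) (fun t ht => ?_)
  · refine le_trans (le_of_eq ?_) h2
    rw [Real.norm_eq_abs]
    congr 1
    simp
    ring
  · have hc : HasDerivAt (fun t : ℝ => f (x + t • u)) (fderiv ℝ f (x + t • u) u) t := by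
      have := ((hf.differentiable (by norm_num)) (x + t • u)).hasFDerivAt.comp_hasDerivAt t
        (hline t)
      simpa [Function.comp_def] using this
    have hq : HasDerivAt (fun t : ℝ => t ^ 2 / 2 * fderiv ℝ (fderiv ℝ f) x u u)
        (t * fderiv ℝ (fderiv ℝ f) x u u) t := by
      have := ((hasDerivAt_pow 2 t).div_const 2).mul_const (fderiv ℝ (fderiv ℝ f) x u u)
      refine this.congr_deriv ?_
      simp
    have hl : HasDerivAt (fun t : ℝ => t * fderiv ℝ f x u) (fderiv ℝ f x u) t := by
      simpa using (hasDerivAt_id t).mul_const (fderiv ℝ f x u)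
    refine (((hc.sub hl).sub hq).congr_deriv ?_).hasDerivWithinAt
    simp
  · refine (ContinuousLinearMap.le_opNorm _ _).trans ?_
    have := mul_le_mul_of_nonneg_right (h1 t ⟨ht.1, ht.2.le⟩) hu0.le
    refine this.trans (le_of_eq ?_)
    ring

/-! ### Expansion of the scattered velocity -/

namespace BilliardSystem

variable {d : Type} [Fintype d]

/-- The part of the second order expansion that is even in the gradient, with `b` for `n̄(x)`. -/
def evenTerm (L : EuclideanSpace ℝ (d ⊕ Unit) →L[ℝ] ℝ)
    (Q : EuclideanSpace ℝ (d ⊕ Unit) →L[ℝ] EuclideanSpace ℝ (d ⊕ Unit) →L[ℝ] ℝ)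
    (ξ b : EuclideanSpace ℝ (d ⊕ Unit)) : ℝ :=
  -4 * inner ℝ b ξ * L b + 2 * (inner ℝ b ξ ^ 2 / height ξ - height ξ * ‖b‖ ^ 2) * L (vec 0 1) +
    2 * Q (height ξ • b - inner ℝ b ξ • vec 0 1) (height ξ • b - inner ℝ b ξ • vec 0 1)

/-- The part of the first order expansion that is odd in the gradient, with `b` for `n̄(x)` and
`r` for the last component of `n(x)`. -/
def oddTerm (z : ℝ) (L : EuclideanSpace ℝ (d ⊕ Unit) →L[ℝ] ℝ)
    (ξ b : EuclideanSpace ℝ (d ⊕ Unit)) (r : ℝ) : ℝ :=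
  z * (inner ℝ b ξ / (r * height ξ)) -
    2 * (r * height ξ + inner ℝ b ξ ^ 2 / (r * height ξ)) * L b +
    2 * (r * inner ℝ b ξ - ‖b‖ ^ 2 * inner ℝ b ξ / r) * L (vec 0 1)

lemma oddTerm_neg (z : ℝ) (L : EuclideanSpace ℝ (d ⊕ Unit) →L[ℝ] ℝ)
    (ξ b : EuclideanSpace ℝ (d ⊕ Unit)) (r : ℝ) :
    oddTerm z L ξ (-b) r = -oddTerm z L ξ b r := by
  simp only [oddTerm, inner_neg_left, norm_neg, map_neg]
  ring

lemma norm_vec_zero_one : ‖(vec 0 1 : EuclideanSpace ℝ (d ⊕ Unit))‖ = 1 := by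
  have h := norm_sq_eq_horizontal_add_height (vec 0 1 : EuclideanSpace ℝ (d ⊕ Unit))
  rw [horizontal_vec, height_vec, norm_zero] at h
  refine (pow_eq_one_iff_of_nonneg (norm_nonneg _) two_ne_zero).1 ?_
  rw [h]; norm_num

variable [DecidableEq d] (S : BilliardSystem d)

@[simp] lemma height_normalBar (x : EuclideanSpace ℝ d) : height (S.normalBar x) = 0 := by
  simp [normalBar]

lemma norm_normalBar_sq (x : EuclideanSpace ℝ d) :
    ‖S.normalBar x‖ ^ 2 = 1 - height (S.normal x) ^ 2 := by
  have h := norm_sq_eq_horizontal_add_height (S.normal x)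
  rw [norm_normal] at h
  rw [norm_sq_eq_horizontal_add_height, height_normalBar, normalBar, horizontal_vec]
  linarith

lemma normalBar_eq (x : EuclideanSpace ℝ d) :
    S.normalBar x = vec (-(height (S.normal x) • gradient S.F x)) 0 := by
  rw [normalBar, horizontal_normal]

lemma norm_normalBar_le (x : EuclideanSpace ℝ d) : ‖S.normalBar x‖ ≤ √S.flatness := by
  refine (norm_le_horizontal_add_height _).trans ?_
  rw [height_normalBar, abs_zero, add_zero, normalBar_eq, horizontal_vec, norm_neg, norm_smul,
    Real.norm_eq_abs, abs_of_pos (S.height_normal_pos x)]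
  exact (mul_le_of_le_one_left (norm_nonneg _) (S.height_normal_le_one x)).trans
    (S.norm_gradient_le x)

lemma inner_normalBar (x : EuclideanSpace ℝ d) (ξ : EuclideanSpace ℝ (d ⊕ Unit)) :
    inner ℝ (S.normalBar x) ξ =
      -(height (S.normal x) * inner ℝ (gradient S.F x) (horizontal ξ)) := by
  rw [normalBar_eq, inner_eq_horizontal_add_height, horizontal_vec, height_vec, inner_neg_left,
    real_inner_smul_left]
  ring

lemma inner_normal_eq (x : EuclideanSpace ℝ d) (ξ : EuclideanSpace ℝ (d ⊕ Unit)) :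
    inner ℝ (S.normal x) ξ =
      inner ℝ (S.normalBar x) ξ + height (S.normal x) * height ξ := by
  rw [inner_normal, inner_normalBar]; ring

lemma launchDet_eq {ξ : EuclideanSpace ℝ (d ⊕ Unit)} (hξ : height ξ < 0)
    (x : EuclideanSpace ℝ d) :
    S.launchDet ξ x = 1 + inner ℝ (S.normalBar x) ξ / (height (S.normal x) * height ξ) := by
  have h1 := (S.height_normal_pos x).ne'
  have h2 := hξ.ne
  rw [launchDet, inner_normalBar]
  field_simp
  ring

lemma scatter_eq (x : EuclideanSpace ℝ d) (ξ : EuclideanSpace ℝ (d ⊕ Unit)) :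
    S.scatter x ξ = ξ +
      ((-2 * (inner ℝ (S.normalBar x) ξ + height (S.normal x) * height ξ)) • S.normalBar x +
        (2 * (height (S.normal x) * inner ℝ (S.normalBar x) ξ -
          height ξ * ‖S.normalBar x‖ ^ 2)) • vec 0 1) := by
  have hbar : horizontal (S.normalBar x) = horizontal (S.normal x) := by simp [normalBar]
  refine ext_horizontal_height ?_ ?_
  · simp only [scatter, horizontal_vec, horizontal_sub, horizontal_add, horizontal_smul,
      S.inner_normal_eq, smul_zero, add_zero, neg_mul]
    rw [neg_smul, ← sub_eq_add_neg, hbar]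
  · simp only [scatter, height_vec, height_sub, height_add, height_smul, S.inner_normal_eq,
      height_normalBar, norm_normalBar_sq]
    ring

/-- The Jacobian times the linear Taylor term splits exactly by parity in the gradient, so odd terms
of every order go into `oddTerm`. Approximation enters only through the Taylor remainder and the
quadratic term. -/
lemma abs_launchDet_mul_sub_le {ξ : EuclideanSpace ℝ (d ⊕ Unit)} (hξ : height ξ < 0)
    (hsmall : 16 * (√S.flatness * ‖ξ‖) ≤ -height ξ) {Ψ : EuclideanSpace ℝ (d ⊕ Unit) → ℝ}
    (hΨ : ContDiff ℝ 2 Ψ) {M q : ℝ} (hM : ∀ x y,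
      ‖fderiv ℝ (fderiv ℝ Ψ) x - fderiv ℝ (fderiv ℝ Ψ) y‖ ≤ M * ‖x - y‖) (hM0 : 0 ≤ M)
    (hq : ‖fderiv ℝ (fderiv ℝ Ψ) ξ‖ ≤ q) (x : EuclideanSpace ℝ d) :
    |S.launchDet ξ x * Ψ (S.scatter x ξ) - Ψ ξ -
        oddTerm (Ψ ξ) (fderiv ℝ Ψ ξ) ξ (S.normalBar x) (height (S.normal x)) -
        evenTerm (fderiv ℝ Ψ ξ) (fderiv ℝ (fderiv ℝ Ψ) ξ) ξ (S.normalBar x)| ≤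
      √S.flatness ^ 3 * (432 * M * ‖ξ‖ ^ 3 + 36 * q * ‖ξ‖ ^ 2 * (‖ξ‖ / (-height ξ)) +
        42 * q * ‖ξ‖ ^ 2) := by
  have hρ := S.sqrt_flatness_le hξ hsmall
  have hρ0 : 0 ≤ √S.flatness := Real.sqrt_nonneg _
  have hwt := S.abs_launchDet_sub_one_le hξ x
  have hwt' := S.abs_launchDet_sub_one_le_of_small hξ hsmall x
  have hdet := S.launchDet_eq hξ x
  have hsc := S.scatter_eq x ξ
  have hb := S.norm_normalBar_le x
  have hb2 := S.norm_normalBar_sq x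
  have hr0 := S.height_normal_pos x
  have hr1 := S.height_normal_le_one x
  have hN : |inner ℝ (S.normalBar x) ξ + height (S.normal x) * height ξ| ≤ ‖ξ‖ := by
    rw [← S.inner_normal_eq]
    refine (abs_real_inner_le_norm _ _).trans ?_
    rw [norm_normal, one_mul]
  have hs : |inner ℝ (S.normalBar x) ξ| ≤ √S.flatness * ‖ξ‖ :=
    (abs_real_inner_le_norm _ _).trans (mul_le_mul_of_nonneg_right hb (norm_nonneg _))
  have ha := abs_height_le ξ
  set ρ := √S.flatness
  set b := S.normalBar x
  set r := height (S.normal x)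
  set s := inner ℝ b ξ with hsdef
  set a := height ξ with hadef
  set L := fderiv ℝ Ψ ξ
  set Q := fderiv ℝ (fderiv ℝ Ψ) ξ with hQ
  set e := (vec 0 1 : EuclideanSpace ℝ (d ⊕ Unit)) with he
  have hnorm_e : ‖e‖ = 1 := norm_vec_zero_one
  -- `Δ` is the full change of velocity and `Δ₁` its part of first order in `b`.
  set Δ := (-2 * (s + r * a)) • b + (2 * (r * s - a * ‖b‖ ^ 2)) • e with hΔ
  set Δ₁ := (-2 : ℝ) • (a • b - s • e) with hΔ₁
  have hξ0 : 0 ≤ ‖ξ‖ := norm_nonneg _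
  have hb0 : 0 ≤ ‖b‖ := norm_nonneg _
  have hbsq : ‖b‖ ^ 2 ≤ ρ ^ 2 := pow_le_pow_left₀ hb0 hb 2
  have hρ1 : ρ ^ 2 ≤ ρ := by nlinarith
  have hq0 : 0 ≤ q := (norm_nonneg Q).trans hq
  have hcomb : ∀ (α β A B : ℝ), |α| ≤ A → |β| ≤ B → ‖α • b + β • e‖ ≤ A * ρ + B := by
    intro α β A B hα hβ
    refine (norm_add_le _ _).trans ?_
    rw [norm_smul, norm_smul, hnorm_e, mul_one]
    exact add_le_add (mul_le_mul hα hb hb0 ((abs_nonneg _).trans hα)) hβ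
  have hΔn : ‖Δ‖ ≤ 6 * (ρ * ‖ξ‖) := by
    have h1 : |(-2 * (s + r * a))| ≤ 2 * ‖ξ‖ := by
      rw [abs_mul, abs_neg, abs_two]; linarith
    have h2 : |2 * (r * s - a * ‖b‖ ^ 2)| ≤ 2 * (ρ * ‖ξ‖ + ‖ξ‖ * ρ) := by
      rw [abs_mul, abs_two]
      refine mul_le_mul_of_nonneg_left ((abs_sub _ _).trans (add_le_add ?_ ?_)) zero_le_two
      · rw [abs_mul, abs_of_pos hr0]
        exact (mul_le_of_le_one_left (abs_nonneg _) hr1).trans hs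
      · rw [abs_mul, abs_of_nonneg (sq_nonneg ‖b‖)]
        exact mul_le_mul ha (hbsq.trans hρ1) (sq_nonneg _) hξ0
    refine (hcomb _ _ _ _ h1 h2).trans (le_of_eq ?_)
    ring
  have hΔ₁n : ‖Δ₁‖ ≤ 6 * (ρ * ‖ξ‖) := by
    have : Δ₁ = (-2 * a) • b + (2 * s) • e := by
      rw [hΔ₁]; module
    rw [this]
    refine (hcomb _ _ (2 * ‖ξ‖) (2 * (ρ * ‖ξ‖)) ?_ ?_).trans ?_
    · rw [abs_mul, abs_neg, abs_two]; linarith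
    · rw [abs_mul, abs_two]; linarith
    · nlinarith [mul_nonneg hρ0 hξ0]
  -- Since `r ≤ 1`, `1 - r` is at most `1 - r ^ 2 = ‖b‖ ^ 2`.
  have h1r : 1 - r ≤ ρ ^ 2 := by nlinarith
  have hdiff : ‖Δ - Δ₁‖ ≤ 7 * (ρ ^ 2 * ‖ξ‖) := by
    have : Δ - Δ₁ = (-2 * (s - (1 - r) * a)) • b +
        (-2 * ((1 - r) * s + a * ‖b‖ ^ 2)) • e := by
      rw [hΔ, hΔ₁]; module
    rw [this]
    have e1 : |(1 - r) * a| ≤ ρ * ‖ξ‖ := by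
      rw [abs_mul, abs_of_nonneg (by linarith : 0 ≤ 1 - r)]
      exact mul_le_mul (h1r.trans hρ1) ha (abs_nonneg _) hρ0
    have e2 : |(1 - r) * s| ≤ ρ ^ 2 * (1 / 16 * ‖ξ‖) := by
      rw [abs_mul, abs_of_nonneg (by linarith : 0 ≤ 1 - r)]
      refine mul_le_mul h1r (hs.trans ?_) (abs_nonneg _) (sq_nonneg _)
      exact mul_le_mul_of_nonneg_right hρ hξ0
    have e3 : |a * ‖b‖ ^ 2| ≤ ‖ξ‖ * ρ ^ 2 := by
      rw [abs_mul, abs_of_nonneg (sq_nonneg ‖b‖)]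
      exact mul_le_mul ha hbsq (sq_nonneg _) hξ0
    refine (hcomb _ _ (2 * (ρ * ‖ξ‖ + ρ * ‖ξ‖))
      (2 * (ρ ^ 2 * (1 / 16 * ‖ξ‖) + ‖ξ‖ * ρ ^ 2)) ?_ ?_).trans ?_
    · rw [abs_mul, abs_neg, abs_two]
      exact mul_le_mul_of_nonneg_left ((abs_sub _ _).trans (add_le_add hs e1)) zero_le_two
    · rw [abs_mul, abs_neg, abs_two]
      exact mul_le_mul_of_nonneg_left ((abs_add_le _ _).trans (add_le_add e2 e3)) zero_le_two
    · nlinarith [mul_nonneg (sq_nonneg ρ) hξ0]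
  have hQb : ∀ u v, |Q u v| ≤ q * ‖u‖ * ‖v‖ := fun u v =>
    (Q.le_opNorm₂ u v).trans (mul_le_mul_of_nonneg_right
      (mul_le_mul_of_nonneg_right hq (norm_nonneg u)) (norm_nonneg v))
  have hrem := abs_sub_taylor_two_le hΨ hM ξ Δ
  rw [← hsc] at hrem
  set D := S.launchDet ξ x
  set R := Ψ (S.scatter x ξ) - Ψ ξ - L Δ - 1 / 2 * Q Δ Δ with hR
  have hD2 : |D| ≤ 2 := by
    have := abs_le.1 hwt'
    rw [abs_le]; constructor <;> linarith
  have key : D * Ψ (S.scatter x ξ) - Ψ ξ - oddTerm (Ψ ξ) L ξ b r - evenTerm L Q ξ b =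
      D * R + 1 / 2 * ((D - 1) * Q Δ Δ + (Q (Δ - Δ₁) Δ + Q Δ₁ (Δ - Δ₁))) := by
    -- The product `D * (s + r * a)` is `(s + r * a) ^ 2 / (r * a)`. The signs of `s` and `b` follow
    -- the gradient while `r` and `‖b‖ ^ 2` are even, so the bracket in the second line collects the
    -- odd terms.
    have hlin : D * L Δ = -4 * s * L b + 2 * (s ^ 2 / a - a * ‖b‖ ^ 2) * L e +
        (-(2 * (r * a + s ^ 2 / (r * a)) * L b) + 2 * (r * s - ‖b‖ ^ 2 * s / r) * L e) := by
      have hr' := hr0.ne'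
      have ha' := hξ.ne
      rw [hdet, hΔ, map_add, map_smul, map_smul, smul_eq_mul, smul_eq_mul]
      field_simp
      ring
    have hQ₁ : Q Δ₁ Δ₁ = 4 * Q (a • b - s • e) (a • b - s • e) := by
      rw [hΔ₁]
      simp only [map_smul, smul_apply, smul_eq_mul]
      ring
    have hΨsc : Ψ (S.scatter x ξ) = R + Ψ ξ + L Δ + 1 / 2 * Q Δ Δ := by rw [hR]; ring
    have hz : Ψ ξ * D = Ψ ξ + Ψ ξ * (s / (r * a)) := by rw [hdet]; ring
    have hQsub : Q (Δ - Δ₁) Δ + Q Δ₁ (Δ - Δ₁) = Q Δ Δ - Q Δ₁ Δ₁ := by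
      simp only [map_sub, sub_apply]; ring
    rw [hΨsc, hQsub, hQ₁, oddTerm, evenTerm, ← hsdef, ← hadef, ← he]
    linear_combination hlin + hz
  rw [key]
  have hR' : |R| ≤ M * ‖Δ‖ ^ 3 := hrem
  clear_value R D Δ Δ₁ Q
  -- The constants are `432 = 2 * 6 ^ 3`, from the Taylor remainder, and `42 = 6 * 7`, from the two
  -- quadratic differences averaged by the factor 1/2.
  have b1 : |D * R| ≤ 2 * (M * (6 * (ρ * ‖ξ‖)) ^ 3) := by
    rw [abs_mul]
    refine mul_le_mul hD2 (hR'.trans ?_) (abs_nonneg _) zero_le_two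
    exact mul_le_mul_of_nonneg_left (pow_le_pow_left₀ (norm_nonneg _) hΔn 3) hM0
  have hQbd : ∀ u v : EuclideanSpace ℝ (d ⊕ Unit), ∀ A B : ℝ, ‖u‖ ≤ A → ‖v‖ ≤ B →
      |Q u v| ≤ q * A * B := fun u v A B hu hv =>
    (hQb u v).trans (mul_le_mul (mul_le_mul_of_nonneg_left hu hq0) hv (norm_nonneg v)
      (mul_nonneg hq0 ((norm_nonneg u).trans hu)))
  have b2 : |(D - 1) * Q Δ Δ| ≤ (ρ * ‖ξ‖ / (-a)) * (q * (6 * (ρ * ‖ξ‖)) * (6 * (ρ * ‖ξ‖))) := by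
    rw [abs_mul]
    exact mul_le_mul hwt (hQbd _ _ _ _ hΔn hΔn) (abs_nonneg _)
      (div_nonneg (mul_nonneg hρ0 hξ0) (neg_pos.2 hξ).le)
  have b3 : |Q (Δ - Δ₁) Δ| ≤ q * (7 * (ρ ^ 2 * ‖ξ‖)) * (6 * (ρ * ‖ξ‖)) :=
    hQbd _ _ _ _ hdiff hΔn
  have b4 : |Q Δ₁ (Δ - Δ₁)| ≤ q * (6 * (ρ * ‖ξ‖)) * (7 * (ρ ^ 2 * ‖ξ‖)) :=
    hQbd _ _ _ _ hΔ₁n hdiff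
  have b5 := abs_add_le (D * R) (1 / 2 * ((D - 1) * Q Δ Δ + (Q (Δ - Δ₁) Δ + Q Δ₁ (Δ - Δ₁))))
  rw [abs_mul (1 / 2), abs_of_pos (by norm_num : (0 : ℝ) < 1 / 2)] at b5
  have b6 := abs_add_le ((D - 1) * Q Δ Δ) (Q (Δ - Δ₁) Δ + Q Δ₁ (Δ - Δ₁))
  have b7 := abs_add_le (Q (Δ - Δ₁) Δ) (Q Δ₁ (Δ - Δ₁))
  have b8 : (ρ * ‖ξ‖ / (-a)) * (q * (6 * (ρ * ‖ξ‖)) * (6 * (ρ * ‖ξ‖))) =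
      ρ ^ 3 * (36 * q * ‖ξ‖ ^ 2 * (‖ξ‖ / (-a))) := by ring
  have b9 : 0 ≤ ρ ^ 3 * (36 * q * ‖ξ‖ ^ 2 * (‖ξ‖ / (-a))) := by
    have : 0 ≤ ‖ξ‖ / (-a) := div_nonneg hξ0 (neg_pos.2 hξ).le
    positivity
  rw [b8] at b2
  linarith

end BilliardSystem

/-! ### The means of the even and odd parts over the torus -/

namespace BilliardSystem

variable {d : Type} [DecidableEq d]

lemma vec_zero_one_eq : (vec 0 1 : EuclideanSpace ℝ (d ⊕ Unit)) =
    EuclideanSpace.single (Sum.inr ()) 1 := by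
  ext i; rcases i with i | i <;> simp [vec]

variable [Fintype d]

/-- The coefficients of `evenTerm` as a quadratic form in `b`. -/
def evenCoeff (L : EuclideanSpace ℝ (d ⊕ Unit) →L[ℝ] ℝ)
    (Q : EuclideanSpace ℝ (d ⊕ Unit) →L[ℝ] EuclideanSpace ℝ (d ⊕ Unit) →L[ℝ] ℝ)
    (ξ : EuclideanSpace ℝ (d ⊕ Unit)) (i j : d ⊕ Unit) : ℝ :=
  -4 * ξ i * L (EuclideanSpace.single j 1) +
    2 * (ξ i * ξ j / height ξ - height ξ * (1 : Matrix (d ⊕ Unit) (d ⊕ Unit) ℝ) i j) *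
      L (vec 0 1) +
    2 * (height ξ ^ 2 * Q (EuclideanSpace.single i 1) (EuclideanSpace.single j 1) -
      height ξ * ξ i * (Q (EuclideanSpace.single j 1) (vec 0 1) +
        Q (vec 0 1) (EuclideanSpace.single j 1)) + ξ i * ξ j * Q (vec 0 1) (vec 0 1))

/-- As a quadratic form in `b`, the even part has a mean that depends on the system only through the
matrix `A`. -/
lemma evenTerm_eq_sum (L : EuclideanSpace ℝ (d ⊕ Unit) →L[ℝ] ℝ)
    (Q : EuclideanSpace ℝ (d ⊕ Unit) →L[ℝ] EuclideanSpace ℝ (d ⊕ Unit) →L[ℝ] ℝ)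
    (ξ b : EuclideanSpace ℝ (d ⊕ Unit)) :
    evenTerm L Q ξ b = ∑ i, ∑ j, b i * b j * evenCoeff L Q ξ i j := by
  have hbsum : b = ∑ i, b i • (EuclideanSpace.single i 1 : EuclideanSpace ℝ (d ⊕ Unit)) := by
    conv_lhs => rw [← (EuclideanSpace.basisFun (d ⊕ Unit) ℝ).sum_repr b]
    simp only [EuclideanSpace.basisFun_repr, EuclideanSpace.basisFun_apply]
  have hlin : ∀ T : EuclideanSpace ℝ (d ⊕ Unit) →L[ℝ] ℝ,
      T b = ∑ i, b i * T (EuclideanSpace.single i 1) := fun T => by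
    conv_lhs => rw [hbsum]
    simp
  have hs : inner ℝ b ξ = ∑ i, b i * ξ i := by
    simp [PiLp.inner_apply, mul_comm]
  have hn : ‖b‖ ^ 2 = ∑ i, ∑ j, b i * b j * (1 : Matrix (d ⊕ Unit) (d ⊕ Unit) ℝ) i j := by
    rw [EuclideanSpace.norm_sq_eq]
    simp [Matrix.one_apply, sq]
  have hQe : Q b (vec 0 1) = ∑ j, b j * Q (EuclideanSpace.single j 1) (vec 0 1) := by
    have := hlin (Q.flip (vec 0 1))
    simpa using this
  have hQb : Q b b = ∑ i, ∑ j, b i * b j *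
      Q (EuclideanSpace.single i 1) (EuclideanSpace.single j 1) := by
    have := hlin (Q.flip b)
    simp only [ContinuousLinearMap.flip_apply] at this
    rw [this]
    refine Finset.sum_congr rfl fun i _ => ?_
    rw [hlin (Q _), Finset.mul_sum]
    exact Finset.sum_congr rfl fun j _ => by ring
  have e1 : inner ℝ b ξ * L b = ∑ i, ∑ j, b i * b j * (ξ i * L (EuclideanSpace.single j 1)) := by
    rw [hs, hlin L, Finset.sum_mul_sum]
    exact Finset.sum_congr rfl fun i _ => Finset.sum_congr rfl fun j _ => by ring
  have e2 : inner ℝ b ξ ^ 2 = ∑ i, ∑ j, b i * b j * (ξ i * ξ j) := by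
    rw [sq, hs, Finset.sum_mul_sum]
    exact Finset.sum_congr rfl fun i _ => Finset.sum_congr rfl fun j _ => by ring
  have e3 : inner ℝ b ξ * (Q b (vec 0 1) + Q (vec 0 1) b) = ∑ i, ∑ j, b i * b j *
      (ξ i * (Q (EuclideanSpace.single j 1) (vec 0 1) +
        Q (vec 0 1) (EuclideanSpace.single j 1))) := by
    rw [hs, hQe, hlin (Q (vec 0 1)), ← Finset.sum_add_distrib, Finset.sum_mul_sum]
    exact Finset.sum_congr rfl fun i _ => Finset.sum_congr rfl fun j _ => by ring
  have hexp : evenTerm L Q ξ b = -4 * (inner ℝ b ξ * L b) +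
      2 * L (vec 0 1) / height ξ * inner ℝ b ξ ^ 2 - 2 * height ξ * L (vec 0 1) * ‖b‖ ^ 2 +
      2 * height ξ ^ 2 * Q b b -
      2 * height ξ * (inner ℝ b ξ * (Q b (vec 0 1) + Q (vec 0 1) b)) +
      2 * Q (vec 0 1) (vec 0 1) * inner ℝ b ξ ^ 2 := by
    simp only [evenTerm, map_sub, map_smul, sub_apply, smul_apply, smul_eq_mul]
    ring
  rw [hexp, e1, e2, e3, hn, hQb]
  simp only [Finset.mul_sum, ← Finset.sum_add_distrib, ← Finset.sum_sub_distrib]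
  refine Finset.sum_congr rfl fun i _ => Finset.sum_congr rfl fun j _ => ?_
  rw [evenCoeff]
  ring

variable (S : BilliardSystem d)

@[fun_prop] lemma measurable_normalBar : Measurable S.normalBar :=
  (continuous_vec_uncurry.comp (continuous_horizontal.prodMk continuous_const)).measurable.comp
    S.measurable_normal

lemma integrable_normalBar_mul (i j : d ⊕ Unit) :
    Integrable (fun x => S.normalBar x i * S.normalBar x j) S.uniform := by
  have hm : ∀ i : d ⊕ Unit, Measurable fun x => S.normalBar x i := fun i =>
    (by fun_prop : Continuous fun q : EuclideanSpace ℝ (d ⊕ Unit) => q i).measurable.comp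
      S.measurable_normalBar
  refine Integrable.of_bound ((hm i).mul (hm j)).aestronglyMeasurable
    (√S.flatness * √S.flatness) (Eventually.of_forall fun x => ?_)
  rw [norm_mul]
  exact mul_le_mul ((PiLp.norm_apply_le _ i).trans (S.norm_normalBar_le x))
    ((PiLp.norm_apply_le _ j).trans (S.norm_normalBar_le x)) (norm_nonneg _) (Real.sqrt_nonneg _)

lemma integrable_evenTerm (L : EuclideanSpace ℝ (d ⊕ Unit) →L[ℝ] ℝ)
    (Q : EuclideanSpace ℝ (d ⊕ Unit) →L[ℝ] EuclideanSpace ℝ (d ⊕ Unit) →L[ℝ] ℝ)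
    (ξ : EuclideanSpace ℝ (d ⊕ Unit)) :
    Integrable (fun x => evenTerm L Q ξ (S.normalBar x)) S.uniform := by
  simp only [evenTerm_eq_sum]
  exact integrable_finsetSum _ fun i _ => integrable_finsetSum _ fun j _ =>
    (S.integrable_normalBar_mul i j).mul_const _

lemma integral_evenTerm (L : EuclideanSpace ℝ (d ⊕ Unit) →L[ℝ] ℝ)
    (Q : EuclideanSpace ℝ (d ⊕ Unit) →L[ℝ] EuclideanSpace ℝ (d ⊕ Unit) →L[ℝ] ℝ)
    (ξ : EuclideanSpace ℝ (d ⊕ Unit)) :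
    ∫ x, evenTerm L Q ξ (S.normalBar x) ∂S.uniform =
      ∑ i, ∑ j, S.A i j * evenCoeff L Q ξ i j := by
  simp only [evenTerm_eq_sum]
  rw [integral_finsetSum _ fun i _ => integrable_finsetSum _ fun j _ =>
    (S.integrable_normalBar_mul i j).mul_const _]
  refine Finset.sum_congr rfl fun i _ => ?_
  rw [integral_finsetSum _ fun j _ => (S.integrable_normalBar_mul i j).mul_const _]
  refine Finset.sum_congr rfl fun j _ => ?_
  rw [integral_mul_const]
  rfl

variable {S}

/-- As functions of the gradient, `normalBar` is odd and the last component of the normal is even.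
-/
lemma Symmetric.integral_oddTerm (hS : S.Symmetric) (z : ℝ)
    (L : EuclideanSpace ℝ (d ⊕ Unit) →L[ℝ] ℝ) (ξ : EuclideanSpace ℝ (d ⊕ Unit)) :
    ∫ x, oddTerm z L ξ (S.normalBar x) (height (S.normal x)) ∂S.uniform = 0 := by
  simp only [normalBar_eq, height_normal]
  refine hS.integral_eq_zero (φ := fun g => oddTerm z L ξ
    (vec (-((√(1 + ‖g‖ ^ 2))⁻¹ • g)) 0) (√(1 + ‖g‖ ^ 2))⁻¹) fun g => ?_
  rw [← oddTerm_neg, norm_neg]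
  congr 1
  refine ext_horizontal_height ?_ ?_
  · have : ∀ q : EuclideanSpace ℝ (d ⊕ Unit), horizontal (-q) = -horizontal q := fun q => by
      rw [← neg_one_smul ℝ, horizontal_smul, neg_one_smul]
    rw [this]; simp
  · have : ∀ q : EuclideanSpace ℝ (d ⊕ Unit), height (-q) = -height q := fun q => by
      rw [← neg_one_smul ℝ, height_smul, neg_one_mul]
    rw [this]; simp

lemma measurable_oddTerm (S : BilliardSystem d) (z : ℝ)
    (L : EuclideanSpace ℝ (d ⊕ Unit) →L[ℝ] ℝ) (ξ : EuclideanSpace ℝ (d ⊕ Unit)) :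
    Measurable fun x => oddTerm z L ξ (S.normalBar x) (height (S.normal x)) := by
  have hr : Measurable fun x => height (S.normal x) :=
    continuous_height.measurable.comp S.measurable_normal
  have hs : Measurable fun x => inner ℝ (S.normalBar x) ξ :=
    S.measurable_normalBar.inner measurable_const
  have hL : Measurable fun x => L (S.normalBar x) :=
    L.continuous.measurable.comp S.measurable_normalBar
  have hn : Measurable fun x => ‖S.normalBar x‖ := S.measurable_normalBar.norm
  unfold oddTerm
  fun_prop

/-- Second order expansion of the mean of a function of the return velocity, for velocities which
allow only one collision. -/
lemma Symmetric.abs_integral_returnVelocity_sub_le (hS : S.Symmetric)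
    {ξ : EuclideanSpace ℝ (d ⊕ Unit)} (hξ : height ξ < 0)
    (hsmall : 16 * (√S.flatness * ‖ξ‖) ≤ -height ξ) {Ψ : EuclideanSpace ℝ (d ⊕ Unit) → ℝ}
    (hΨ : ContDiff ℝ 2 Ψ) {B M q : ℝ} (hB : ∀ x, |Ψ x| ≤ B) (hM : ∀ x y,
      ‖fderiv ℝ (fderiv ℝ Ψ) x - fderiv ℝ (fderiv ℝ Ψ) y‖ ≤ M * ‖x - y‖) (hM0 : 0 ≤ M)
    (hq : ‖fderiv ℝ (fderiv ℝ Ψ) ξ‖ ≤ q) :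
    |(∫ x, Ψ (S.returnVelocity x ξ) ∂S.uniform) - Ψ ξ -
        ∑ i, ∑ j, S.A i j * evenCoeff (fderiv ℝ Ψ ξ) (fderiv ℝ (fderiv ℝ Ψ) ξ) ξ i j| ≤
      √S.flatness ^ 3 * (432 * M * ‖ξ‖ ^ 3 + 36 * q * ‖ξ‖ ^ 2 * (‖ξ‖ / (-height ξ)) +
        42 * q * ‖ξ‖ ^ 2) := by
  have hpt := S.abs_launchDet_mul_sub_le hξ hsmall hΨ hM hM0 hq
  set K := √S.flatness ^ 3 * (432 * M * ‖ξ‖ ^ 3 + 36 * q * ‖ξ‖ ^ 2 * (‖ξ‖ / (-height ξ)) +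
        42 * q * ‖ξ‖ ^ 2)
  rw [S.integral_returnVelocity hξ hsmall, ← S.integral_evenTerm]
  set f := fun x => S.launchDet ξ x * Ψ (S.scatter x ξ) with hf
  set ev := fun x => evenTerm (fderiv ℝ Ψ ξ) (fderiv ℝ (fderiv ℝ Ψ) ξ) ξ (S.normalBar x) with hev
  set od := fun x => oddTerm (Ψ ξ) (fderiv ℝ Ψ ξ) ξ (S.normalBar x) (height (S.normal x)) with hod
  have hdet : Measurable fun x => S.launchDet ξ x := by
    have : Measurable fun x => inner ℝ (gradient S.F x) (horizontal ξ) :=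
      S.measurable_gradient.inner measurable_const
    unfold launchDet
    fun_prop
  have hsc : Measurable fun x => S.scatter x ξ := by
    simp only [scatter_eq]
    have hr : Measurable fun x => height (S.normal x) :=
      continuous_height.measurable.comp S.measurable_normal
    have hs : Measurable fun x => inner ℝ (S.normalBar x) ξ :=
      S.measurable_normalBar.inner measurable_const
    have hn : Measurable fun x => ‖S.normalBar x‖ := S.measurable_normalBar.norm
    have hb := S.measurable_normalBar
    fun_prop
  have hfint : Integrable f S.uniform := by
    refine Integrable.of_bound (hdet.mul (hΨ.continuous.measurable.comp hsc)).aestronglyMeasurable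
      (2 * B) (Eventually.of_forall fun x => ?_)
    rw [norm_mul, Real.norm_eq_abs, Real.norm_eq_abs]
    refine mul_le_mul ?_ (hB _) (abs_nonneg _) zero_le_two
    have := abs_le.1 (S.abs_launchDet_sub_one_le_of_small hξ hsmall x)
    rw [abs_le]; constructor <;> linarith
  have hevint : Integrable ev S.uniform := S.integrable_evenTerm _ _ _
  have hrem : Integrable (fun x => f x - Ψ ξ - od x - ev x) S.uniform := by
    refine Integrable.of_bound ?_ K (Eventually.of_forall hpt)
    exact ((hfint.aestronglyMeasurable.sub aestronglyMeasurable_const).sub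
      (S.measurable_oddTerm _ _ _).aestronglyMeasurable).sub hevint.aestronglyMeasurable
  -- The odd part is the difference of integrable functions, the remainder being integrable because
  -- it is bounded.
  have hodint : Integrable od S.uniform := by
    have := ((hfint.sub (integrable_const (Ψ ξ))).sub hevint).sub hrem
    refine this.congr (Eventually.of_forall fun x => ?_)
    simp only [Pi.sub_apply]
    ring
  have hint : ∫ x, (f x - Ψ ξ - od x - ev x) ∂S.uniform =
      (∫ x, f x ∂S.uniform) - Ψ ξ - ∫ x, ev x ∂S.uniform := by
    have h1 : Integrable (fun x => f x - Ψ ξ) S.uniform := hfint.sub (integrable_const _)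
    have h2 : Integrable (fun x => f x - Ψ ξ - od x) S.uniform := h1.sub hodint
    rw [integral_sub h2 hevint, integral_sub h1 hodint, integral_sub hfint (integrable_const _),
      hS.integral_oddTerm]
    simp
  rw [← hint]
  have := norm_integral_le_of_norm_le_const (μ := S.uniform)
    (f := fun x => f x - Ψ ξ - od x - ev x) (C := K) (Eventually.of_forall hpt)
  simpa using this

end BilliardSystem

/-! ### Hidden and observed velocities -/

variable {k p : ℕ}

@[simp] lemma observed_join (w : EuclideanSpace ℝ (Fin k)) (v : EuclideanSpace ℝ (Fin p ⊕ Unit)) :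
    observed (join w v) = v := by
  ext i; rcases i with i | i <;> simp [observed, join, vec, height]

@[simp] lemma height_join (w : EuclideanSpace ℝ (Fin k)) (v : EuclideanSpace ℝ (Fin p ⊕ Unit)) :
    height (join w v) = height v := by
  simp [join]

lemma join_eq_add (w : EuclideanSpace ℝ (Fin k)) (v : EuclideanSpace ℝ (Fin p ⊕ Unit)) :
    join w v = join 0 v + join w 0 := by
  ext i; rcases i with (i | i) | i <;> simp [join, vec, height]

lemma observed_sub (ξ η : EuclideanSpace ℝ ((Fin k ⊕ Fin p) ⊕ Unit)) :
    observed (ξ - η) = observed ξ - observed η := by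
  ext i; rcases i with i | i <;> simp [observed, vec, height]

lemma join_zero_observed (ξ : EuclideanSpace ℝ ((Fin k ⊕ Fin p) ⊕ Unit)) :
    observed (join (0 : EuclideanSpace ℝ (Fin k)) (observed ξ) - ξ) = 0 := by
  rw [observed_sub, observed_join, sub_self]

lemma norm_join_sq (w : EuclideanSpace ℝ (Fin k)) (v : EuclideanSpace ℝ (Fin p ⊕ Unit)) :
    ‖(join w v : EuclideanSpace ℝ ((Fin k ⊕ Fin p) ⊕ Unit))‖ ^ 2 = ‖w‖ ^ 2 + ‖v‖ ^ 2 := by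
  simp [EuclideanSpace.norm_sq_eq, join, vec, height, add_assoc]

lemma norm_observed_le (ξ : EuclideanSpace ℝ ((Fin k ⊕ Fin p) ⊕ Unit)) : ‖observed ξ‖ ≤ ‖ξ‖ := by
  refine le_of_sq_le_sq ?_ (norm_nonneg _)
  simp only [EuclideanSpace.norm_sq_eq, observed, vec, height, Fintype.sum_sum_type, Sum.elim_inl,
    Sum.elim_inr, add_assoc]
  exact le_add_of_nonneg_left (by positivity)

lemma norm_join_le (w : EuclideanSpace ℝ (Fin k)) (v : EuclideanSpace ℝ (Fin p ⊕ Unit)) :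
    ‖(join w v : EuclideanSpace ℝ ((Fin k ⊕ Fin p) ⊕ Unit))‖ ≤ ‖w‖ + ‖v‖ := by
  refine le_of_sq_le_sq ?_ (by positivity)
  rw [norm_join_sq]
  nlinarith [mul_nonneg (norm_nonneg w) (norm_nonneg v)]

lemma contDiff_observed :
    ContDiff ℝ ∞ (observed : EuclideanSpace ℝ ((Fin k ⊕ Fin p) ⊕ Unit) → _) := by
  rw [contDiff_euclidean]
  rintro (i | i) <;> simp only [observed, vec, height, Sum.elim_inl, Sum.elim_inr] <;> fun_prop

lemma continuous_observed :
    Continuous (observed : EuclideanSpace ℝ ((Fin k ⊕ Fin p) ⊕ Unit) → _) :=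
  contDiff_observed.continuous

lemma continuous_join : Continuous fun z : EuclideanSpace ℝ (Fin k) ×
    EuclideanSpace ℝ (Fin p ⊕ Unit) => join z.1 z.2 := by
  unfold join
  refine Continuous.vec ?_ (by fun_prop)
  refine (PiLp.continuous_toLp 2 _).comp (continuous_pi fun i => ?_)
  rcases i with i | i <;> simp <;> fun_prop

/-! ### Functions of the observed component -/

/-- `G` depends only on the observed component of its argument, and vanishes unless this component
lies in `K`. -/
def ObservedOn {W : Type*} [Zero W] (K : Set (EuclideanSpace ℝ (Fin p ⊕ Unit)))
    (G : EuclideanSpace ℝ ((Fin k ⊕ Fin p) ⊕ Unit) → W) : Prop :=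
  (∀ ξ u, observed u = 0 → G (ξ + u) = G ξ) ∧ ∀ ξ, observed ξ ∉ K → G ξ = 0

namespace ObservedOn

variable {W : Type*} [NormedAddCommGroup W]
  {K : Set (EuclideanSpace ℝ (Fin p ⊕ Unit))}
  {G : EuclideanSpace ℝ ((Fin k ⊕ Fin p) ⊕ Unit) → W}

lemma apply_join_zero (hG : ObservedOn K G) (ξ : EuclideanSpace ℝ ((Fin k ⊕ Fin p) ⊕ Unit)) :
    G (join 0 (observed ξ)) = G ξ := by
  rw [← hG.1 ξ _ (join_zero_observed ξ), add_sub_cancel]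

lemma apply_join (hG : ObservedOn K G) (w : EuclideanSpace ℝ (Fin k))
    (v : EuclideanSpace ℝ (Fin p ⊕ Unit)) : G (join w v) = G (join 0 v) := by
  rw [← hG.apply_join_zero (join w v), observed_join]

/-- The function is constant along hidden directions, hence not compactly supported in general, but
all its values are taken at hidden velocity 0, where compactness of `K` applies. -/
lemma exists_norm_le (hG : ObservedOn K G) (hK : IsCompact K) (hc : Continuous G) :
    ∃ C, 0 ≤ C ∧ ∀ ξ, ‖G ξ‖ ≤ C := by
  have hcont : Continuous fun v => G (join 0 v) :=
    hc.comp (continuous_join.comp (continuous_const.prodMk continuous_id))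
  obtain ⟨C, hC⟩ := hK.exists_bound_of_continuousOn hcont.continuousOn
  refine ⟨max C 0, le_max_right _ _, fun ξ => ?_⟩
  by_cases hξ : observed ξ ∈ K
  · rw [← hG.apply_join_zero]
    exact (hC _ hξ).trans (le_max_left _ _)
  · rw [hG.2 ξ hξ, norm_zero]
    exact le_max_right _ _

variable [NormedSpace ℝ W]

/-- Stability under differentiation lets `exists_norm_le` bound the derivatives of the extended
function of every order. -/
lemma fderiv (hG : ObservedOn K G) (hK : IsClosed K) : ObservedOn K (fderiv ℝ G) := by
  refine ⟨fun ξ u hu => ?_, fun ξ hξ => ?_⟩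
  · have : (fun ξ => G (ξ + u)) = G := funext fun ξ => hG.1 ξ u hu
    rw [← fderiv_comp_add_right u, this]
  · have hev : G =ᶠ[𝓝 ξ] fun _ => 0 := by
      filter_upwards [(hK.isOpen_compl.preimage continuous_observed).mem_nhds hξ] with η hη
      exact hG.2 η hη
    rw [hev.fderiv_eq]
    exact fderiv_const_apply 0

end ObservedOn

lemma observedOn_comp_observed (Φ : EuclideanSpace ℝ (Fin p ⊕ Unit) → ℝ) :
    ObservedOn (k := k) (tsupport Φ) fun ξ => Φ (observed ξ) := by
  refine ⟨fun ξ u hu => ?_, fun ξ hξ => image_eq_zero_of_notMem_tsupport hξ⟩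
  have : observed (ξ + u) = observed ξ := by
    have := observed_sub (ξ + u) u
    rwa [add_sub_cancel_right, hu, sub_zero, eq_comm] at this
  simp only [this]

/-! ### The limit operator as a sum over matrix entries -/

variable (k) in
/-- The function `Φ`, extended to all velocities. -/
def extend (Φ : EuclideanSpace ℝ (Fin p ⊕ Unit) → ℝ) :
    EuclideanSpace ℝ ((Fin k ⊕ Fin p) ⊕ Unit) → ℝ := fun ξ => Φ (observed ξ)

lemma contDiff_extend {Φ : EuclideanSpace ℝ (Fin p ⊕ Unit) → ℝ} (hΦ : ContDiff ℝ ∞ Φ) :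
    ContDiff ℝ ∞ (extend k Φ) := hΦ.comp contDiff_observed

/-- The mean of `evenCoeff` over the hidden velocity. -/
def limitCoeff (C : Matrix ((Fin k ⊕ Fin p) ⊕ Unit) ((Fin k ⊕ Fin p) ⊕ Unit) ℝ)
    (L : EuclideanSpace ℝ ((Fin k ⊕ Fin p) ⊕ Unit) →L[ℝ] ℝ)
    (Q : EuclideanSpace ℝ ((Fin k ⊕ Fin p) ⊕ Unit) →L[ℝ]
      EuclideanSpace ℝ ((Fin k ⊕ Fin p) ⊕ Unit) →L[ℝ] ℝ)
    (ξ : EuclideanSpace ℝ ((Fin k ⊕ Fin p) ⊕ Unit)) (i j : (Fin k ⊕ Fin p) ⊕ Unit) : ℝ :=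
  BilliardSystem.evenCoeff L Q ξ i j + 2 * C i j / height ξ * L (vec 0 1) +
    2 * C i j * Q (vec 0 1) (vec 0 1)

/-- Displays the operator as linear in `Λ`, with the same coefficients as the averaged quadratic
form. Symmetry of `C` and of the Hessian is needed to match the traces, which transpose one factor,
and the mixed Hessian term. -/
lemma limitOperator_eq_sum {C : Matrix ((Fin k ⊕ Fin p) ⊕ Unit) ((Fin k ⊕ Fin p) ⊕ Unit) ℝ}
    (hC : ∀ i j, C i j = C j i) (Λ : Matrix ((Fin k ⊕ Fin p) ⊕ Unit) ((Fin k ⊕ Fin p) ⊕ Unit) ℝ)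
    {Φ : EuclideanSpace ℝ (Fin p ⊕ Unit) → ℝ} (hΦ : ContDiff ℝ ∞ Φ)
    {v : EuclideanSpace ℝ (Fin p ⊕ Unit)} (hv : height v < 0) :
    limitOperator C Λ Φ v = ∑ i, ∑ j, Λ i j *
      limitCoeff C (fderiv ℝ (extend k Φ) (join 0 v))
        (fderiv ℝ (fderiv ℝ (extend k Φ)) (join 0 v)) (join 0 v) i j := by
  set L := fderiv ℝ (extend k Φ) (join 0 v) with hL
  set Q := fderiv ℝ (fderiv ℝ (extend k Φ)) (join 0 v) with hQ
  set ξ := (join 0 v : EuclideanSpace ℝ ((Fin k ⊕ Fin p) ⊕ Unit)) with hξ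
  have ha : height ξ = height v := height_join _ _
  have hsymm : ∀ u u', Q u u' = Q u' u := by
    have := (contDiff_extend (k := k) hΦ).contDiffAt (x := join 0 v)
    exact fun u u' => (this.isSymmSndFDerivAt
      (by rw [minSmoothness_of_isRCLikeNormedField]; exact WithTop.coe_le_coe.2 (le_top : (2 : ℕ∞) ≤ ⊤))).eq u u'
  have hG : ∀ i, grad k Φ v i = L (EuclideanSpace.single i 1) := by
    intro i
    have : inner ℝ (EuclideanSpace.single i (1 : ℝ)) (gradient (extend k Φ) (join 0 v)) =
        L (EuclideanSpace.single i 1) := by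
      rw [real_inner_comm, gradient, InnerProductSpace.toDual_symm_apply]
    rw [← this, EuclideanSpace.inner_single_left]
    simp [grad]
    rfl
  have hH : ∀ i j, hess k Φ v i j =
      Q (EuclideanSpace.single i 1) (EuclideanSpace.single j 1) := by
    intro i j
    rw [hess, Matrix.of_apply, iteratedFDeriv_two_apply]
    rfl
  have he : ∀ u : (Fin k ⊕ Fin p) ⊕ Unit → ℝ, u ⬝ᵥ basisE k p = u (Sum.inr ()) := fun u => by
    simp [basisE]
  have hHe : hess k Φ v *ᵥ basisE k p = fun j => Q (EuclideanSpace.single j 1) (vec 0 1) := by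
    funext j
    simp [basisE, hH, BilliardSystem.vec_zero_one_eq]
  have hv' : ξ (Sum.inr ()) = height v := ha
  have hGe : grad k Φ v (Sum.inr ()) = L (vec 0 1) := by
    rw [hG, BilliardSystem.vec_zero_one_eq]
  have hne := hv.ne
  have t1 : (Λ *ᵥ grad k Φ v) ⬝ᵥ (fun i => ξ i) =
      ∑ i, ∑ j, Λ i j * (ξ i * L (EuclideanSpace.single j 1)) := by
    simp only [dotProduct, Matrix.mulVec, Finset.sum_mul, hG]
    exact Finset.sum_congr rfl fun i _ => Finset.sum_congr rfl fun j _ => by ring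
  have t2 : (Λ *ᵥ fun i => ξ i) ⬝ᵥ (fun i => ξ i) = ∑ i, ∑ j, Λ i j * (ξ i * ξ j) := by
    simp only [dotProduct, Matrix.mulVec, Finset.sum_mul]
    exact Finset.sum_congr rfl fun i _ => Finset.sum_congr rfl fun j _ => by ring
  have t3 : (C * Λ).trace = ∑ i, ∑ j, Λ i j * C i j := by
    simp only [Matrix.trace, Matrix.diag, Matrix.mul_apply]
    rw [Finset.sum_comm]
    exact Finset.sum_congr rfl fun i _ => Finset.sum_congr rfl fun j _ => by
      rw [hC j i, mul_comm]
  have t4 : Λ.trace = ∑ i, ∑ j, Λ i j *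
      (1 : Matrix ((Fin k ⊕ Fin p) ⊕ Unit) ((Fin k ⊕ Fin p) ⊕ Unit) ℝ) i j := by
    simp [Matrix.trace, Matrix.one_apply]
  have t5 : (Λ * hess k Φ v).trace = ∑ i, ∑ j, Λ i j *
      Q (EuclideanSpace.single i 1) (EuclideanSpace.single j 1) := by
    simp only [Matrix.trace, Matrix.diag, Matrix.mul_apply, hH]
    exact Finset.sum_congr rfl fun i _ => Finset.sum_congr rfl fun j _ => by rw [hsymm]
  have t6 : (Λ *ᵥ fun j => Q (EuclideanSpace.single j 1) (vec 0 1)) ⬝ᵥ (fun i => ξ i) =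
      ∑ i, ∑ j, Λ i j * (ξ i * Q (EuclideanSpace.single j 1) (vec 0 1)) := by
    simp only [dotProduct, Matrix.mulVec, Finset.sum_mul]
    exact Finset.sum_congr rfl fun i _ => Finset.sum_congr rfl fun j _ => by ring
  have t7 : Q (EuclideanSpace.single (Sum.inr ()) 1) (vec 0 1) = Q (vec 0 1) (vec 0 1) := by
    simp only [BilliardSystem.vec_zero_one_eq]
  simp only [limitOperator, ← hξ]
  rw [hHe, he, he, he, t1, t2, t3, t4, t5, t6, t7, hv', hGe]
  simp only [Finset.mul_sum, Finset.sum_mul, ← Finset.sum_add_distrib, ← Finset.sum_sub_distrib]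
  refine Finset.sum_congr rfl fun i _ => Finset.sum_congr rfl fun j _ => ?_
  rw [limitCoeff, BilliardSystem.evenCoeff, ha, hsymm (vec 0 1) (EuclideanSpace.single j 1)]
  field_simp
  ring

/-! ### Averaging over the hidden velocity -/

lemma covariance_comm (μ : Measure (EuclideanSpace ℝ (Fin k))) (i j : (Fin k ⊕ Fin p) ⊕ Unit) :
    covariance p μ i j = covariance p μ j i := by
  simp only [covariance, Matrix.of_apply, mul_comm]

section Average

variable {μ : Measure (EuclideanSpace ℝ (Fin k))}

lemma memLp_join_apply {q : ENNReal}
    (hμ : MemLp (fun w : EuclideanSpace ℝ (Fin k) => w) q μ) (i : (Fin k ⊕ Fin p) ⊕ Unit) :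
    MemLp (fun w => (join w 0 : EuclideanSpace ℝ ((Fin k ⊕ Fin p) ⊕ Unit)) i) q μ := by
  refine hμ.of_le ?_ (Eventually.of_forall fun w => ?_)
  · have h : Continuous fun w : EuclideanSpace ℝ (Fin k) =>
        (join w 0 : EuclideanSpace ℝ ((Fin k ⊕ Fin p) ⊕ Unit)) :=
      continuous_join.comp (continuous_id.prodMk continuous_const)
    exact ((by fun_prop : Continuous fun q : EuclideanSpace ℝ ((Fin k ⊕ Fin p) ⊕ Unit) =>
        q i).comp h).aestronglyMeasurable
  · refine (PiLp.norm_apply_le _ i).trans ((norm_join_le w 0).trans ?_)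
    rw [norm_zero, add_zero]

lemma integral_join_apply (hμ : Integrable (fun w : EuclideanSpace ℝ (Fin k) => w) μ)
    (hmean : ∫ w, w ∂μ = 0) (i : (Fin k ⊕ Fin p) ⊕ Unit) :
    ∫ w, (join w 0 : EuclideanSpace ℝ ((Fin k ⊕ Fin p) ⊕ Unit)) i ∂μ = 0 := by
  rcases i with (i | i) | i
  · have h : ∀ w : EuclideanSpace ℝ (Fin k),
        (join w 0 : EuclideanSpace ℝ ((Fin k ⊕ Fin p) ⊕ Unit)) (Sum.inl (Sum.inl i)) =
          EuclideanSpace.proj (𝕜 := ℝ) i w := fun w => by simp [join, vec]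
    simp only [h]
    rw [ContinuousLinearMap.integral_comp_comm _ hμ, hmean, map_zero]
  · simp [join, vec]
  · simp [join, vec, height]

/-- The height does not involve `w`, so `evenCoeff` is a quadratic polynomial in `w`: the linear
terms average to zero and the quadratic one gives the covariance. -/
lemma integral_evenCoeff_join [IsProbabilityMeasure μ]
    (hμ : MemLp (fun w : EuclideanSpace ℝ (Fin k) => w) 2 μ)
    (hmean : ∫ w, w ∂μ = 0) (L : EuclideanSpace ℝ ((Fin k ⊕ Fin p) ⊕ Unit) →L[ℝ] ℝ)
    (Q : EuclideanSpace ℝ ((Fin k ⊕ Fin p) ⊕ Unit) →L[ℝ]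
      EuclideanSpace ℝ ((Fin k ⊕ Fin p) ⊕ Unit) →L[ℝ] ℝ)
    (v : EuclideanSpace ℝ (Fin p ⊕ Unit)) (i j : (Fin k ⊕ Fin p) ⊕ Unit) :
    Integrable (fun w => BilliardSystem.evenCoeff L Q (join w v) i j) μ ∧
      ∫ w, BilliardSystem.evenCoeff L Q (join w v) i j ∂μ =
        limitCoeff (covariance p μ) L Q (join 0 v) i j := by
  have hμ1 : Integrable (fun w : EuclideanSpace ℝ (Fin k) => w) μ := hμ.integrable (by norm_num)
  set ξ := (join 0 v : EuclideanSpace ℝ ((Fin k ⊕ Fin p) ⊕ Unit)) with hξ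
  set u := fun (i : (Fin k ⊕ Fin p) ⊕ Unit) (w : EuclideanSpace ℝ (Fin k)) =>
    (join w 0 : EuclideanSpace ℝ ((Fin k ⊕ Fin p) ⊕ Unit)) i with hu
  have hui : ∀ i, Integrable (u i) μ := fun i => (memLp_join_apply hμ i).integrable (by norm_num)
  have huij : ∀ i j, Integrable (fun w => u i w * u j w) μ := fun i j =>
    (memLp_join_apply hμ i).integrable_mul (memLp_join_apply hμ j)
  have ha : height ξ = height v := height_join _ _
  set α := -4 * L (EuclideanSpace.single j 1) + 2 * ξ j / height v * L (vec 0 1) -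
    2 * height v * (Q (EuclideanSpace.single j 1) (vec 0 1) +
        Q (vec 0 1) (EuclideanSpace.single j 1)) + 2 * ξ j * Q (vec 0 1) (vec 0 1) with hα
  set β := 2 * ξ i / height v * L (vec 0 1) + 2 * ξ i * Q (vec 0 1) (vec 0 1) with hβ
  set γ := 2 / height v * L (vec 0 1) + 2 * Q (vec 0 1) (vec 0 1) with hγ
  have hexp : ∀ w, BilliardSystem.evenCoeff L Q (join w v) i j =
      BilliardSystem.evenCoeff L Q ξ i j + (u i w * α + u j w * β) + u i w * u j w * γ := by
    intro w
    have h1 : ∀ i, (join w v : EuclideanSpace ℝ ((Fin k ⊕ Fin p) ⊕ Unit)) i = ξ i + u i w :=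
      fun i => by rw [join_eq_add]; rfl
    rw [BilliardSystem.evenCoeff, BilliardSystem.evenCoeff, h1, h1, ha, height_join, hα, hβ, hγ]
    ring
  simp only [hexp]
  have i1 : Integrable (fun w => u i w * α) μ := (hui i).mul_const α
  have i2 : Integrable (fun w => u j w * β) μ := (hui j).mul_const β
  have i3 : Integrable (fun w => u i w * u j w * γ) μ := (huij i j).mul_const γ
  have i12 : Integrable (fun w => u i w * α + u j w * β) μ := i1.add i2
  have i012 : Integrable (fun w => BilliardSystem.evenCoeff L Q ξ i j +
      (u i w * α + u j w * β)) μ := (integrable_const _).add i12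
  refine ⟨i012.add i3, ?_⟩
  rw [integral_add i012 i3, integral_add (integrable_const _) i12, integral_add i1 i2,
    integral_mul_const, integral_mul_const, integral_mul_const, hu, integral_join_apply hμ1 hmean,
    integral_join_apply hμ1 hmean, limitCoeff, ha]
  have hcov : ∫ w, (join w 0 : EuclideanSpace ℝ ((Fin k ⊕ Fin p) ⊕ Unit)) i *
    (join w 0 : EuclideanSpace ℝ ((Fin k ⊕ Fin p) ⊕ Unit)) j ∂μ = covariance p μ i j := rfl
  rw [hcov, hγ]
  simp
  ring

end Average

/-! ### The uniform second order estimate -/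

namespace BilliardSystem

variable {d : Type} [Fintype d]

/-- A crude bound, used for hidden velocities so large that the one-collision condition fails. -/
lemma abs_evenTerm_le {L : EuclideanSpace ℝ (d ⊕ Unit) →L[ℝ] ℝ}
    {Q : EuclideanSpace ℝ (d ⊕ Unit) →L[ℝ] EuclideanSpace ℝ (d ⊕ Unit) →L[ℝ] ℝ}
    {ξ b : EuclideanSpace ℝ (d ⊕ Unit)} {ρ ℓ q : ℝ} (hb : ‖b‖ ≤ ρ) (hL : ‖L‖ ≤ ℓ) (hQ : ‖Q‖ ≤ q)
    (hξ : height ξ < 0) :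
    |evenTerm L Q ξ b| ≤ ρ ^ 2 * (4 * ‖ξ‖ * ℓ + 2 * (‖ξ‖ ^ 2 / (-height ξ) + ‖ξ‖) * ℓ +
      8 * q * ‖ξ‖ ^ 2) := by
  have hρ : 0 ≤ ρ := (norm_nonneg b).trans hb
  have hℓ : 0 ≤ ℓ := (norm_nonneg L).trans hL
  have hq : 0 ≤ q := (norm_nonneg Q).trans hQ
  have ha := abs_height_le ξ
  have hapos := neg_pos.2 hξ
  have hs : |inner ℝ b ξ| ≤ ρ * ‖ξ‖ :=
    (abs_real_inner_le_norm _ _).trans (mul_le_mul_of_nonneg_right hb (norm_nonneg _))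
  have hLu : ∀ u, |L u| ≤ ℓ * ‖u‖ := fun u => L.le_of_opNorm_le hL u
  have hLb : |L b| ≤ ℓ * ρ := (hLu b).trans (mul_le_mul_of_nonneg_left hb hℓ)
  have hLe : |L (vec 0 1)| ≤ ℓ := by
    have := hLu (vec 0 1)
    rwa [norm_vec_zero_one, mul_one] at this
  have hQu : ∀ u, |Q u u| ≤ q * ‖u‖ * ‖u‖ := fun u =>
    (Q.le_opNorm₂ u u).trans (by gcongr)
  set u := height ξ • b - inner ℝ b ξ • (vec 0 1 : EuclideanSpace ℝ (d ⊕ Unit)) with hu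
  have hun : ‖u‖ ≤ 2 * (ρ * ‖ξ‖) := by
    refine (norm_sub_le _ _).trans ?_
    rw [norm_smul, norm_smul, norm_vec_zero_one, mul_one, Real.norm_eq_abs, Real.norm_eq_abs]
    have := mul_le_mul ha hb (norm_nonneg _) (norm_nonneg _)
    linarith
  have h1 : |-4 * inner ℝ b ξ * L b| ≤ 4 * (ρ * ‖ξ‖) * (ℓ * ρ) := by
    rw [abs_mul, abs_mul, abs_neg, abs_of_pos (by norm_num : (0 : ℝ) < 4)]
    gcongr
  have h2 : |2 * (inner ℝ b ξ ^ 2 / height ξ - height ξ * ‖b‖ ^ 2) * L (vec 0 1)| ≤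
      2 * ((ρ * ‖ξ‖) ^ 2 / (-height ξ) + ‖ξ‖ * ρ ^ 2) * ℓ := by
    rw [abs_mul, abs_mul, abs_two]
    have h3 : |inner ℝ b ξ ^ 2 / height ξ| ≤ (ρ * ‖ξ‖) ^ 2 / (-height ξ) := by
      rw [abs_div, abs_of_neg hξ, abs_pow]
      gcongr
    have h4 : |height ξ * ‖b‖ ^ 2| ≤ ‖ξ‖ * ρ ^ 2 := by
      rw [abs_mul, abs_of_nonneg (sq_nonneg ‖b‖)]
      gcongr
    have h5 := (abs_sub (inner ℝ b ξ ^ 2 / height ξ) (height ξ * ‖b‖ ^ 2)).trans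
      (add_le_add h3 h4)
    gcongr
  have h3 : |2 * Q u u| ≤ 2 * (q * (2 * (ρ * ‖ξ‖)) * (2 * (ρ * ‖ξ‖))) := by
    rw [abs_mul, abs_two]
    have := hQu u
    have h4 : q * ‖u‖ * ‖u‖ ≤ q * (2 * (ρ * ‖ξ‖)) * (2 * (ρ * ‖ξ‖)) := by gcongr
    linarith
  rw [evenTerm]
  refine (abs_add_le _ _).trans ((add_le_add ((abs_add_le _ _).trans (add_le_add h1 h2)) h3).trans
    (le_of_eq ?_))
  ring

end BilliardSystem

variable {k p : ℕ}

/-- The mean over the torus of `Φ` at the return velocity, for given hidden velocity `w`. -/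
def meanReturn (S : BilliardSystem (Fin k ⊕ Fin p)) (Φ : EuclideanSpace ℝ (Fin p ⊕ Unit) → ℝ)
    (v : EuclideanSpace ℝ (Fin p ⊕ Unit)) (w : EuclideanSpace ℝ (Fin k)) : ℝ :=
  ∫ x, extend k Φ (S.returnVelocity x (join w v)) ∂S.uniform

section Estimate

variable {Φ : EuclideanSpace ℝ (Fin p ⊕ Unit) → ℝ}

lemma abs_meanReturn_le {B : ℝ} (hB : ∀ ξ, |extend k Φ ξ| ≤ B)
    (S : BilliardSystem (Fin k ⊕ Fin p)) (v : EuclideanSpace ℝ (Fin p ⊕ Unit))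
    (w : EuclideanSpace ℝ (Fin k)) : |meanReturn S Φ v w| ≤ B := by
  have := norm_integral_le_of_norm_le_const (μ := S.uniform)
    (f := fun x => extend k Φ (S.returnVelocity x (join w v))) (C := B)
    (Eventually.of_forall fun x => hB _)
  simpa [meanReturn] using this

/-- The purpose of the joint measurability of the return map: with it the outer integral over the
hidden velocity may be split linearly. -/
lemma stronglyMeasurable_meanReturn (hΦ : Continuous Φ) (S : BilliardSystem (Fin k ⊕ Fin p))
    {v : EuclideanSpace ℝ (Fin p ⊕ Unit)} (hv : height v < 0) :
    StronglyMeasurable (meanReturn S Φ v) := by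
  have h1 : Measurable fun w : EuclideanSpace ℝ (Fin k) =>
      (⟨join w v, by rwa [height_join]⟩ :
        {ξ : EuclideanSpace ℝ ((Fin k ⊕ Fin p) ⊕ Unit) // height ξ < 0}) :=
    (continuous_join.comp (continuous_id.prodMk continuous_const)).measurable.subtype_mk
  have h2 : Measurable fun z : EuclideanSpace ℝ (Fin k) × EuclideanSpace ℝ (Fin k ⊕ Fin p) =>
      S.returnVelocity z.2 (join z.1 v) :=
    S.measurable_returnVelocity.comp (measurable_snd.prodMk (h1.comp measurable_fst))
  have h3 : Measurable fun z : EuclideanSpace ℝ (Fin k) × EuclideanSpace ℝ (Fin k ⊕ Fin p) =>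
      extend k Φ (S.returnVelocity z.2 (join z.1 v)) :=
    (hΦ.comp continuous_observed).measurable.comp h2
  exact h3.stronglyMeasurable.integral_prod_right

lemma exists_bounds (hΦ : ContDiff ℝ ∞ Φ) (hc : HasCompactSupport Φ) :
    ∃ B, 0 ≤ B ∧ (∀ ξ, |extend k Φ ξ| ≤ B) ∧ (∀ ξ, ‖fderiv ℝ (extend k Φ) ξ‖ ≤ B) ∧
      (∀ ξ, ‖fderiv ℝ (fderiv ℝ (extend k Φ)) ξ‖ ≤ B) ∧
      ∀ ξ η, ‖fderiv ℝ (fderiv ℝ (extend k Φ)) ξ - fderiv ℝ (fderiv ℝ (extend k Φ)) η‖ ≤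
        B * ‖ξ - η‖ := by
  have hK : IsCompact (tsupport Φ) := hc
  have o0 : ObservedOn (tsupport Φ) (extend k Φ) := observedOn_comp_observed Φ
  have o1 := o0.fderiv hK.isClosed
  have o2 := o1.fderiv hK.isClosed
  have o3 := o2.fderiv hK.isClosed
  have d0 := contDiff_extend (k := k) hΦ
  have d1 : ContDiff ℝ ∞ (fderiv ℝ (extend k Φ)) := d0.fderiv_right (by simp)
  have d2 : ContDiff ℝ ∞ (fderiv ℝ (fderiv ℝ (extend k Φ))) := d1.fderiv_right (by simp)
  have c3 : Continuous (fderiv ℝ (fderiv ℝ (fderiv ℝ (extend k Φ)))) :=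
    d2.continuous_fderiv (by simp)
  obtain ⟨B0, hB0, b0⟩ := o0.exists_norm_le hK d0.continuous
  obtain ⟨B1, hB1, b1⟩ := o1.exists_norm_le hK d1.continuous
  obtain ⟨B2, hB2, b2⟩ := o2.exists_norm_le hK d2.continuous
  obtain ⟨B3, hB3, b3⟩ := o3.exists_norm_le hK c3
  refine ⟨B0 + B1 + B2 + B3, by positivity, fun ξ => (b0 ξ).trans (by linarith),
    fun ξ => (b1 ξ).trans (by linarith), fun ξ => (b2 ξ).trans (by linarith), fun ξ η => ?_⟩
  have := Convex.norm_image_sub_le_of_norm_fderiv_le (𝕜 := ℝ) (s := Set.univ)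
    (fun x _ => d2.differentiable (by simp) x) (fun x _ => b3 x) convex_univ
    (Set.mem_univ η) (Set.mem_univ ξ)
  exact this.trans (mul_le_mul_of_nonneg_right (by linarith) (norm_nonneg _))

lemma exists_support_bounds (hc : HasCompactSupport Φ) (hlow : tsupport Φ ⊆ lowerHalfSpace p) :
    ∃ δ R : ℝ, 0 < δ ∧ 1 ≤ R ∧ ∀ v ∈ tsupport Φ, height v ≤ -δ ∧ ‖v‖ ≤ R := by
  have hK : IsCompact (tsupport Φ) := hc
  obtain ⟨R, hR⟩ := hK.isBounded.exists_norm_le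
  have hδ : ∃ δ : ℝ, 0 < δ ∧ ∀ v ∈ tsupport Φ, height v ≤ -δ := by
    rcases (tsupport Φ).eq_empty_or_nonempty with h | h
    · exact ⟨1, one_pos, by simp [h]⟩
    · obtain ⟨v, hv, hmax⟩ := hK.exists_isMaxOn h continuous_height.continuousOn
      exact ⟨-height v, neg_pos.2 (hlow hv), fun u hu => by rw [neg_neg]; exact hmax hu⟩
  obtain ⟨δ, hδ0, hδ⟩ := hδ
  exact ⟨δ, max R 1, hδ0, le_max_right _ _, fun v hv =>
    ⟨hδ v hv, (hR v hv).trans (le_max_left _ _)⟩⟩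

/-- For velocities steep enough for a single collision this is the Taylor estimate. Otherwise
`√S.flatness * (1 + ‖w‖)` is bounded below, and powers of it absorb the trivial bounds on all terms.
-/
lemma exists_abs_meanReturn_sub_le (hΦ : ContDiff ℝ ∞ Φ) (hc : HasCompactSupport Φ) {δ R : ℝ}
    (hδ : 0 < δ) (hR : 1 ≤ R) :
    ∃ K, 0 ≤ K ∧ ∀ S : BilliardSystem (Fin k ⊕ Fin p), S.Symmetric →
      ∀ v, height v ≤ -δ → ‖v‖ ≤ R → ∀ w : EuclideanSpace ℝ (Fin k),
      |meanReturn S Φ v w - Φ v - ∑ i, ∑ j, S.A i j *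
        BilliardSystem.evenCoeff (fderiv ℝ (extend k Φ) (join 0 v))
          (fderiv ℝ (fderiv ℝ (extend k Φ)) (join 0 v)) (join w v) i j| ≤
        K * √S.flatness ^ 3 * (1 + ‖w‖) ^ 3 := by
  obtain ⟨B, hB0, hB, hB1, hB2, hB3⟩ := exists_bounds (k := k) hΦ hc
  have hK : IsCompact (tsupport Φ) := hc
  have o0 : ObservedOn (tsupport Φ) (extend k Φ) := observedOn_comp_observed Φ
  have o1 := o0.fderiv hK.isClosed
  have o2 := o1.fderiv hK.isClosed
  have hR0 : 0 ≤ R := zero_le_one.trans hR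
  set E := 4 * R * B + 2 * (R ^ 2 / δ + R) * B + 8 * B * R ^ 2 with hE
  have hE0 : 0 ≤ E := by positivity
  refine ⟨(432 * B * R ^ 3 + 36 * B * R ^ 3 / δ + 42 * B * R ^ 2) +
    (2 * B * (16 * R / δ) ^ 3 + E * (16 * R / δ)), by positivity, fun S hS v hv hvR w => ?_⟩
  set ρ := √S.flatness with hρ
  have hρ0 : 0 ≤ ρ := Real.sqrt_nonneg _
  -- The derivatives do not see the hidden component, so they may be taken at the full velocity,
  -- where the expansion is made.
  rw [← o1.apply_join w v, ← o2.apply_join w v]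
  have hΨ : Φ v = extend k Φ (join w v) := by simp [extend]
  rw [hΨ]
  set ξ := (join w v : EuclideanSpace ℝ ((Fin k ⊕ Fin p) ⊕ Unit)) with hξdef
  have hhξ : height ξ = height v := height_join w v
  have hξneg : height ξ < 0 := by rw [hhξ]; linarith
  set N := 1 + ‖w‖ with hN
  have hN1 : 1 ≤ N := by rw [hN]; linarith [norm_nonneg w]
  have hξN : ‖ξ‖ ≤ R * N := by
    refine (norm_join_le w v).trans ?_
    rw [hN]
    nlinarith [norm_nonneg w]
  have hξ0 : 0 ≤ ‖ξ‖ := norm_nonneg _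
  have hdiv : ‖ξ‖ / (-height ξ) ≤ R * N / δ := by
    rw [hhξ]
    have : δ ≤ -height v := by linarith
    gcongr
  have hN2 : N ^ 2 ≤ N ^ 3 := pow_le_pow_right₀ hN1 (by norm_num)
  have hN12 : N ≤ N ^ 2 := by nlinarith
  have hN0 : 0 ≤ N := zero_le_one.trans hN1
  by_cases hsmall : 16 * (ρ * ‖ξ‖) ≤ -height ξ
  · refine (hS.abs_integral_returnVelocity_sub_le hξneg hsmall
      ((contDiff_extend hΦ).of_le (WithTop.coe_le_coe.2 (le_top : (2 : ℕ∞) ≤ ⊤))) hB hB3 hB0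
      (hB2 ξ)).trans ?_
    have h1 : 432 * B * ‖ξ‖ ^ 3 ≤ 432 * B * R ^ 3 * N ^ 3 := by
      calc 432 * B * ‖ξ‖ ^ 3 ≤ 432 * B * (R * N) ^ 3 := by gcongr
        _ = _ := by ring
    have h2 : 36 * B * ‖ξ‖ ^ 2 * (‖ξ‖ / (-height ξ)) ≤ 36 * B * R ^ 3 / δ * N ^ 3 := by
      calc 36 * B * ‖ξ‖ ^ 2 * (‖ξ‖ / (-height ξ)) ≤ 36 * B * (R * N) ^ 2 * (R * N / δ) := by
            have : 0 ≤ ‖ξ‖ / (-height ξ) := div_nonneg hξ0 (neg_pos.2 hξneg).le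
            gcongr
        _ = _ := by ring
    have h3 : 42 * B * ‖ξ‖ ^ 2 ≤ 42 * B * R ^ 2 * N ^ 3 := by
      calc 42 * B * ‖ξ‖ ^ 2 ≤ 42 * B * (R * N) ^ 2 := by gcongr
        _ = 42 * B * R ^ 2 * N ^ 2 := by ring
        _ ≤ _ := by gcongr
    have h4 : 0 ≤ (2 * B * (16 * R / δ) ^ 3 + E * (16 * R / δ)) * N ^ 3 := by positivity
    have h5 := mul_le_mul_of_nonneg_left (add_le_add (add_le_add h1 h2) h3)
      (pow_nonneg hρ0 3)
    refine h5.trans ?_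
    have h6 := mul_nonneg (pow_nonneg hρ0 3) h4
    linarith
  · push Not at hsmall
    -- The quantity that absorbs the bounds: its cube multiplies the bound on the two values of the
    -- function, and its first power supplies the missing factor `ρ * N` for the quadratic form.
    have hT : 1 ≤ ρ * N * (16 * R / δ) := by
      have h1 : δ < 16 * (ρ * (R * N)) := by
        have : 16 * (ρ * ‖ξ‖) ≤ 16 * (ρ * (R * N)) := by gcongr
        rw [hhξ] at hsmall
        linarith
      rw [show ρ * N * (16 * R / δ) = 16 * (ρ * (R * N)) / δ by ring, one_le_div hδ]
      exact h1.le
    have hf := abs_meanReturn_le hB S v w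
    have hev : |∑ i, ∑ j, S.A i j * BilliardSystem.evenCoeff (fderiv ℝ (extend k Φ) ξ)
        (fderiv ℝ (fderiv ℝ (extend k Φ)) ξ) ξ i j| ≤ ρ ^ 2 * (E * N ^ 2) := by
      rw [← S.integral_evenTerm]
      have hpt : ∀ x, ‖BilliardSystem.evenTerm (fderiv ℝ (extend k Φ) ξ)
          (fderiv ℝ (fderiv ℝ (extend k Φ)) ξ) ξ (S.normalBar x)‖ ≤ ρ ^ 2 * (E * N ^ 2) := by
        intro x
        refine (BilliardSystem.abs_evenTerm_le (S.norm_normalBar_le x) (hB1 ξ) (hB2 ξ)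
          hξneg).trans ?_
        gcongr
        rw [hE]
        have e1 : 4 * ‖ξ‖ * B ≤ 4 * R * B * N ^ 2 := by
          calc 4 * ‖ξ‖ * B ≤ 4 * (R * N ^ 2) * B := by
                have := hξN.trans (mul_le_mul_of_nonneg_left hN12 hR0)
                gcongr
            _ = _ := by ring
        have e2 : 2 * (‖ξ‖ ^ 2 / (-height ξ) + ‖ξ‖) * B ≤ 2 * (R ^ 2 / δ + R) * B * N ^ 2 := by
          calc 2 * (‖ξ‖ ^ 2 / (-height ξ) + ‖ξ‖) * B
              = 2 * (‖ξ‖ * (‖ξ‖ / (-height ξ)) + ‖ξ‖) * B := by ring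
            _ ≤ 2 * ((R * N) * (R * N / δ) + R * N ^ 2) * B := by
                have := hξN.trans (mul_le_mul_of_nonneg_left hN12 hR0)
                have h0 : 0 ≤ ‖ξ‖ / (-height ξ) := div_nonneg hξ0 (neg_pos.2 hξneg).le
                gcongr
            _ = _ := by ring
        have e3 : 8 * B * ‖ξ‖ ^ 2 ≤ 8 * B * R ^ 2 * N ^ 2 := by
          calc 8 * B * ‖ξ‖ ^ 2 ≤ 8 * B * (R * N) ^ 2 := by gcongr
            _ = _ := by ring
        linarith
      simpa using norm_integral_le_of_norm_le_const (μ := S.uniform) (Eventually.of_forall hpt)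
    have hΨB := hB ξ
    set T := ρ * N * (16 * R / δ) with hTdef
    have hT3 : 1 ≤ T ^ 3 := one_le_pow₀ hT
    have h1 : 2 * B ≤ 2 * B * (16 * R / δ) ^ 3 * ρ ^ 3 * N ^ 3 := by
      calc 2 * B ≤ 2 * B * T ^ 3 := le_mul_of_one_le_right (by positivity) hT3
        _ = _ := by rw [hTdef]; ring
    have h2 : ρ ^ 2 * (E * N ^ 2) ≤ E * (16 * R / δ) * ρ ^ 3 * N ^ 3 := by
      calc ρ ^ 2 * (E * N ^ 2) ≤ ρ ^ 2 * (E * N ^ 2) * T :=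
            le_mul_of_one_le_right (by positivity) hT
        _ = _ := by rw [hTdef]; ring
    have h3 : 0 ≤ (432 * B * R ^ 3 + 36 * B * R ^ 3 / δ + 42 * B * R ^ 2) * ρ ^ 3 * N ^ 3 := by
      positivity
    refine (abs_sub _ _).trans ((add_le_add ((abs_sub _ _).trans (add_le_add hf hΨB))
      hev).trans ?_)
    linarith

/-- A velocity outside the enlarged region is at distance at least `c * (1 + ‖v‖)` from the support,
whereas a return moves it by at most `4 * √S.flatness * (‖w‖ + ‖v‖)`. Only large `‖w‖` can
contribute, and there the cubic factor exceeds 1. -/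
lemma exists_abs_meanReturn_le (hΦ : ContDiff ℝ ∞ Φ) (hc : HasCompactSupport Φ) {δ R : ℝ}
    (hδ : 0 < δ) (hR : 1 ≤ R) (hsupp : ∀ v ∈ tsupport Φ, height v ≤ -δ ∧ ‖v‖ ≤ R) :
    ∃ K ρ₀ : ℝ, 0 ≤ K ∧ 0 < ρ₀ ∧ ∀ S : BilliardSystem (Fin k ⊕ Fin p), √S.flatness ≤ ρ₀ →
      ∀ v, height v < 0 → ¬ (height v ≤ -(δ / 2) ∧ ‖v‖ ≤ 2 * R) →
      ∀ w : EuclideanSpace ℝ (Fin k),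
      |meanReturn S Φ v w| ≤ K * √S.flatness ^ 3 * (1 + ‖w‖) ^ 3 := by
  obtain ⟨B, hB0, hB, -⟩ := exists_bounds (k := k) hΦ hc
  -- The bound by 1/3 serves `‖v‖ > 2 * R`, where the distance to the support exceeds `‖v‖ / 2` and
  -- `‖v‖ > 2`. The other bound serves shallow `v` with `‖v‖ ≤ 2 * R`, whose height differs by at
  -- least `δ / 2` from those in the support.
  obtain ⟨c, hc0, hc1, hc2⟩ : ∃ c : ℝ, 0 < c ∧ c ≤ 1 / 3 ∧ c * (1 + 2 * R) ≤ δ / 2 := by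
    refine ⟨min (1 / 3) (δ / 2 / (1 + 2 * R)), by positivity, min_le_left _ _, ?_⟩
    rw [← le_div_iff₀ (by positivity)]
    exact min_le_right _ _
  refine ⟨B * (4 / c) ^ 3, c / 8, by positivity, by positivity, fun S hS v hv hfar w => ?_⟩
  set ρ := √S.flatness with hρ
  have hρ0 : 0 ≤ ρ := Real.sqrt_nonneg _
  by_cases hcase : c ≤ 4 * ρ * ‖w‖
  · refine (abs_meanReturn_le hB S v w).trans ?_
    have h1 : 1 ≤ 4 / c * ρ * (1 + ‖w‖) := by
      rw [show 4 / c * ρ * (1 + ‖w‖) = (4 * ρ * (1 + ‖w‖)) / c by ring, one_le_div hc0]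
      nlinarith
    calc B ≤ B * (4 / c * ρ * (1 + ‖w‖)) ^ 3 := le_mul_of_one_le_right hB0 (one_le_pow₀ h1)
      _ = _ := by ring
  · have hzero : ∀ x, extend k Φ (S.returnVelocity x (join w v)) = 0 := by
      intro x
      by_contra hne
      have hmem : observed (S.returnVelocity x (join w v)) ∈ tsupport Φ :=
        subset_tsupport _ hne
      obtain ⟨hη1, hη2⟩ := hsupp _ hmem
      set η := S.returnVelocity x (join w v)
      have hdist : ‖observed η - v‖ ≤ 4 * ρ * (‖w‖ + ‖v‖) := by
        have h1 : observed η - v = observed (η - join w v) := by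
          rw [observed_sub, observed_join]
        rw [h1]
        refine (norm_observed_le _).trans ((S.norm_returnVelocity_sub_le x
          (by rwa [height_join])).trans ?_)
        exact mul_le_mul_of_nonneg_left (norm_join_le w v) (by positivity)
      have hfar' : c * (1 + ‖v‖) ≤ ‖observed η - v‖ := by
        by_cases hvR : ‖v‖ ≤ 2 * R
        · have hvh : -(δ / 2) < height v := by
            by_contra! h
            exact hfar ⟨h, hvR⟩
          have h1 := abs_height_le (observed η - v)
          have h2 := neg_abs_le (height (observed η - v))
          rw [height_sub] at h1 h2
          nlinarith
        · have h1 := norm_sub_norm_le v (observed η)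
          rw [norm_sub_rev] at h1
          nlinarith [norm_nonneg v]
      refine hcase ?_
      nlinarith [norm_nonneg v]
    rw [meanReturn]
    simp only [hzero, integral_zero, abs_zero]
    positivity

/-- The scattering operator is approximated to second order by the operator with the matrix `A` in
the place of the limit, uniformly in the velocity and in the system. -/
lemma exists_abs_scatteringOperator_sub_le {μ : Measure (EuclideanSpace ℝ (Fin k))}
    [IsProbabilityMeasure μ] (hμ : MemLp (fun w : EuclideanSpace ℝ (Fin k) => w) 3 μ)
    (hmean : ∫ w, w ∂μ = 0) (hΦ : ContDiff ℝ ∞ Φ) (hc : HasCompactSupport Φ)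
    (hlow : tsupport Φ ⊆ lowerHalfSpace p) :
    ∃ K ρ₀ : ℝ, 0 ≤ K ∧ 0 < ρ₀ ∧ ∀ S : BilliardSystem (Fin k ⊕ Fin p), S.Symmetric →
      √S.flatness ≤ ρ₀ → ∀ v ∈ lowerHalfSpace p,
      |scatteringOperator S μ Φ v - Φ v - limitOperator (covariance p μ) S.A Φ v| ≤
        K * √S.flatness ^ 3 := by
  obtain ⟨δ, R, hδ, hR, hsupp⟩ := exists_support_bounds hc hlow
  obtain ⟨B, hB0, hB, -⟩ := exists_bounds (k := k) hΦ hc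
  -- The near estimate is taken on the region with `δ / 2` and `2 * R`, exactly the complement
  -- within the half-space of the region of the far estimate.
  obtain ⟨K₁, hK₁, hnear⟩ := exists_abs_meanReturn_sub_le (k := k) hΦ hc (half_pos hδ)
    (by linarith : 1 ≤ 2 * R)
  obtain ⟨K₂, ρ₀, hK₂, hρ₀, hfar⟩ := exists_abs_meanReturn_le (k := k) hΦ hc hδ hR hsupp
  have hμ2 : MemLp (fun w : EuclideanSpace ℝ (Fin k) => w) 2 μ :=
    hμ.mono_exponent (by norm_num)
  have hN : Integrable (fun w : EuclideanSpace ℝ (Fin k) => (1 + ‖w‖) ^ 3) μ := by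
    have h1 : MemLp (fun w : EuclideanSpace ℝ (Fin k) => 1 + ‖w‖) 3 μ :=
      (memLp_const (1 : ℝ)).add hμ.norm
    have h2 := h1.integrable_norm_pow (p := 3) (by norm_num)
    refine h2.congr (Eventually.of_forall fun w => ?_)
    simp only [Real.norm_eq_abs]
    rw [abs_of_nonneg (by positivity)]
  have hKc : IsCompact (tsupport Φ) := hc
  have o0 : ObservedOn (tsupport Φ) (extend k Φ) := observedOn_comp_observed Φ
  have o1 := o0.fderiv hKc.isClosed
  have o2 := o1.fderiv hKc.isClosed
  refine ⟨(K₁ + K₂) * ∫ w, (1 + ‖w‖) ^ 3 ∂μ, ρ₀, ?_, hρ₀, fun S hS hSρ v hv => ?_⟩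
  · exact mul_nonneg (by positivity) (integral_nonneg fun w => by positivity)
  have hv' : height v < 0 := hv
  have hρ0 : 0 ≤ √S.flatness := Real.sqrt_nonneg _
  set L := fderiv ℝ (extend k Φ) (join 0 v) with hL
  set Q := fderiv ℝ (fderiv ℝ (extend k Φ)) (join 0 v) with hQ
  have hpt : ∀ w : EuclideanSpace ℝ (Fin k), ‖meanReturn S Φ v w - Φ v - ∑ i, ∑ j, S.A i j *
      BilliardSystem.evenCoeff L Q (join w v) i j‖ ≤
        (K₁ + K₂) * √S.flatness ^ 3 * (1 + ‖w‖) ^ 3 := by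
    intro w
    rw [Real.norm_eq_abs]
    by_cases hnr : height v ≤ -(δ / 2) ∧ ‖v‖ ≤ 2 * R
    · refine (hnear S hS v hnr.1 hnr.2 w).trans ?_
      gcongr
      linarith
    -- Outside the enlarged region Φ and its derivatives vanish at `v`, so only the mean of the
    -- scattered values remains.
    · have hvn : v ∉ tsupport Φ := fun h => hnr ⟨by linarith [(hsupp v h).1], by
        linarith [(hsupp v h).2]⟩
      have hobs : observed (join (0 : EuclideanSpace ℝ (Fin k)) v) ∉ tsupport Φ := by
        rwa [observed_join]
      have e1 : L = 0 := o1.2 _ hobs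
      have e2 : Q = 0 := o2.2 _ hobs
      have e3 : Φ v = 0 := image_eq_zero_of_notMem_tsupport hvn
      have e4 : ∀ i j, BilliardSystem.evenCoeff L Q (join w v) i j = 0 := fun i j => by
        rw [e1, e2, BilliardSystem.evenCoeff]; simp
      simp only [e3, e4, mul_zero, Finset.sum_const_zero, sub_zero]
      refine (hfar S hSρ v hv' hnr w).trans ?_
      gcongr
      linarith
  have hfint : Integrable (meanReturn S Φ v) μ :=
    Integrable.of_bound (stronglyMeasurable_meanReturn hΦ.continuous S hv').aestronglyMeasurable B
      (Eventually.of_forall fun w => abs_meanReturn_le hB S v w)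
  have hcint : ∀ i j, Integrable (fun w => S.A i j *
      BilliardSystem.evenCoeff L Q (join w v) i j) μ := fun i j =>
    (integral_evenCoeff_join hμ2 hmean L Q v i j).1.const_mul _
  have hsint : Integrable (fun w => ∑ i, ∑ j, S.A i j *
      BilliardSystem.evenCoeff L Q (join w v) i j) μ :=
    integrable_finsetSum _ fun i _ => integrable_finsetSum _ fun j _ => hcint i j
  have hsum : ∫ w, ∑ i, ∑ j, S.A i j * BilliardSystem.evenCoeff L Q (join w v) i j ∂μ =
      limitOperator (covariance p μ) S.A Φ v := by
    rw [limitOperator_eq_sum (covariance_comm μ) S.A hΦ hv',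
      integral_finsetSum _ fun i _ => integrable_finsetSum _ fun j _ => hcint i j]
    refine Finset.sum_congr rfl fun i _ => ?_
    rw [integral_finsetSum _ fun j _ => hcint i j]
    refine Finset.sum_congr rfl fun j _ => ?_
    rw [integral_const_mul, (integral_evenCoeff_join hμ2 hmean L Q v i j).2]
  have hint : scatteringOperator S μ Φ v - Φ v - limitOperator (covariance p μ) S.A Φ v =
      ∫ w, (meanReturn S Φ v w - Φ v - ∑ i, ∑ j, S.A i j *
        BilliardSystem.evenCoeff L Q (join w v) i j) ∂μ := by
    have h1 : Integrable (fun w => meanReturn S Φ v w - Φ v) μ :=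
      hfint.sub (integrable_const _)
    rw [integral_sub h1 hsint, integral_sub hfint (integrable_const _), hsum]
    simp [scatteringOperator, meanReturn, extend]
  rw [hint, ← Real.norm_eq_abs]
  refine (norm_integral_le_of_norm_le (hN.const_mul ((K₁ + K₂) * √S.flatness ^ 3))
    (Eventually.of_forall hpt)).trans (le_of_eq ?_)
  rw [integral_const_mul]
  ring

/-- The coefficients of the limit operator are bounded. -/
lemma continuousOn_coeff_polynomial {X : Type*} [TopologicalSpace X] {s : Set X}
    {x y l m q₁ q₂ q₃ q₄ a b : X → ℝ} {r t : ℝ} (hx : ContinuousOn x s) (hy : ContinuousOn y s)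
    (hl : ContinuousOn l s) (hm : ContinuousOn m s) (h₁ : ContinuousOn q₁ s)
    (h₂ : ContinuousOn q₂ s) (h₃ : ContinuousOn q₃ s) (h₄ : ContinuousOn q₄ s)
    (ha : ContinuousOn a s) (hb : ContinuousOn b s) :
    ContinuousOn (fun v => -4 * x v * l v + 2 * (x v * y v * b v - a v * r) * m v +
      2 * (a v ^ 2 * q₁ v - a v * x v * (q₂ v + q₃ v) + x v * y v * q₄ v) +
      2 * t * b v * m v + 2 * t * q₄ v) s := by
  fun_prop

/-- The coefficients are singular at height 0, but they vanish off the support of Φ, which is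
compact in the open half-space. -/
lemma exists_abs_limitCoeff_le (C : Matrix ((Fin k ⊕ Fin p) ⊕ Unit) ((Fin k ⊕ Fin p) ⊕ Unit) ℝ)
    (hΦ : ContDiff ℝ ∞ Φ) (hc : HasCompactSupport Φ) (hlow : tsupport Φ ⊆ lowerHalfSpace p) :
    ∃ K : ℝ, 0 ≤ K ∧ ∀ v i j, |limitCoeff C (fderiv ℝ (extend k Φ) (join 0 v))
        (fderiv ℝ (fderiv ℝ (extend k Φ)) (join 0 v)) (join 0 v) i j| ≤ K := by
  have hKc : IsCompact (tsupport Φ) := hc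
  have o0 : ObservedOn (tsupport Φ) (extend k Φ) := observedOn_comp_observed Φ
  have o1 := o0.fderiv hKc.isClosed
  have o2 := o1.fderiv hKc.isClosed
  have d0 := contDiff_extend (k := k) hΦ
  have d1 : ContDiff ℝ ∞ (fderiv ℝ (extend k Φ)) := d0.fderiv_right (by simp)
  have hj : Continuous fun v : EuclideanSpace ℝ (Fin p ⊕ Unit) =>
      (join 0 v : EuclideanSpace ℝ ((Fin k ⊕ Fin p) ⊕ Unit)) :=
    continuous_join.comp (continuous_const.prodMk continuous_id)
  have hL : Continuous fun v : EuclideanSpace ℝ (Fin p ⊕ Unit) =>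
      fderiv ℝ (extend k Φ) (join 0 v) := d1.continuous.comp hj
  have hQ : Continuous fun v : EuclideanSpace ℝ (Fin p ⊕ Unit) =>
      fderiv ℝ (fderiv ℝ (extend k Φ)) (join 0 v) :=
    (d1.continuous_fderiv (by simp)).comp hj
  have key : ∀ i j, ∃ K : ℝ, 0 ≤ K ∧ ∀ v, |limitCoeff C (fderiv ℝ (extend k Φ) (join 0 v))
        (fderiv ℝ (fderiv ℝ (extend k Φ)) (join 0 v)) (join 0 v) i j| ≤ K := by
    intro i j
    have hcont : ContinuousOn (fun v => limitCoeff C (fderiv ℝ (extend k Φ) (join 0 v))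
        (fderiv ℝ (fderiv ℝ (extend k Φ)) (join 0 v)) (join 0 v) i j) (tsupport Φ) := by
      have hji : ∀ i, Continuous fun v : EuclideanSpace ℝ (Fin p ⊕ Unit) =>
          (join 0 v : EuclideanSpace ℝ ((Fin k ⊕ Fin p) ⊕ Unit)) i := fun i =>
        (by fun_prop : Continuous fun q : EuclideanSpace ℝ ((Fin k ⊕ Fin p) ⊕ Unit) =>
          q i).comp hj
      have hLu : ∀ u, Continuous fun v : EuclideanSpace ℝ (Fin p ⊕ Unit) =>
          fderiv ℝ (extend k Φ) (join 0 v) u := fun u => hL.clm_apply continuous_const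
      have hQu : ∀ u u', Continuous fun v : EuclideanSpace ℝ (Fin p ⊕ Unit) =>
          fderiv ℝ (fderiv ℝ (extend k Φ)) (join 0 v) u u' := fun u u' =>
        (hQ.clm_apply continuous_const).clm_apply continuous_const
      have hinv : ContinuousOn (fun v : EuclideanSpace ℝ (Fin p ⊕ Unit) => (height v)⁻¹)
          (tsupport Φ) :=
        continuous_height.continuousOn.inv₀ fun v hv => (hlow hv : height v < 0).ne
      have c1 := hji i
      have c2 := hji j
      have c3 := hLu (EuclideanSpace.single j 1)
      have c5 := hQu (EuclideanSpace.single i 1) (EuclideanSpace.single j 1)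
      have c6 := hQu (EuclideanSpace.single j 1) (vec 0 1)
      have c7 := hQu (vec 0 1) (EuclideanSpace.single j 1)
      have c8 := hQu (vec 0 1) (vec 0 1)
      have c9 : Continuous fun v : EuclideanSpace ℝ (Fin p ⊕ Unit) => height v :=
        continuous_height
      simp only [limitCoeff, BilliardSystem.evenCoeff, height_join, div_eq_mul_inv]
      exact continuousOn_coeff_polynomial c1.continuousOn c2.continuousOn c3.continuousOn (hLu _).continuousOn
        c5.continuousOn c6.continuousOn c7.continuousOn c8.continuousOn c9.continuousOn hinv
    obtain ⟨K, hK⟩ := hKc.exists_bound_of_continuousOn hcont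
    refine ⟨max K 0, le_max_right _ _, fun v => ?_⟩
    by_cases hv : v ∈ tsupport Φ
    · exact (hK v hv).trans (le_max_left _ _)
    · have hobs : observed (join (0 : EuclideanSpace ℝ (Fin k)) v) ∉ tsupport Φ := by
        rwa [observed_join]
      rw [o1.2 _ hobs, o2.2 _ hobs, limitCoeff, BilliardSystem.evenCoeff]
      simp
  choose K hK0 hK using key
  refine ⟨∑ i, ∑ j, K i j, Finset.sum_nonneg fun i _ => Finset.sum_nonneg fun j _ => hK0 i j,
    fun v i j => (hK i j v).trans ?_⟩
  exact (Finset.single_le_sum (f := fun j => K i j) (fun j _ => hK0 i j) (Finset.mem_univ j)).trans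
    (Finset.single_le_sum (f := fun i => ∑ j, K i j)
      (fun i _ => Finset.sum_nonneg fun j _ => hK0 i j) (Finset.mem_univ i))

end Estimate

/-! ### The Gaussian covariance -/

section Gaussian

open ProbabilityTheory

lemma gaussian_density_eq_prod (k : ℕ) {σ : ℝ} (hσ : 0 < σ) (w : EuclideanSpace ℝ (Fin k)) :
    Real.exp (-(1 / 2) * ‖w‖ ^ 2 / σ ^ 2) / (2 * Real.pi * σ ^ 2) ^ ((k : ℝ) / 2) =
      ∏ i, gaussianPDFReal 0 (σ.toNNReal ^ 2) (w i) := by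
  have hpos : 0 < 2 * Real.pi * σ ^ 2 := by positivity
  simp only [gaussianPDFReal_def, sub_zero, NNReal.coe_pow, Real.coe_toNNReal σ hσ.le]
  rw [Finset.prod_mul_distrib, ← Real.exp_sum, Finset.prod_const, Finset.card_univ,
    Fintype.card_fin, EuclideanSpace.real_norm_sq_eq, div_eq_inv_mul, inv_pow,
    Real.sqrt_eq_rpow, ← Real.rpow_mul_natCast hpos.le]
  congr 1
  · congr 2
    ring
  · congr 1
    rw [Finset.mul_sum, Finset.sum_div]
    refine Finset.sum_congr rfl fun i _ => ?_
    field_simp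

lemma integral_gaussian_eq (k : ℕ) {σ : ℝ} (hσ : 0 < σ) (f : Fin k → ℝ → ℝ) :
    ∫ w, ∏ l, f l (w l) ∂gaussian k σ =
      ∏ l, ∫ x, f l x ∂gaussianReal 0 (σ.toNNReal ^ 2) := by
  have hv : σ.toNNReal ^ 2 ≠ 0 := (pow_pos (Real.toNNReal_pos.2 hσ) 2).ne'
  have hmeas : Measurable fun w : EuclideanSpace ℝ (Fin k) => ENNReal.ofReal
      (Real.exp (-(1 / 2) * ‖w‖ ^ 2 / σ ^ 2) / (2 * Real.pi * σ ^ 2) ^ ((k : ℝ) / 2)) := by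
    fun_prop
  rw [gaussian, integral_withDensity_eq_integral_toReal_smul hmeas
    (Eventually.of_forall fun _ => ENNReal.ofReal_lt_top)]
  simp_rw [integral_gaussianReal_eq_integral_smul hv, smul_eq_mul]
  rw [← integral_fintype_prod_volume_eq_prod,
    ← (PiLp.volume_preserving_toLp (Fin k)).integral_comp
      (MeasurableEquiv.toLp 2 (Fin k → ℝ)).measurableEmbedding]
  refine integral_congr_ae (Eventually.of_forall fun x => ?_)
  have hw := gaussian_density_eq_prod k hσ (WithLp.toLp 2 x)
  have h0 : 0 ≤ ∏ i, gaussianPDFReal 0 (σ.toNNReal ^ 2) (x i) :=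
    Finset.prod_nonneg fun i _ => gaussianPDFReal_nonneg _ _ _
  simp only [hw, ENNReal.toReal_ofReal h0, Finset.prod_mul_distrib]

lemma integral_gaussian_mul (k : ℕ) {σ : ℝ} (hσ : 0 < σ) (i j : Fin k) :
    ∫ w, w i * w j ∂gaussian k σ = if i = j then σ ^ 2 else 0 := by
  -- Padding with factors 1 gives a product over all coordinates, so the integral factors. For `i ≠
  -- j` the factor of index `i` is the mean of a centred Gaussian.
  have h1 : ∀ w : EuclideanSpace ℝ (Fin k), w i * w j =
      ∏ l, (if l = i then w l else 1) * (if l = j then w l else 1) := fun w => by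
    rw [Finset.prod_mul_distrib]
    simp
  simp_rw [h1]
  rw [integral_gaussian_eq k hσ fun l x => (if l = i then x else 1) * (if l = j then x else 1)]
  by_cases hij : i = j
  · subst hij
    have hvar : ∫ x, x * x ∂gaussianReal 0 (σ.toNNReal ^ 2) = σ ^ 2 := by
      have := variance_fun_id_gaussianReal (μ := 0) (v := σ.toNNReal ^ 2)
      rw [variance_of_integral_eq_zero aemeasurable_id' integral_id_gaussianReal] at this
      simpa only [sq, NNReal.coe_mul, Real.coe_toNNReal σ hσ.le] using this
    rw [if_pos rfl, Finset.prod_eq_single i]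
    · simpa using hvar
    · intro l _ hl
      simp [hl]
    · simp
  · rw [if_neg hij]
    refine Finset.prod_eq_zero (Finset.mem_univ i) ?_
    simp [hij]

lemma covariance_gaussian {k p : ℕ} {σ : ℝ} (hσ : 0 < σ) :
    covariance p (gaussian k σ) = σ ^ 2 • hiddenProjection k p := by
  ext i j
  rcases i with (i | i) | i <;> rcases j with (j | j) | j
  case inl.inl.inl.inl =>
    simp [covariance, hiddenProjection, join, vec, integral_gaussian_mul k hσ,
      Matrix.diagonal_apply]
  all_goals simp [covariance, hiddenProjection, join, vec, height, Matrix.diagonal_apply]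

end Gaussian

/-! ### Dependence of the limit operator on its matrix -/

lemma limitOperator_smul {k p : ℕ} {C : Matrix ((Fin k ⊕ Fin p) ⊕ Unit) ((Fin k ⊕ Fin p) ⊕ Unit) ℝ}
    (hC : ∀ i j, C i j = C j i) (r : ℝ)
    (Λ : Matrix ((Fin k ⊕ Fin p) ⊕ Unit) ((Fin k ⊕ Fin p) ⊕ Unit) ℝ)
    {Φ : EuclideanSpace ℝ (Fin p ⊕ Unit) → ℝ} (hΦ : ContDiff ℝ ∞ Φ)
    {v : EuclideanSpace ℝ (Fin p ⊕ Unit)} (hv : height v < 0) :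
    limitOperator C (r • Λ) Φ v = r * limitOperator C Λ Φ v := by
  simp only [limitOperator_eq_sum hC _ hΦ hv, Finset.mul_sum, Matrix.smul_apply, smul_eq_mul,
    mul_assoc]

/-- Linearity in the matrix and bounded coefficients turn convergence of the entries into uniform
convergence in the velocity. -/
lemma exists_abs_limitOperator_sub_le {k p : ℕ}
    {C : Matrix ((Fin k ⊕ Fin p) ⊕ Unit) ((Fin k ⊕ Fin p) ⊕ Unit) ℝ}
    (hC : ∀ i j, C i j = C j i) {Φ : EuclideanSpace ℝ (Fin p ⊕ Unit) → ℝ} (hΦ : ContDiff ℝ ∞ Φ)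
    (hc : HasCompactSupport Φ) (hlow : tsupport Φ ⊆ lowerHalfSpace p) :
    ∃ K : ℝ, ∀ (Λ Λ' : Matrix ((Fin k ⊕ Fin p) ⊕ Unit) ((Fin k ⊕ Fin p) ⊕ Unit) ℝ),
      ∀ v ∈ lowerHalfSpace p, |limitOperator C Λ Φ v - limitOperator C Λ' Φ v| ≤
        K * ∑ i, ∑ j, |Λ i j - Λ' i j| := by
  obtain ⟨K, -, hK⟩ := exists_abs_limitCoeff_le C hΦ hc hlow
  refine ⟨K, fun Λ Λ' v hv => ?_⟩
  rw [limitOperator_eq_sum hC _ hΦ hv, limitOperator_eq_sum hC _ hΦ hv]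
  simp only [← Finset.sum_sub_distrib, ← sub_mul, Finset.mul_sum]
  refine (Finset.abs_sum_le_sum_abs _ _).trans (Finset.sum_le_sum fun i _ =>
    (Finset.abs_sum_le_sum_abs _ _).trans (Finset.sum_le_sum fun j _ => ?_))
  rw [abs_mul, mul_comm]
  exact mul_le_mul_of_nonneg_right (hK v i j) (abs_nonneg _)

end RandomBilliard

end

theorem theorem4p1 {k p : ℕ}
    -- the law of the hidden velocity: mean zero, finite moments up to order three
    (μ : Measure (EuclideanSpace ℝ (Fin k))) [IsProbabilityMeasure μ]
    (hμ_moments : MemLp (fun w : EuclideanSpace ℝ (Fin k) => w) 3 μ)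
    (hμ_mean : ∫ w, w ∂μ = 0)
    -- a family of symmetric systems whose flatness parameter tends to zero along `l`
    {ι : Type*} (l : Filter ι) (S : ι → RandomBilliard.BilliardSystem (Fin k ⊕ Fin p))
    (hsymm : ∀ i, (S i).Symmetric)
    (hflat : Tendsto (fun i => (S i).flatness) l (𝓝[>] 0))
    -- the limit `Λ` of `A / h` exists
    (Λ : Matrix ((Fin k ⊕ Fin p) ⊕ Unit) ((Fin k ⊕ Fin p) ⊕ Unit) ℝ)
    (hΛ : Tendsto (fun i => (S i).flatness⁻¹ • (S i).A) l (𝓝 Λ)) :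
    (∀ Φ : EuclideanSpace ℝ (Fin p ⊕ Unit) → ℝ,
      ContDiff ℝ ∞ Φ → HasCompactSupport Φ → tsupport Φ ⊆ RandomBilliard.lowerHalfSpace p →
      TendstoUniformlyOn
        (fun i v => (RandomBilliard.scatteringOperator (S i) μ Φ v - Φ v) / (S i).flatness)
        (RandomBilliard.limitOperator (RandomBilliard.covariance p μ) Λ Φ)
        l (RandomBilliard.lowerHalfSpace p)) ∧
    (∀ σ : ℝ, 0 < σ →
      RandomBilliard.covariance p (RandomBilliard.gaussian k σ)
        = σ ^ 2 • RandomBilliard.hiddenProjection k p) := by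
  refine ⟨fun Φ hΦ hc hlow => ?_, fun σ hσ => RandomBilliard.covariance_gaussian hσ⟩
  have hC := RandomBilliard.covariance_comm (p := p) μ
  obtain ⟨K, ρ₀, -, hρ₀, hP⟩ := RandomBilliard.exists_abs_scatteringOperator_sub_le
    hμ_moments hμ_mean hΦ hc hlow
  obtain ⟨K', hL⟩ := RandomBilliard.exists_abs_limitOperator_sub_le hC hΦ hc hlow
  obtain ⟨h0, hpos⟩ := tendsto_nhdsWithin_iff.1 hflat
  have hsqrt : Tendsto (fun i => √(S i).flatness) l (𝓝 0) := by
    simpa [Function.comp_def] using (Real.continuous_sqrt.tendsto 0).comp h0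
  have hentry : Tendsto (fun i => ∑ a, ∑ b, |Λ a b - ((S i).flatness⁻¹ • (S i).A) a b|) l (𝓝 0) := by
    have : Tendsto (fun i => ∑ a, ∑ b, |Λ a b - ((S i).flatness⁻¹ • (S i).A) a b|) l
        (𝓝 (∑ a, ∑ b, |Λ a b - Λ a b|)) :=
      tendsto_finsetSum _ fun a _ => tendsto_finsetSum _ fun b _ =>
        (tendsto_const_nhds.sub (tendsto_pi_nhds.1 (tendsto_pi_nhds.1 hΛ a) b)).abs
    simpa using this
  have herr := (hsqrt.const_mul K).add (hentry.const_mul K')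
  rw [mul_zero, mul_zero, add_zero] at herr
  rw [Metric.tendstoUniformlyOn_iff]
  intro ε hε
  filter_upwards [hpos, hsqrt.eventually (ge_mem_nhds hρ₀),
    herr.eventually (gt_mem_nhds hε)] with i hi hρ hlt v hv
  have hi : 0 < (S i).flatness := hi
  have h1 := hP (S i) (hsymm i) hρ v hv
  have h2 := hL Λ ((S i).flatness⁻¹ • (S i).A) v hv
  rw [RandomBilliard.limitOperator_smul hC _ _ hΦ hv] at h2
  set X := RandomBilliard.scatteringOperator (S i) μ Φ v - Φ v
  set Y := RandomBilliard.limitOperator (RandomBilliard.covariance p μ) (S i).A Φ v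
  set Z := RandomBilliard.limitOperator (RandomBilliard.covariance p μ) Λ Φ v
  -- The error of order h^(3/2) becomes one of order √h after division by h.
  have h3 : |X / (S i).flatness - (S i).flatness⁻¹ * Y| ≤ K * √(S i).flatness := by
    rw [div_eq_inv_mul, ← mul_sub, abs_mul, abs_of_pos (inv_pos.2 hi), inv_mul_le_iff₀ hi]
    calc |X - Y| ≤ K * √(S i).flatness ^ 3 := h1
      _ = √(S i).flatness ^ 2 * (K * √(S i).flatness) := by ring
      _ = (S i).flatness * (K * √(S i).flatness) := by rw [Real.sq_sqrt hi.le]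
  rw [Real.dist_eq]
  calc |Z - X / (S i).flatness|
      = |(Z - (S i).flatness⁻¹ * Y) + ((S i).flatness⁻¹ * Y - X / (S i).flatness)| := by
        rw [sub_add_sub_cancel]
    _ ≤ _ := abs_add_le _ _
    _ ≤ _ := add_le_add h2 ((abs_sub_comm _ _).trans_le h3)
    _ < ε := by linarith
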